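/- **Setting.** Let $d\in\mathbf N$ and let $V:\mathbf R^d\to\mathbf R$ satisfy: 1. $V\in C^5(\mathbf R^d)$; 2. $V$ has finitely many critical points, and $D^2V$ is non-degenerate at each of them; 3. $\inf_{|x|>R}|\nabla V(x)|>0$ for some $R>0$; 4. with $\Psi_\varepsilon(x):=\frac12|\nabla V(x)|^2-\varepsilon\,\Delta V(x)$, there are $C_1,C_2>0$ and $\alpha\in[0,2)$ such that $$\limsup_{\varepsilon\to0}\max\big(|\partial_i\partial_j\partial_k\Psi_\varepsilon(x)|,\,|\Psi_\varepsilon(x)|\big)\le C_1e^{C_2|x|^\alpha}\qquad\text{for all }x\in\mathbf R^d,\ 1\le i,j,k\le d;$$ 5. $V(x)\to\infty$ as $|x|\to\infty$, and $2\Delta V(x)\le|\nabla V(x)|^2$ for all $|x|\ge R$, for some $R>0$; 6. for some $R>0$, $|\nabla V(x_1)|\ge|\nabla V(x_2)|$ whenever $|x_1|\ge|x_2|\ge R$. Fix $x_-,x_+\in\mathbf R^d$, $a>0$ and $\gamma\in(0,\frac12)$. Let $\mathcal H_a$ be the set of pairs $(m,\mathbf A)$ with $m\in H^1(0,1;\mathbf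 R^d)$, $m(0)=x_-$, $m(1)=x_+$, and $\mathbf A\in H^1(0,1;\mathbf R^{d\times d})$ symmetric with $\mathbf A(t)\ge a\,\mathbf I_d$ on $(0,1)$. Write $\mathbf X:\mathbf Y=\operatorname{Tr}(\mathbf X\mathbf Y^T)$, $\|\mathbf A\|_{H^1}^2=\sum_{i,j}\|A_{ij}\|_{H^1(0,1)}^2$, and $(D^3V\cdot\nabla V)_{ij}=\sum_k\partial_k\partial_j\partial_iV\,\partial_kV$. For $\varepsilon>0$ and $(m,\mathbf A)\in\mathcal H_a$ put $\mathbf B_\varepsilon=\varepsilon^{-2}\mathbf A^2-\varepsilon^{-1}\mathbf A'$. Let $\bar\nu_\varepsilon=N\big(0,2(-\partial_t^2+\mathbf B_\varepsilon)^{-1}\big)$ be the centred Gaussian law on continuous paths $z:[0,1]\to\mathbf R^d$ whose covariance operator on $L^2(0,1;\mathbf R^d)$ is $2(-\partial_t^2+\mathbf B_\varepsilon)^{-1}$ with Dirichlet boundary conditions. Let $\mathbf M_\varepsilon$ be the fundamental matrix, $\partial_t\mathbf M_\varepsilon(t,s)=-\varepsilon^{-1}\mathbf A(t)\mathbf M_\varepsilon(t,s)$,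 $\mathbf M_\varepsilon(s,s)=\mathbf I_d$, and $\overline{\mathbf M}_\varepsilon(t)=\mathbf M_\varepsilon(1,t)$. Define $$\begin{aligned}\tilde D_\varepsilon(m,\mathbf A)={}&\frac1{2\varepsilon^2}\mathbb E^{\bar\nu_\varepsilon}\int_0^1\Psi_\varepsilon(z(t)+m(t))\,dt+\frac14\int_0^1|m'(t)|^2dt-\frac14\mathbb E^{\bar\nu_\varepsilon}\int_0^1z(t)^T\mathbf B_\varepsilon(t)z(t)\,dt\\&+\frac1{2\varepsilon}\int_0^1\operatorname{Tr}\mathbf A(t)\,dt+\frac12\log\det\int_0^1\overline{\mathbf M}_\varepsilon(t)\overline{\mathbf M}_\varepsilon(t)^Tdt,\end{aligned}$$ $$F_\varepsilon(m,\mathbf A)=\varepsilon\tilde D_\varepsilon(m,\mathbf A)+\varepsilon^\gamma\|\mathbf A\|_{H^1}^2,\qquad E_\varepsilon(m)=\frac\varepsilon4\int_0^1|m'(t)|^2dt+\frac1{4\varepsilon}\int_0^1|\nabla V(m(t))|^2dt.$$ **Proposition 4.4.** Let $(m_\varepsilon,\mathbf A_\varepsilon)\in\mathcal H_a$ for $\varepsilon>0$,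 with $$\limsup_{\varepsilon\to0}\varepsilon^\gamma\|\mathbf A_\varepsilon\|_{H^1}^2<\infty\quad\text{and}\quad\limsup_{\varepsilon\to0}\|m_\varepsilon\|_{L^\infty(0,1)}<\infty.$$ Then, for all sufficiently small $\varepsilon>0$, the random variables $\int_0^1\Psi_\varepsilon(z+m_\varepsilon)\,dt$ and $\int_0^1z^T\mathbf B_\varepsilon z\,dt$ in the definition of $F_\varepsilon(m_\varepsilon,\mathbf A_\varepsilon)$ are $\bar\nu_\varepsilon$-integrable, and, as $\varepsilon\downarrow0$, $$\begin{aligned}F_\varepsilon(m_\varepsilon,\mathbf A_\varepsilon)={}&E_\varepsilon(m_\varepsilon)+\frac14\int_0^1\big(D^2V(m_\varepsilon(t))-\mathbf A_\varepsilon(t)\big)^2:\mathbf A_\varepsilon^{-1}(t)\,dt\\&+\frac14\int_0^1\big(D^3V(m_\varepsilon(t))\cdot\nabla V(m_\varepsilon(t))\big):\mathbf A_\varepsilon^{-1}(t)\,dt+\varepsilon^\gamma\|\mathbf A_\varepsilon\|_{H^1}^2+\mathcal O(\varepsilon^{1/2}).\end{aligned}$$ -/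

import Mathlib

open MeasureTheory ProbabilityTheory Filter Topology Set
open scoped Matrix Gradient Laplacian InnerProductSpace ContDiff ENNReal NNReal

/-! ## Potentials -/

/-- The Hessian `D²V(x)` as a matrix. -/
noncomputable def hessianMatrix {d : ℕ} (V : EuclideanSpace ℝ (Fin d) → ℝ)
    (x : EuclideanSpace ℝ (Fin d)) : Matrix (Fin d) (Fin d) ℝ :=
  Matrix.of fun i j =>
    iteratedFDeriv ℝ 2 V x ![EuclideanSpace.single i 1, EuclideanSpace.single j 1]

/-- The matrix `D³V(x) · ∇V(x)`, with entries `∑ₖ ∂ₖ∂ⱼ∂ᵢV(x) ∂ₖV(x)`. -/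
noncomputable def thirdDerivGradMatrix {d : ℕ} (V : EuclideanSpace ℝ (Fin d) → ℝ)
    (x : EuclideanSpace ℝ (Fin d)) : Matrix (Fin d) (Fin d) ℝ :=
  Matrix.of fun i j =>
    ∑ k, iteratedFDeriv ℝ 3 V x
      ![EuclideanSpace.single i 1, EuclideanSpace.single j 1, EuclideanSpace.single k 1]
        * (∇ V x) k

/-- `Ψ_ε(x) = ½ |∇V(x)|² - ε ΔV(x)`. -/
noncomputable def pathPotential {d : ℕ} (V : EuclideanSpace ℝ (Fin d) → ℝ) (ε : ℝ)
    (x : EuclideanSpace ℝ (Fin d)) : ℝ :=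
  1 / 2 * ‖∇ V x‖ ^ 2 - ε * (Δ V) x

/-- The standing assumptions on the potential `V`. -/
structure IsAdmissiblePotential {d : ℕ} (V : EuclideanSpace ℝ (Fin d) → ℝ) : Prop where
  contDiff : ContDiff ℝ 5 V
  finite_critical : {x | ∇ V x = 0}.Finite
  nondegenerate : ∀ x, ∇ V x = 0 → (hessianMatrix V x).det ≠ 0
  /-- `inf_{|x| > R} |∇V(x)| > 0` for some `R > 0`. -/
  coercive : ∃ R > 0, ∃ c > 0, ∀ x, R < ‖x‖ → c ≤ ‖∇ V x‖
  growth : ∃ C₁ > 0, ∃ C₂ > 0, ∃ α : ℝ, 0 ≤ α ∧ α < 2 ∧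
    ∀ (x : EuclideanSpace ℝ (Fin d)) (i j k : Fin d),
      limsup (fun ε : ℝ => max
        |iteratedFDeriv ℝ 3 (pathPotential V ε) x
          ![EuclideanSpace.single i 1, EuclideanSpace.single j 1, EuclideanSpace.single k 1]|
        |pathPotential V ε x|) (𝓝[>] 0) ≤ C₁ * Real.exp (C₂ * ‖x‖ ^ α)
  tendsto_atTop : Tendsto V (cocompact (EuclideanSpace ℝ (Fin d))) atTop
  laplacian_le : ∃ R > 0, ∀ x, R ≤ ‖x‖ → 2 * (Δ V) x ≤ ‖∇ V x‖ ^ 2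
  monotone : ∃ R > 0, ∀ x y, R ≤ ‖y‖ → ‖y‖ ≤ ‖x‖ → ‖∇ V y‖ ≤ ‖∇ V x‖

/-! ## Function spaces on `(0,1)` -/

/-- `u ∈ H¹(0,1)`: (the continuous representative of) `u` is absolutely continuous on `[0,1]` and
its a.e. derivative, which is then its weak derivative, is in `L²(0,1)`. -/
def MemH1 {F : Type*} [NormedAddCommGroup F] [NormedSpace ℝ F] (u : ℝ → F) : Prop :=
  AbsolutelyContinuousOnInterval u 0 1 ∧ MemLp (deriv u) 2 (volume.restrict (Ioo 0 1))

/-- `m ∈ H¹(0,1; ℝᵈ)` with `m(0) = x₋` and `m(1) = x₊`. -/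
def MemH1Bdry {d : ℕ} (xm xp : EuclideanSpace ℝ (Fin d)) (m : ℝ → EuclideanSpace ℝ (Fin d)) :
    Prop :=
  MemH1 m ∧ m 0 = xm ∧ m 1 = xp

/-- The space `H¹_a(0,1)` of symmetric-matrix valued `H¹` functions with `A(t) ≥ a I`
(for the continuous representative the bound holds at every `t ∈ [0,1]`). -/
structure MemH1Mat {d : ℕ} (a : ℝ) (A : ℝ → Matrix (Fin d) (Fin d) ℝ) : Prop where
  memH1 : ∀ i j, MemH1 fun t => A t i j
  symm : ∀ t ∈ Icc (0 : ℝ) 1, (A t).IsSymm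
  lower : ∀ t ∈ Icc (0 : ℝ) 1, (A t - a • (1 : Matrix (Fin d) (Fin d) ℝ)).PosSemidef

/-- The entrywise derivative `A'`. -/
noncomputable def matDeriv {d : ℕ} (A : ℝ → Matrix (Fin d) (Fin d) ℝ) (t : ℝ) :
    Matrix (Fin d) (Fin d) ℝ :=
  Matrix.of fun i j => deriv (fun s => A s i j) t

/-- `‖A‖²_{H¹(0,1)} = ∑ᵢⱼ (‖Aᵢⱼ‖²_{L²} + ‖A'ᵢⱼ‖²_{L²})`. -/
noncomputable def h1NormSq {d : ℕ} (A : ℝ → Matrix (Fin d) (Fin d) ℝ) : ℝ :=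
  ∑ i, ∑ j, ((∫ t in (0 : ℝ)..1, A t i j ^ 2) + ∫ t in (0 : ℝ)..1, matDeriv A t i j ^ 2)

/-- `X : Y = Tr(X Yᵀ)`. -/
def frobInner {d : ℕ} (X Y : Matrix (Fin d) (Fin d) ℝ) : ℝ := (X * Yᵀ).trace

/-! ## The fundamental matrix -/

/-- `M(t,s)` is the fundamental matrix of `x' = -ε⁻¹ A(t) x` on `[0,1]`. -/
def IsFundamentalMatrix {d : ℕ} (ε : ℝ) (A : ℝ → Matrix (Fin d) (Fin d) ℝ)
    (M : ℝ → ℝ → Matrix (Fin d) (Fin d) ℝ) : Prop :=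
  ∀ s ∈ Icc (0 : ℝ) 1, M s s = 1 ∧ ∀ t ∈ Icc (0 : ℝ) 1, ∀ i j,
    HasDerivWithinAt (fun r => M r s i j) ((-(ε⁻¹ • (A t * M t s))) i j) (Icc 0 1) t

theorem exists_linear_ode {d : ℕ} (B : ℝ → Matrix (Fin d) (Fin d) ℝ)
    (hB : ∀ i j, ContinuousOn (fun t => B t i j) (Icc 0 1)) (v : Fin d → ℝ) :
    ∃ y : ℝ → Fin d → ℝ, y 0 = v ∧
      ∀ t ∈ Icc (0 : ℝ) 1, HasDerivWithinAt y (B t *ᵥ y t) (Icc 0 1) t := by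
  have hc : ∀ i j, ∃ c, ∀ t ∈ Icc (0 : ℝ) 1, ‖B t i j‖ ≤ c := fun i j =>
    isCompact_Icc.exists_bound_of_continuousOn (hB i j)
  choose c hc using hc
  obtain ⟨k, hk0, hk⟩ : ∃ k : ℝ≥0, 0 ≤ k ∧ ∀ t ∈ Icc (0 : ℝ) 1, ∀ w : Fin d → ℝ,
      ‖B t *ᵥ w‖ ≤ k * ‖w‖ := by
    refine ⟨(∑ i, ∑ j, |c i j|).toNNReal, zero_le, fun t ht w => ?_⟩
    have h0 : 0 ≤ ∑ i, ∑ j, |c i j| := by positivity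
    rw [Real.coe_toNNReal _ h0]
    refine (pi_norm_le_iff_of_nonneg (by positivity)).2 fun i => ?_
    calc ‖(B t *ᵥ w) i‖ ≤ ∑ j, ‖B t i j * w j‖ := norm_sum_le Finset.univ fun j => B t i j * w j
      _ ≤ ∑ j, |c i j| * ‖w‖ := Finset.sum_le_sum fun j _ => by
          rw [norm_mul]
          exact mul_le_mul ((hc i j t ht).trans (le_abs_self _)) (norm_le_pi_norm w j)
            (norm_nonneg _) (abs_nonneg _)
      _ = (∑ j, |c i j|) * ‖w‖ := by rw [Finset.sum_mul]
      _ ≤ _ := mul_le_mul_of_nonneg_right (Finset.single_le_sum (f := fun i => ∑ j, |c i j|)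
            (fun i _ => by positivity) (Finset.mem_univ i)) (norm_nonneg _)
  set R : ℝ≥0 := ‖v‖₊ * (Real.exp k).toNNReal + 1 with hR
  let P : (Fin d → ℝ) → Fin d → ℝ := fun w i => max (-R) (min R (w i))
  have hPn : ∀ w, ‖P w‖ ≤ R := fun w => (pi_norm_le_iff_of_nonneg R.2).2 fun i => by
    rw [Real.norm_eq_abs, abs_le]
    exact ⟨le_max_left _ _, max_le (by linarith [R.2]) (min_le_left _ _)⟩
  have hPle : ∀ w, ‖P w‖ ≤ ‖w‖ := fun w => (pi_norm_le_iff_of_nonneg (norm_nonneg _)).2 fun i => by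
    have h1 := norm_le_pi_norm w i
    rw [Real.norm_eq_abs] at h1 ⊢
    refine le_trans ?_ h1
    have hR0 : (0 : ℝ) ≤ R := R.coe_nonneg
    have h2 := le_abs_self (w i)
    have h3 := neg_abs_le (w i)
    rw [abs_le]
    refine ⟨?_, max_le (by linarith [abs_nonneg (w i)]) ((min_le_right _ _).trans h2)⟩
    exact le_max_of_le_right (le_min (by linarith [abs_nonneg (w i)]) h3)
  have hPid : ∀ w, ‖w‖ ≤ R → P w = w := fun w hw => by
    funext i
    have h1 := (norm_le_pi_norm w i).trans hw
    rw [Real.norm_eq_abs, abs_le] at h1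
    simp only [P]
    rw [min_eq_right h1.2, max_eq_right h1.1]
  have hPL : ∀ w z, ‖P w - P z‖ ≤ ‖w - z‖ := fun w z =>
    (pi_norm_le_iff_of_nonneg (norm_nonneg _)).2 fun i => by
      refine le_trans ?_ (norm_le_pi_norm (w - z) i)
      simp only [P, Pi.sub_apply, Real.norm_eq_abs]
      have h1 := abs_max_sub_max_le_max (-(R : ℝ)) (min R (w i)) (-R) (min R (z i))
      have h2 := abs_min_sub_min_le_max (R : ℝ) (w i) R (z i)
      simp only [sub_self, abs_zero] at h1 h2
      rw [max_eq_right (abs_nonneg (min (R : ℝ) (w i) - min (R : ℝ) (z i)))] at h1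
      rw [max_eq_right (abs_nonneg (w i - z i))] at h2
      exact h1.trans h2
  have hpl : IsPicardLindelof (fun t w => B t *ᵥ P w) (tmin := 0) (tmax := 1)
      ⟨0, by simp⟩ v (k * R) 0 (k * R) k := by
    refine ⟨fun t ht => LipschitzWith.lipschitzOnWith (LipschitzWith.of_dist_le_mul ?_),
      fun w _ => ?_, fun t ht w _ => ?_, by simp⟩
    · intro w z
      rw [dist_eq_norm, dist_eq_norm, ← Matrix.mulVec_sub]
      exact (hk t ht _).trans (by gcongr; exact hPL w z)
    · refine continuousOn_pi.2 fun i => ?_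
      exact continuousOn_finsetSum Finset.univ fun j _ =>
        (hB i j).mul (continuousOn_const (c := P w j))
    · refine (hk t ht _).trans ?_
      push_cast
      gcongr
      exact hPn w
  obtain ⟨y, hy0, hy⟩ := hpl.exists_eq_forall_mem_Icc_hasDerivWithinAt₀
  refine ⟨y, hy0, ?_⟩
  have hb := norm_le_gronwallBound_of_norm_deriv_right_le (f := y)
    (f' := fun t => B t *ᵥ P (y t)) (δ := ‖v‖) (K := k) (ε := 0) (a := 0) (b := 1)
    (fun t ht => (hy t ht).continuousWithinAt)
    (fun t ht => by
      refine (hy t ⟨ht.1, ht.2.le⟩).mono_of_mem_nhdsWithin ?_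
      exact mem_of_superset (Icc_mem_nhdsGE_of_mem ⟨le_rfl, ht.2⟩) (Icc_subset_Icc_left ht.1))
    (by rw [← hy0]) (fun t ht => by
      rw [add_zero]
      exact (hk t ⟨ht.1, ht.2.le⟩ (P (y t))).trans
        (mul_le_mul_of_nonneg_left (hPle (y t)) k.2))
  intro t ht
  have h1 := hb t ht
  rw [gronwallBound_ε0] at h1
  have h2 : ‖y t‖ ≤ R := by
    refine h1.trans ?_
    rw [hR]
    push_cast
    rw [Real.coe_toNNReal _ (Real.exp_pos _).le]
    have : Real.exp (k * (t - 0)) ≤ Real.exp k := Real.exp_le_exp.2 (by nlinarith [ht.1, ht.2, k.2])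
    have := mul_le_mul_of_nonneg_left this (norm_nonneg v)
    linarith
  have h3 : HasDerivWithinAt y (B t *ᵥ P (y t)) (Icc 0 1) t := hy t ht
  rwa [hPid _ h2] at h3

theorem exists_linear_ode_matrix {d : ℕ} (B : ℝ → Matrix (Fin d) (Fin d) ℝ)
    (hB : ∀ i j, ContinuousOn (fun t => B t i j) (Icc 0 1)) :
    ∃ X : ℝ → Matrix (Fin d) (Fin d) ℝ, X 0 = 1 ∧ ∀ t ∈ Icc (0 : ℝ) 1, ∀ i j,
      HasDerivWithinAt (fun r => X r i j) ((B t * X t) i j) (Icc 0 1) t := by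
  choose y hy0 hy using fun j : Fin d => exists_linear_ode B hB (Pi.single j 1)
  refine ⟨fun t => Matrix.of fun i j => y j t i, ?_, fun t ht i j => ?_⟩
  · ext i j
    simp [hy0, Pi.single_apply, Matrix.one_apply]
  · have := hasDerivWithinAt_pi.1 (hy j t ht) i
    simpa [Matrix.mul_apply, Matrix.mulVec, dotProduct] using this

theorem exists_isFundamentalMatrix {d : ℕ} (ε : ℝ) (A : ℝ → Matrix (Fin d) (Fin d) ℝ)
    (hA : ∀ i j, ContinuousOn (fun t => A t i j) (Icc 0 1)) :
    ∃ M, IsFundamentalMatrix ε A M := by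
  obtain ⟨X, hX0, hX⟩ := exists_linear_ode_matrix (fun t => -(ε⁻¹ • A t))
    (fun i j => ((hA i j).const_smul ε⁻¹).neg)
  obtain ⟨Y, hY0, hY⟩ := exists_linear_ode_matrix (fun t => ε⁻¹ • (A t)ᵀ)
    (fun i j => (hA j i).const_smul ε⁻¹)
  have hd : ∀ t ∈ Icc (0 : ℝ) 1, ∀ i j,
      HasDerivWithinAt (fun r => ((Y r)ᵀ * X r) i j) 0 (Icc 0 1) t := by
    intro t ht i j
    have h := HasDerivWithinAt.fun_sum (u := Finset.univ) fun l _ =>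
      (hY t ht l i).mul (hX t ht l j)
    have he : (∑ l, ((ε⁻¹ • (A t)ᵀ * Y t) l i * X t l j
        + Y t l i * (-(ε⁻¹ • A t) * X t) l j)) = 0 := by
      have : (ε⁻¹ • (A t)ᵀ * Y t)ᵀ * X t + (Y t)ᵀ * (-(ε⁻¹ • A t) * X t) = 0 := by
        simp [Matrix.transpose_mul, Matrix.mul_assoc]
      have h2 := congrFun (congrFun this i) j
      rw [Matrix.add_apply, Matrix.mul_apply, Matrix.mul_apply, ← Finset.sum_add_distrib] at h2
      exact h2
    rw [he] at h
    exact h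
  have hYX : ∀ t ∈ Icc (0 : ℝ) 1, (Y t)ᵀ * X t = 1 := by
    intro t ht
    ext i j
    have hcont : ContinuousOn (fun r => ((Y r)ᵀ * X r) i j) (Icc 0 1) :=
      fun r hr => (hd r hr i j).continuousWithinAt
    have := constant_of_has_deriv_right_zero hcont (fun r hr =>
      (hd r ⟨hr.1, hr.2.le⟩ i j).mono_of_mem_nhdsWithin
        (mem_of_superset (Icc_mem_nhdsGE_of_mem ⟨le_rfl, hr.2⟩) (Icc_subset_Icc_left hr.1))) t ht
    simpa [hX0, hY0] using this
  refine ⟨fun t s => X t * (Y s)ᵀ, fun s hs => ⟨mul_eq_one_comm.1 (hYX s hs), fun t ht i j => ?_⟩⟩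
  have h := HasDerivWithinAt.fun_sum (u := Finset.univ) fun l _ =>
    (hX t ht i l).mul_const ((Y s)ᵀ l j)
  have he : (-(ε⁻¹ • (A t * (X t * (Y s)ᵀ)))) i j
      = ∑ l, (-(ε⁻¹ • A t) * X t) i l * (Y s)ᵀ l j := by
    rw [← Matrix.mul_apply]
    simp [Matrix.mul_assoc]
  rw [he]
  exact h

open Classical in
/-- The fundamental matrix `M_ε(t,s)` on `[0,1]`: `∂ₜM(t,s) = -ε⁻¹ A(t) M(t,s)`, `M(s,s) = I`.
It exists for continuous `A` by `exists_isFundamentalMatrix`. -/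
noncomputable def fundamentalMatrix {d : ℕ} (ε : ℝ) (A : ℝ → Matrix (Fin d) (Fin d) ℝ) :
    ℝ → ℝ → Matrix (Fin d) (Fin d) ℝ :=
  if h : ∃ M, IsFundamentalMatrix ε A M then h.choose else 0

theorem isFundamentalMatrix_fundamentalMatrix {d : ℕ} {ε : ℝ}
    {A : ℝ → Matrix (Fin d) (Fin d) ℝ}
    (hA : ∀ i j, ContinuousOn (fun t => A t i j) (Icc 0 1)) :
    IsFundamentalMatrix ε A (fundamentalMatrix ε A) := by
  have h := exists_isFundamentalMatrix ε A hA
  rw [fundamentalMatrix, dif_pos h]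
  exact h.choose_spec

/-- The entrywise integral `∫₀¹ M̄(t) M̄(t)ᵀ dt`, where `M̄(t) = M_ε(1,t)`. -/
noncomputable def fundamentalGram {d : ℕ} (ε : ℝ) (A : ℝ → Matrix (Fin d) (Fin d) ℝ) :
    Matrix (Fin d) (Fin d) ℝ :=
  Matrix.of fun i j =>
    ∫ t in (0 : ℝ)..1, (fundamentalMatrix ε A 1 t * (fundamentalMatrix ε A 1 t)ᵀ) i j

/-! ## The Gaussian law `N(0, 2(-∂ₜ² + B_ε)⁻¹)` on path space -/

/-- `B_ε = ε⁻² A² - ε⁻¹ A'`. -/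
noncomputable def schrodingerPotential {d : ℕ} (ε : ℝ) (A : ℝ → Matrix (Fin d) (Fin d) ℝ)
    (t : ℝ) : Matrix (Fin d) (Fin d) ℝ :=
  (ε ^ 2)⁻¹ • (A t * A t) - ε⁻¹ • matDeriv A t

/-- `u` is the weak solution in `H¹₀(0,1; ℝᵈ)` of `(-∂ₜ² + B_ε) u = g`, that is,
`u = (-∂ₜ² + B_ε)⁻¹ g` for the Dirichlet realisation. -/
structure IsDirichletSolution {d : ℕ} (ε : ℝ) (A : ℝ → Matrix (Fin d) (Fin d) ℝ)
    (g u : ℝ → EuclideanSpace ℝ (Fin d)) : Prop where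
  memH1 : MemH1 u
  zero_left : u 0 = 0
  zero_right : u 1 = 0
  weak : ∀ φ : ℝ → EuclideanSpace ℝ (Fin d), ContDiff ℝ ∞ φ → HasCompactSupport φ →
    tsupport φ ⊆ Ioo 0 1 →
      ∫ t in (0 : ℝ)..1, (inner ℝ (deriv u t) (deriv φ t)
          + (schrodingerPotential ε A t *ᵥ (u t).ofLp) ⬝ᵥ (φ t).ofLp)
        = ∫ t in (0 : ℝ)..1, inner ℝ (g t) (φ t)

/-- Continuous paths `[0,1] → ℝᵈ`, with the supremum norm. -/
abbrev PathSpace (d : ℕ) : Type := C(unitInterval, EuclideanSpace ℝ (Fin d))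

instance (d : ℕ) : MeasurableSpace (PathSpace d) := borel _

instance (d : ℕ) : BorelSpace (PathSpace d) := ⟨rfl⟩

/-- The value `z(t)`, `t ∈ [0,1]`, of a continuous path. -/
noncomputable def pathEval {d : ℕ} (z : PathSpace d) (t : ℝ) : EuclideanSpace ℝ (Fin d) :=
  z (projIcc 0 1 zero_le_one t)

/-- `ν` is the centred Gaussian measure, carried by continuous paths, whose covariance operator on
`L²(0,1; ℝᵈ)` is `Σ = 2(-∂ₜ² + B_ε)⁻¹` with Dirichlet boundary conditions:
`E[⟨f, z⟩ ⟨g, z⟩] = ⟨f, Σ g⟩` for `f, g ∈ L²`. -/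
structure IsBridgeLaw {d : ℕ} (ε : ℝ) (A : ℝ → Matrix (Fin d) (Fin d) ℝ)
    (ν : Measure (PathSpace d)) : Prop where
  gaussian : IsGaussian ν
  mean_zero : ∫ z, z ∂ν = 0
  covariance : ∀ f g u : ℝ → EuclideanSpace ℝ (Fin d),
    MemLp f 2 (volume.restrict (Ioo 0 1)) → MemLp g 2 (volume.restrict (Ioo 0 1)) →
    IsDirichletSolution ε A g u →
      ∫ z, (∫ t in (0 : ℝ)..1, inner ℝ (f t) (pathEval z t))
          * (∫ t in (0 : ℝ)..1, inner ℝ (g t) (pathEval z t)) ∂ν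
        = 2 * ∫ t in (0 : ℝ)..1, inner ℝ (f t) (u t)

/-! ## The functionals -/

/-- `∫₀¹ Ψ_ε(z(t) + m(t)) dt`. -/
noncomputable def pathPotentialIntegral {d : ℕ} (V : EuclideanSpace ℝ (Fin d) → ℝ) (ε : ℝ)
    (m : ℝ → EuclideanSpace ℝ (Fin d)) (z : PathSpace d) : ℝ :=
  ∫ t in (0 : ℝ)..1, pathPotential V ε (pathEval z t + m t)

/-- `∫₀¹ z(t)ᵀ B_ε(t) z(t) dt`. -/
noncomputable def pathQuadraticIntegral {d : ℕ} (ε : ℝ) (A : ℝ → Matrix (Fin d) (Fin d) ℝ)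
    (z : PathSpace d) : ℝ :=
  ∫ t in (0 : ℝ)..1,
    (pathEval z t).ofLp ⬝ᵥ (schrodingerPotential ε A t *ᵥ (pathEval z t).ofLp)

/-- The modified Kullback-Leibler divergence, for `ν` the law `N(0, 2(-∂ₜ² + B_ε)⁻¹)`. -/
noncomputable def modifiedKL {d : ℕ} (V : EuclideanSpace ℝ (Fin d) → ℝ) (ε : ℝ)
    (m : ℝ → EuclideanSpace ℝ (Fin d)) (A : ℝ → Matrix (Fin d) (Fin d) ℝ)
    (ν : Measure (PathSpace d)) : ℝ :=
  1 / (2 * ε ^ 2) * (∫ z, pathPotentialIntegral V ε m z ∂ν)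
    + 1 / 4 * (∫ t in (0 : ℝ)..1, ‖deriv m t‖ ^ 2)
    - 1 / 4 * (∫ z, pathQuadraticIntegral ε A z ∂ν)
    + 1 / (2 * ε) * (∫ t in (0 : ℝ)..1, (A t).trace)
    + 1 / 2 * Real.log (fundamentalGram ε A).det

/-- `F_ε(m, A)` for `(m, A) ∈ H¹_±(0,1) × H¹_a(0,1)`, with `ν` the law `N(0, 2(-∂ₜ² + B_ε)⁻¹)`. -/
noncomputable def functionalF {d : ℕ} (V : EuclideanSpace ℝ (Fin d) → ℝ) (γ ε : ℝ)
    (m : ℝ → EuclideanSpace ℝ (Fin d)) (A : ℝ → Matrix (Fin d) (Fin d) ℝ)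
    (ν : Measure (PathSpace d)) : ℝ :=
  ε * modifiedKL V ε m A ν + ε ^ γ * h1NormSq A

/-- The Ginzburg-Landau (rescaled Freidlin-Wentzell) functional `E_ε(m)`, for `m ∈ H¹_±(0,1)`. -/
noncomputable def functionalE {d : ℕ} (V : EuclideanSpace ℝ (Fin d) → ℝ) (ε : ℝ)
    (m : ℝ → EuclideanSpace ℝ (Fin d)) : ℝ :=
  ε / 4 * (∫ t in (0 : ℝ)..1, ‖deriv m t‖ ^ 2)
    + 1 / (4 * ε) * ∫ t in (0 : ℝ)..1, ‖∇ V (m t)‖ ^ 2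

/-! ## Absolutely continuous functions on the unit interval -/

/-! Everything rests on the covariance of `z(t)` at a single time. The operator factorises as `-∂ₜ²
+ B_ε = (-∂ₜ + ε⁻¹A)(∂ₜ + ε⁻¹A)`, so the Dirichlet problem is solved by two first-order linear
systems. With `X` the fundamental matrix from time `0`, `Y = X⁻¹` and `R(t) = ∫₀ᵗ YYᵀ`, the Green
function gives `Cov z(t) = K(t) - Q(t)`, where `K = 2XRXᵀ` (`freeCov`) belongs to the diffusion `dz
= -ε⁻¹Az dt + √2 dW` started at `0`, and `Q = 2XR R(1)⁻¹RXᵀ ≥ 0` (`bridgeCorr`) accounts for pinning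
it at time `1` (`exists_isDirichletSolution`, `integral_coord_mul_coord`).

Three facts about `K` and `Q` suffice. First, `0 ≤ K ≤ ε/a`. Second, the Lyapunov equation `K' = 2I
- ε⁻¹(AK + KA)` drives `ε⁻¹K` to its equilibrium `A⁻¹`: an energy estimate gives `∫|ε⁻¹K - A⁻¹|² =
O(ε)` (`integral_frobSq_freeCov_sub_inv_le`), and testing the equation against `A` gives
`ε⁻¹∫Tr(A²K) = ∫Tr A` up to small terms. Third, `∫Tr Q = O(ε²)`, because `R(1)⁻¹YYᵀ` integrates to
the identity.

Let `f = ½|∇V|²`, whose Hessian is `S = (D²V)² + D³V·∇V`. A second-order Taylor expansion yields `E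
f(z + m) = f(m) + ½Tr(S(K - Q)) + O(ε^{3/2})`; after division by `2ε` this is the potential part of
`E_ε` plus `¼∫Tr(SA⁻¹)` plus `O(√ε)`. The Laplacian contributes `-½∫ΔV`. The quadratic term
contributes `-¼∫Tr A`, which combines with the explicit `½∫Tr A`. The algebraic identity `(H - A)² :
A⁻¹ = Tr(H²A⁻¹) - 2Tr H + Tr A` assembles these into the claim. The log-determinant costs only
`O(ε|log ε|)`. Errors of size `ε‖A‖²_{H¹}` are `O(√ε)` because `γ < ½`.

The moments come from `E exp(β|z(t)|²) ≤ 1 + 2d` with `β` of order `1/ε`, so integrands of growth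
`e^{c|x|²}` are harmless for small `ε`. The growth assumption takes its limsup at fixed `x`, where
`εΔV` disappears, so it controls `f` only. The growth of `ΔV` is recovered by a Bernstein argument:
Bochner's identity at a maximum of a cut-off multiple of `(ΔV)²` bounds `ΔV` by `f` and `Δf` on a
unit ball (`exists_laplacian_sq_le`). -/

theorem AbsolutelyContinuousOnInterval.continuousOn_unit {E : Type*}
    [SeminormedAddCommGroup E] {u : ℝ → E} (hu : AbsolutelyContinuousOnInterval u 0 1) : ContinuousOn u (Icc 0 1) := by
  rw [← uIcc_of_le (zero_le_one' ℝ)]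
  exact hu.continuousOn

theorem AbsolutelyContinuousOnInterval.ae_hasDerivAt {u : ℝ → ℝ}
    (hu : AbsolutelyContinuousOnInterval u 0 1) :
    ∀ᵐ t, t ∈ Icc (0 : ℝ) 1 → HasDerivAt u (deriv u t) t := by
  filter_upwards [hu.ae_differentiableAt] with t ht h
  exact (ht (by rwa [uIcc_of_le zero_le_one])).hasDerivAt

theorem ae_mem_Ioo_of_ae_mem_Icc {p : ℝ → Prop} (h : ∀ᵐ t, t ∈ Ioo (0 : ℝ) 1 → p t) :
    ∀ᵐ t, t ∈ uIoc (0 : ℝ) 1 → p t := by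
  have h1 : ∀ᵐ t : ℝ, t ≠ 1 := by simp [ae_iff]
  filter_upwards [h, h1] with t ht h1 h2
  rw [uIoc_of_le zero_le_one] at h2
  exact ht ⟨h2.1, lt_of_le_of_ne h2.2 h1⟩

/-- The fundamental theorem of calculus for an absolutely continuous function whose derivative is
known almost everywhere. -/
theorem AbsolutelyContinuousOnInterval.integral_eq_sub_of_ae_hasDerivAt {u u' : ℝ → ℝ}
    (hu : AbsolutelyContinuousOnInterval u 0 1)
    (h : ∀ᵐ t, t ∈ Ioo (0 : ℝ) 1 → HasDerivAt u (u' t) t) :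
    IntervalIntegrable u' volume 0 1 ∧ ∫ t in (0 : ℝ)..1, u' t = u 1 - u 0 := by
  have h1 : ∀ᵐ t, t ∈ uIoc (0 : ℝ) 1 → deriv u t = u' t :=
    (ae_mem_Ioo_of_ae_mem_Icc h).mono fun t ht h => (ht h).deriv
  refine ⟨hu.intervalIntegrable_deriv.congr_ae ?_, ?_⟩
  · rwa [EventuallyEq, ae_restrict_iff' measurableSet_uIoc]
  · rw [← hu.integral_deriv_eq_sub]
    exact (intervalIntegral.integral_congr_ae h1).symm

theorem AbsolutelyContinuousOnInterval.of_hasDerivWithinAt {F : Type*} [NormedAddCommGroup F]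
    [NormedSpace ℝ F] {u u' : ℝ → F}
    (h : ∀ t ∈ Icc (0 : ℝ) 1, HasDerivWithinAt u (u' t) (Icc 0 1) t)
    (hc : ContinuousOn u' (Icc 0 1)) : AbsolutelyContinuousOnInterval u 0 1 := by
  obtain ⟨C, hC⟩ := isCompact_Icc.exists_bound_of_continuousOn hc
  have : LipschitzOnWith C.toNNReal u (uIcc 0 1) := by
    rw [uIcc_of_le zero_le_one]
    refine (convex_Icc 0 1).lipschitzOnWith_of_nnnorm_hasDerivWithin_le h fun t ht => ?_
    rw [← NNReal.coe_le_coe, coe_nnnorm]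
    exact (hC t ht).trans (Real.le_coe_toNNReal C)
  exact this.absolutelyContinuousOnInterval

theorem AbsolutelyContinuousOnInterval.zero {F : Type*} [NormedAddCommGroup F]
    [NormedSpace ℝ F] : AbsolutelyContinuousOnInterval (fun _ => (0 : F)) 0 1 :=
  .of_hasDerivWithinAt (u' := fun _ => 0) (fun t _ => hasDerivWithinAt_const t _ _)
    continuousOn_const

theorem AbsolutelyContinuousOnInterval.fun_sum_unit {ι : Type*} (s : Finset ι) {u : ι → ℝ → ℝ}
    (h : ∀ i ∈ s, AbsolutelyContinuousOnInterval (u i) 0 1) :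
    AbsolutelyContinuousOnInterval (fun t => ∑ i ∈ s, u i t) 0 1 := by
  classical
  induction s using Finset.induction_on with
  | empty => simpa using AbsolutelyContinuousOnInterval.zero
  | insert i s hi ih =>
    simp only [Finset.sum_insert hi]
    exact (h i (by simp)).fun_add (ih fun j hj => h j (by simp [hj]))

/-- A function whose increments are controlled by those of finitely many absolutely continuous
functions is absolutely continuous. -/
theorem AbsolutelyContinuousOnInterval.of_dist_le {ι : Type*} (s : Finset ι) {u : ι → ℝ → ℝ}
    {w : ℝ → ℝ} {c : ℝ} (hu : ∀ i ∈ s, AbsolutelyContinuousOnInterval (u i) 0 1)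
    (h : ∀ x ∈ Icc (0 : ℝ) 1, ∀ y ∈ Icc (0 : ℝ) 1,
      dist (w x) (w y) ≤ c * ∑ i ∈ s, dist (u i x) (u i y)) :
    AbsolutelyContinuousOnInterval w 0 1 := by
  have h1 := (tendsto_finsetSum s fun i hi => hu i hi).const_mul c
  rw [Finset.sum_const_zero, mul_zero] at h1
  refine squeeze_zero' (.of_forall fun E => Finset.sum_nonneg fun _ _ => dist_nonneg) ?_ h1
  filter_upwards [mem_inf_of_right (mem_principal_self _)] with E hE
  rw [Finset.sum_comm, Finset.mul_sum]
  refine Finset.sum_le_sum fun k hk => ?_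
  have h2 := hE.1 k hk
  rw [uIcc_of_le zero_le_one] at h2
  exact h _ h2.1 _ h2.2

/-- The embedding `H¹(0,1) ⊂ L^∞(0,1)`. -/
theorem MemH1.sq_le {u : ℝ → ℝ} (hu : MemH1 u) {t : ℝ} (ht : t ∈ Icc (0 : ℝ) 1) :
    u t ^ 2 ≤ 2 * ((∫ s in (0 : ℝ)..1, u s ^ 2) + ∫ s in (0 : ℝ)..1, deriv u s ^ 2) := by
  have hd2 : IntervalIntegrable (fun s => deriv u s ^ 2) volume 0 1 := by
    rw [intervalIntegrable_iff_integrableOn_Ioo_of_le zero_le_one]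
    exact hu.2.integrable_sq
  have hu2 : IntervalIntegrable (fun s => u s ^ 2) volume 0 1 := by
    refine ContinuousOn.intervalIntegrable ?_
    rw [uIcc_of_le zero_le_one]
    exact hu.1.continuousOn_unit.pow 2
  -- The reference point `s` is arbitrary here; integrating over it at the end replaces `u(s)²` by
  -- `∫u²`.
  have key : ∀ s ∈ Icc (0 : ℝ) 1, u t ^ 2 ≤ 2 * u s ^ 2 + 2 * ∫ r in (0 : ℝ)..1, deriv u r ^ 2 := by
    intro s hs
    have h1 : AbsolutelyContinuousOnInterval u s t := hu.1.mono (by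
      rw [uIcc_of_le (zero_le_one' ℝ)]
      exact uIcc_subset_Icc hs ht)
    have h2 := h1.integral_deriv_eq_sub
    have h3 : (u t - u s) ^ 2 ≤ ∫ r in (0 : ℝ)..1, deriv u r ^ 2 := by
      have hi : IntegrableOn (fun r => |deriv u r|) (Ioc 0 1) := by
        have := hu.1.intervalIntegrable_deriv.abs
        rwa [intervalIntegrable_iff_integrableOn_Ioc_of_le zero_le_one] at this
      have h4 : |u t - u s| ≤ ∫ r in (0 : ℝ)..1, |deriv u r| := by
        rw [← h2, intervalIntegral.integral_of_le zero_le_one]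
        refine (intervalIntegral.norm_integral_le_integral_norm_uIoc (f := deriv u)).trans ?_
        refine setIntegral_mono_set hi (.of_forall fun _ => abs_nonneg _) ?_
        exact (Ioc_subset_Ioc (le_min hs.1 ht.1) (max_le hs.2 ht.2)).eventuallyLE
      set c := ∫ r in (0 : ℝ)..1, |deriv u r|
      -- Cauchy–Schwarz on the unit interval, in the form that the variance of `|u'|` is
      -- nonnegative.
      have h5 : 0 ≤ ∫ r in (0 : ℝ)..1, (|deriv u r| - c) ^ 2 :=
        intervalIntegral.integral_nonneg zero_le_one fun _ _ => sq_nonneg _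
      have h6 : ∫ r in (0 : ℝ)..1, (|deriv u r| - c) ^ 2
          = (∫ r in (0 : ℝ)..1, deriv u r ^ 2) - 2 * c * c + c ^ 2 := by
        have : ∀ r, (|deriv u r| - c) ^ 2 = deriv u r ^ 2 - 2 * c * |deriv u r| + c ^ 2 := by
          intro r; rw [← sq_abs (deriv u r)]; ring
        simp only [this]
        rw [intervalIntegral.integral_add (hd2.sub
            (hu.1.intervalIntegrable_deriv.abs.const_mul _)) (by simp),
          intervalIntegral.integral_sub hd2 (hu.1.intervalIntegrable_deriv.abs.const_mul _),
          intervalIntegral.integral_const_mul]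
        simp [c]
      have h7 : (u t - u s) ^ 2 ≤ c ^ 2 := sq_le_sq' (neg_le_of_abs_le h4) (le_of_abs_le h4)
      nlinarith
    nlinarith [sq_nonneg (u t - 2 * u s)]
  have h8 := intervalIntegral.integral_mono_on zero_le_one (by simp)
    ((hu2.const_mul 2).add (by simp)) key
  rw [intervalIntegral.integral_add (hu2.const_mul 2) (by simp),
    intervalIntegral.integral_const_mul] at h8
  simp at h8
  linarith

/-! ## Calculus of matrix-valued functions -/

/-- Entrywise derivative of a matrix-valued function on the unit interval. -/
def HasMatDeriv {d : ℕ} (X : ℝ → Matrix (Fin d) (Fin d) ℝ) (X' : Matrix (Fin d) (Fin d) ℝ)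
    (t : ℝ) : Prop :=
  ∀ i j, HasDerivWithinAt (fun r => X r i j) (X' i j) (Icc 0 1) t

namespace HasMatDeriv

variable {d : ℕ} {X Z : ℝ → Matrix (Fin d) (Fin d) ℝ} {X' Z' : Matrix (Fin d) (Fin d) ℝ} {t : ℝ}

theorem const (W : Matrix (Fin d) (Fin d) ℝ) : HasMatDeriv (fun _ => W) 0 t :=
  fun _ _ => hasDerivWithinAt_const _ _ _

theorem mul (hX : HasMatDeriv X X' t) (hZ : HasMatDeriv Z Z' t) :
    HasMatDeriv (fun r => X r * Z r) (X' * Z t + X t * Z') t := by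
  intro i j
  have h := HasDerivWithinAt.fun_sum (u := Finset.univ) fun l _ => (hX i l).mul (hZ l j)
  simp only [Matrix.mul_apply, Matrix.add_apply]
  rw [← Finset.sum_add_distrib]
  exact h

theorem transpose (hX : HasMatDeriv X X' t) : HasMatDeriv (fun r => (X r)ᵀ) X'ᵀ t :=
  fun i j => hX j i

theorem sub (hX : HasMatDeriv X X' t) (hZ : HasMatDeriv Z Z' t) :
    HasMatDeriv (fun r => X r - Z r) (X' - Z') t :=
  fun i j => (hX i j).sub (hZ i j)

theorem const_smul (c : ℝ) (hX : HasMatDeriv X X' t) :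
    HasMatDeriv (fun r => c • X r) (c • X') t :=
  fun i j => (hX i j).const_mul c

theorem trace (hX : HasMatDeriv X X' t) :
    HasDerivWithinAt (fun r => (X r).trace) X'.trace (Icc 0 1) t :=
  HasDerivWithinAt.fun_sum (u := Finset.univ) fun i _ => hX i i

theorem dotProduct_mulVec (hX : HasMatDeriv X X' t) (v w : Fin d → ℝ) :
    HasDerivWithinAt (fun r => v ⬝ᵥ (X r *ᵥ w)) (v ⬝ᵥ (X' *ᵥ w)) (Icc 0 1) t := by
  simp only [dotProduct, Matrix.mulVec]
  exact HasDerivWithinAt.fun_sum (u := Finset.univ) fun i _ =>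
    (HasDerivWithinAt.fun_sum (u := Finset.univ) fun j _ => (hX i j).mul_const _).const_mul _

theorem congr_deriv (hX : HasMatDeriv X X' t) (h : X' = Z') : HasMatDeriv X Z' t := h ▸ hX

theorem continuousOn {X' : ℝ → Matrix (Fin d) (Fin d) ℝ}
    (h : ∀ t ∈ Icc (0 : ℝ) 1, HasMatDeriv X (X' t) t) : ContinuousOn X (Icc 0 1) :=
  continuousOn_pi.2 fun i => continuousOn_pi.2 fun j t ht => (h t ht i j).continuousWithinAt

theorem eq_of_deriv_zero (h : ∀ t ∈ Icc (0 : ℝ) 1, HasMatDeriv X 0 t)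
    (ht : t ∈ Icc (0 : ℝ) 1) : X t = X 0 := by
  ext i j
  exact constant_of_has_deriv_right_zero (fun r hr => (h r hr i j).continuousWithinAt)
    (fun r hr => (h r ⟨hr.1, hr.2.le⟩ i j).mono_of_mem_nhdsWithin
      (mem_of_superset (Icc_mem_nhdsGE_of_mem ⟨le_rfl, hr.2⟩) (Icc_subset_Icc_left hr.1))) t ht

end HasMatDeriv

theorem monotoneOn_unit_of_hasDerivWithinAt {u u' : ℝ → ℝ}
    (h : ∀ t ∈ Icc (0 : ℝ) 1, HasDerivWithinAt u (u' t) (Icc 0 1) t)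
    (h0 : ∀ t ∈ Icc (0 : ℝ) 1, 0 ≤ u' t) : MonotoneOn u (Icc 0 1) := by
  refine monotoneOn_of_hasDerivWithinAt_nonneg (f' := u') (convex_Icc 0 1)
    (fun t ht => (h t ht).continuousWithinAt)
    (fun t ht => (h t (interior_subset ht)).mono interior_subset)
    (fun t ht => h0 t (interior_subset ht))

theorem hasDerivWithinAt_unit_integral {φ : ℝ → ℝ} (hφ : ContinuousOn φ (Icc 0 1)) {t : ℝ}
    (ht : t ∈ Icc (0 : ℝ) 1) :
    HasDerivWithinAt (fun s => ∫ r in (0 : ℝ)..s, φ r) (φ t) (Icc 0 1) t := by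
  set ψ := IccExtend (zero_le_one' ℝ) ((Icc 0 1).domRestrict φ)
  have hψ : Continuous ψ := (continuousOn_iff_continuous_domRestrict.1 hφ).Icc_extend'
  have he : ∀ s ∈ Icc (0 : ℝ) 1, ψ s = φ s := fun s hs => IccExtend_of_mem _ _ hs
  have h1 : HasDerivWithinAt (fun s => ∫ r in (0 : ℝ)..s, ψ r) (ψ t) (Icc 0 1) t :=
    (hψ.integral_hasStrictDerivAt 0 t).hasDerivAt.hasDerivWithinAt
  rw [he t ht] at h1
  refine h1.congr_of_mem (fun s hs => ?_) ht
  refine intervalIntegral.integral_congr fun r hr => (he r ?_).symm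
  rw [uIcc_of_le hs.1] at hr
  exact ⟨hr.1, hr.2.trans hs.2⟩

/-- Fundamental theorem of calculus on the unit interval with one-sided derivatives at the
endpoints. -/
theorem integral_unit_eq_sub {u u' : ℝ → ℝ}
    (h : ∀ t ∈ Icc (0 : ℝ) 1, HasDerivWithinAt u (u' t) (Icc 0 1) t)
    (hc : ContinuousOn u' (Icc 0 1)) : ∫ t in (0 : ℝ)..1, u' t = u 1 - u 0 := by
  refine intervalIntegral.integral_eq_sub_of_hasDerivAt_of_le zero_le_one
    (fun t ht => (h t ht).continuousWithinAt)
    (fun t ht => (h t (Ioo_subset_Icc_self ht)).hasDerivAt (Icc_mem_nhds ht.1 ht.2)) ?_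
  refine ContinuousOn.intervalIntegrable ?_
  rwa [uIcc_of_le zero_le_one]

/-! ## Symmetric matrices with two-sided bounds -/

section MatrixBounds

variable {d : ℕ}

theorem dotProduct_self_nonneg_real (v : Fin d → ℝ) : 0 ≤ v ⬝ᵥ v :=
  Finset.sum_nonneg fun i _ => mul_self_nonneg (v i)

theorem Matrix.IsSymm.dotProduct_mulVec_comm {S : Matrix (Fin d) (Fin d) ℝ} (hS : S.IsSymm)
    (v w : Fin d → ℝ) : v ⬝ᵥ (S *ᵥ w) = (S *ᵥ v) ⬝ᵥ w := by
  rw [Matrix.dotProduct_mulVec, ← Matrix.mulVec_transpose, hS.eq]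

/-- Positivity of the form at `κb - Sb`, combined with its upper bound at `Sb`, gives `|Sb|² ≤ κ
b·Sb`; the upper bound at `b` finishes. No spectral theorem is needed. -/
theorem Matrix.mulVec_dotProduct_self_le {S : Matrix (Fin d) (Fin d) ℝ} (hS : S.IsSymm) {κ : ℝ}
    (hκ : 0 < κ) (h0 : ∀ v, 0 ≤ v ⬝ᵥ (S *ᵥ v)) (h1 : ∀ v, v ⬝ᵥ (S *ᵥ v) ≤ κ * (v ⬝ᵥ v))
    (b : Fin d → ℝ) : (S *ᵥ b) ⬝ᵥ (S *ᵥ b) ≤ κ ^ 2 * (b ⬝ᵥ b) := by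
  have h2 := h0 (κ • b - S *ᵥ b)
  have h3 := h1 (S *ᵥ b)
  have h4 := h1 b
  simp only [Matrix.mulVec_sub, Matrix.mulVec_smul, dotProduct_sub, sub_dotProduct,
    dotProduct_smul, smul_dotProduct, smul_eq_mul] at h2
  have h5 : b ⬝ᵥ (S *ᵥ (S *ᵥ b)) = (S *ᵥ b) ⬝ᵥ (S *ᵥ b) := hS.dotProduct_mulVec_comm _ _
  rw [h5] at h2
  have h6 : κ * ((S *ᵥ b) ⬝ᵥ (S *ᵥ b)) ≤ κ * (κ * (b ⬝ᵥ (S *ᵥ b))) := by nlinarith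
  have h7 := le_of_mul_le_mul_left h6 hκ
  nlinarith

theorem Matrix.PosSemidef.dotProduct_nonneg {S : Matrix (Fin d) (Fin d) ℝ} (hS : S.PosSemidef)
    (v : Fin d → ℝ) : 0 ≤ v ⬝ᵥ (S *ᵥ v) := by
  have := hS.dotProduct_mulVec_nonneg v
  simpa using this

theorem Matrix.posSemidef_of_isSymm {S : Matrix (Fin d) (Fin d) ℝ} (hS : S.IsSymm)
    (h : ∀ v, 0 ≤ v ⬝ᵥ (S *ᵥ v)) : S.PosSemidef :=
  Matrix.PosSemidef.of_dotProduct_mulVec_nonneg (by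
    rw [Matrix.IsHermitian, Matrix.conjTranspose_eq_transpose_of_trivial]; exact hS) (by simpa using h)

open scoped MatrixOrder in
theorem Matrix.PosSemidef.exists_eq_transpose_mul_self {S : Matrix (Fin d) (Fin d) ℝ}
    (hS : S.PosSemidef) : ∃ B : Matrix (Fin d) (Fin d) ℝ, S = Bᵀ * B := by
  obtain ⟨B, hB⟩ := CStarAlgebra.nonneg_iff_eq_star_mul_self.mp hS.nonneg
  exact ⟨B, by rw [hB, Matrix.star_eq_conjTranspose, Matrix.conjTranspose_eq_transpose_of_trivial]⟩

/-- The squared Frobenius norm. -/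
def frobSq (W : Matrix (Fin d) (Fin d) ℝ) : ℝ := ∑ i, ∑ j, W i j ^ 2

theorem frobSq_nonneg (W : Matrix (Fin d) (Fin d) ℝ) : 0 ≤ frobSq W := by
  unfold frobSq; positivity

theorem frobSq_eq_sum_col (W : Matrix (Fin d) (Fin d) ℝ) :
    frobSq W = ∑ j, (fun i => W i j) ⬝ᵥ (fun i => W i j) := by
  simp only [frobSq, dotProduct]
  rw [Finset.sum_comm]
  simp [sq]

theorem frobSq_transpose (W : Matrix (Fin d) (Fin d) ℝ) : frobSq Wᵀ = frobSq W := by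
  simp only [frobSq, Matrix.transpose_apply]
  exact Finset.sum_comm

theorem frobSq_mul_le {S : Matrix (Fin d) (Fin d) ℝ} {κ : ℝ}
    (h : ∀ b, (S *ᵥ b) ⬝ᵥ (S *ᵥ b) ≤ κ * (b ⬝ᵥ b)) (W : Matrix (Fin d) (Fin d) ℝ) :
    frobSq (S * W) ≤ κ * frobSq W := by
  rw [frobSq_eq_sum_col, frobSq_eq_sum_col, Finset.mul_sum]
  exact Finset.sum_le_sum fun j _ => h fun i => W i j

theorem frobSq_eq_trace (W : Matrix (Fin d) (Fin d) ℝ) : frobSq W = (Wᵀ * W).trace := by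
  rw [frobSq_eq_sum_col]
  rfl

theorem abs_apply_sq_le_frobSq (W : Matrix (Fin d) (Fin d) ℝ) (i j : Fin d) :
    W i j ^ 2 ≤ frobSq W :=
  (Finset.single_le_sum (f := fun j => W i j ^ 2) (fun _ _ => sq_nonneg _)
    (Finset.mem_univ j)).trans (Finset.single_le_sum (f := fun i => ∑ j, W i j ^ 2)
    (fun _ _ => Finset.sum_nonneg fun _ _ => sq_nonneg _) (Finset.mem_univ i))

theorem abs_trace_mul_le (W Z : Matrix (Fin d) (Fin d) ℝ) :
    |(W * Z).trace| ≤ ∑ i, ∑ j, |W i j| * |Z j i| := by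
  refine (Finset.abs_sum_le_sum_abs _ _).trans (Finset.sum_le_sum fun i _ => ?_)
  rw [Matrix.diag_apply, Matrix.mul_apply]
  refine (Finset.abs_sum_le_sum_abs _ _).trans (Finset.sum_le_sum fun j _ => ?_)
  rw [abs_mul]

/-- Entries of a positive semidefinite matrix are bounded by its trace. -/
theorem Matrix.PosSemidef.abs_apply_le_trace {S : Matrix (Fin d) (Fin d) ℝ} (hS : S.PosSemidef)
    (i j : Fin d) : |S i j| ≤ S.trace := by
  have hs : S j i = S i j := by
    have := hS.1.apply i j
    simpa using this
  -- Positivity tested at `eᵢ ± eⱼ`.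
  have key : ∀ c : ℝ, c ^ 2 = 1 → 0 ≤ S i i + S j j + 2 * c * S i j := by
    intro c hc
    have := hS.dotProduct_nonneg (Pi.single i 1 + c • Pi.single j 1)
    simp only [Matrix.mulVec_add, Matrix.mulVec_smul, add_dotProduct, dotProduct_add,
      dotProduct_smul, smul_dotProduct, smul_eq_mul, Matrix.mulVec_single_one,
      single_dotProduct, Matrix.col_apply, one_mul, hs] at this
    linear_combination this + S j j * hc
  have h1 := key 1 (by norm_num)
  have h2 := key (-1) (by norm_num)
  have hd : ∀ k, S k k ≤ S.trace := fun k => Finset.single_le_sum (f := fun k => S k k)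
    (fun k _ => hS.diag_nonneg) (Finset.mem_univ k)
  have := hd i
  have := hd j
  rw [abs_le]
  constructor <;> linarith

end MatrixBounds

/-! ## The fundamental system of `x' = -ε⁻¹ A x` and the bridge covariance -/

/-- `X` is the fundamental matrix from time `0` and `Y` its inverse. -/
structure IsFundamentalPair {d : ℕ} (ε : ℝ) (A X Y : ℝ → Matrix (Fin d) (Fin d) ℝ) : Prop where
  left_zero : X 0 = 1
  left_deriv : ∀ t ∈ Icc (0 : ℝ) 1, HasMatDeriv X (-(ε⁻¹ • (A t * X t))) t
  right_deriv : ∀ t ∈ Icc (0 : ℝ) 1, HasMatDeriv Y (ε⁻¹ • (Y t * A t)) t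
  right_mul_left : ∀ t ∈ Icc (0 : ℝ) 1, Y t * X t = 1

/-- `Y` is built from the adjoint equation, so `Y(t)M(t,s)` has zero derivative in `t`. This
constancy yields both `YX = 1` and the factorisation `M(1,t) = X(1)Y(t)`. -/
theorem exists_isFundamentalPair {d : ℕ} (ε : ℝ) {A : ℝ → Matrix (Fin d) (Fin d) ℝ}
    (hA : ∀ i j, ContinuousOn (fun t => A t i j) (Icc 0 1)) :
    ∃ X Y, IsFundamentalPair ε A X Y ∧
      ∀ t ∈ Icc (0 : ℝ) 1, fundamentalMatrix ε A 1 t = X 1 * Y t := by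
  have hM := isFundamentalMatrix_fundamentalMatrix (ε := ε) hA
  obtain ⟨Z, hZ0, hZ⟩ := exists_linear_ode_matrix (fun t => ε⁻¹ • (A t)ᵀ)
    (fun i j => (hA j i).const_smul ε⁻¹)
  have hY : ∀ t ∈ Icc (0 : ℝ) 1, HasMatDeriv (fun t => (Z t)ᵀ) (ε⁻¹ • ((Z t)ᵀ * A t)) t := by
    intro t ht
    refine (HasMatDeriv.transpose (X' := ε⁻¹ • (A t)ᵀ * Z t) (hZ t ht)).congr_deriv ?_
    simp [Matrix.transpose_mul]
  have hconst : ∀ s ∈ Icc (0 : ℝ) 1, ∀ t ∈ Icc (0 : ℝ) 1,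
      (Z t)ᵀ * fundamentalMatrix ε A t s = fundamentalMatrix ε A 0 s := by
    intro s hs t ht
    have := HasMatDeriv.eq_of_deriv_zero (X := fun r => (Z r)ᵀ * fundamentalMatrix ε A r s)
      (fun r hr => ((hY r hr).mul ((hM s hs).2 r hr)).congr_deriv (by simp [Matrix.mul_assoc])) ht
    simpa [hZ0] using this
  have h0 : (0 : ℝ) ∈ Icc (0 : ℝ) 1 := by simp
  have h1 : (1 : ℝ) ∈ Icc (0 : ℝ) 1 := by simp
  have hYX : ∀ t ∈ Icc (0 : ℝ) 1, (Z t)ᵀ * fundamentalMatrix ε A t 0 = 1 := fun t ht => by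
    rw [hconst 0 h0 t ht, (hM 0 h0).1]
  refine ⟨fun t => fundamentalMatrix ε A t 0, fun t => (Z t)ᵀ,
    ⟨(hM 0 h0).1, (hM 0 h0).2, hY, hYX⟩, fun t ht => ?_⟩
  have h2 : (Z 1)ᵀ * fundamentalMatrix ε A 1 t = (Z t)ᵀ := by
    rw [hconst t ht 1 h1, ← hconst t ht t ht, (hM t ht).1, Matrix.mul_one]
  show _ = fundamentalMatrix ε A 1 0 * (Z t)ᵀ
  rw [← h2, ← Matrix.mul_assoc, mul_eq_one_comm.1 (hYX 1 h1), Matrix.one_mul]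

/-- `∫₀ᵗ Y(r) Y(r)ᵀ dr`. -/
noncomputable def gramIntegral {d : ℕ} (Y : ℝ → Matrix (Fin d) (Fin d) ℝ) (t : ℝ) :
    Matrix (Fin d) (Fin d) ℝ :=
  Matrix.of fun i j => ∫ r in (0 : ℝ)..t, (Y r * (Y r)ᵀ) i j

/-- The covariance of the Ornstein-Uhlenbeck type process started at `0`. -/
noncomputable def freeCov {d : ℕ} (X Y : ℝ → Matrix (Fin d) (Fin d) ℝ) (t : ℝ) :
    Matrix (Fin d) (Fin d) ℝ :=
  (2 : ℝ) • (X t * gramIntegral Y t * (X t)ᵀ)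

/-- The correction to `freeCov` due to conditioning on the endpoint. -/
noncomputable def bridgeCorr {d : ℕ} (X Y : ℝ → Matrix (Fin d) (Fin d) ℝ) (t : ℝ) :
    Matrix (Fin d) (Fin d) ℝ :=
  (2 : ℝ) • (X t * gramIntegral Y t * (gramIntegral Y 1)⁻¹ * gramIntegral Y t * (X t)ᵀ)

namespace IsFundamentalPair

variable {d : ℕ} {ε : ℝ} {A X Y : ℝ → Matrix (Fin d) (Fin d) ℝ}

theorem left_mul_right (h : IsFundamentalPair ε A X Y) {t : ℝ} (ht : t ∈ Icc (0 : ℝ) 1) :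
    X t * Y t = 1 :=
  mul_eq_one_comm.1 (h.right_mul_left t ht)

theorem right_zero (h : IsFundamentalPair ε A X Y) : Y 0 = 1 := by
  have := h.right_mul_left 0 (by simp)
  rwa [h.left_zero, Matrix.mul_one] at this

theorem continuousOn_left (h : IsFundamentalPair ε A X Y) : ContinuousOn X (Icc 0 1) :=
  HasMatDeriv.continuousOn h.left_deriv

theorem continuousOn_right (h : IsFundamentalPair ε A X Y) : ContinuousOn Y (Icc 0 1) :=
  HasMatDeriv.continuousOn h.right_deriv

theorem hasMatDeriv_gramIntegral (h : IsFundamentalPair ε A X Y) {t : ℝ}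
    (ht : t ∈ Icc (0 : ℝ) 1) : HasMatDeriv (gramIntegral Y) (Y t * (Y t)ᵀ) t := by
  intro i j
  have hc : ContinuousOn (fun r => Y r * (Y r)ᵀ) (Icc 0 1) :=
    h.continuousOn_right.mul (continuous_id.matrix_transpose.comp_continuousOn h.continuousOn_right)
  exact hasDerivWithinAt_unit_integral (continuousOn_pi.1 (continuousOn_pi.1 hc i) j) ht

theorem gramIntegral_zero : gramIntegral Y 0 = 0 := by
  ext i j
  simp [gramIntegral]

theorem isSymm_gramIntegral (t : ℝ) : (gramIntegral Y t).IsSymm := by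
  ext i j
  simp only [gramIntegral, Matrix.transpose_apply, Matrix.of_apply, Matrix.mul_apply]
  simp only [mul_comm]

theorem isSymm_freeCov (t : ℝ) : (freeCov X Y t).IsSymm := by
  simp [Matrix.IsSymm, freeCov, Matrix.transpose_mul, (isSymm_gramIntegral t).eq, Matrix.mul_assoc]

theorem isSymm_bridgeCorr (t : ℝ) : (bridgeCorr X Y t).IsSymm := by
  simp [Matrix.IsSymm, bridgeCorr, Matrix.transpose_mul, (isSymm_gramIntegral t).eq,
    Matrix.mul_assoc, Matrix.transpose_nonsing_inv, (isSymm_gramIntegral (Y := Y) 1).eq]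

theorem continuousOn_gramIntegral (h : IsFundamentalPair ε A X Y) :
    ContinuousOn (gramIntegral Y) (Icc 0 1) :=
  HasMatDeriv.continuousOn fun _ ht => h.hasMatDeriv_gramIntegral ht

theorem fundamentalGram_eq (h : IsFundamentalPair ε A X Y)
    (hM : ∀ t ∈ Icc (0 : ℝ) 1, fundamentalMatrix ε A 1 t = X 1 * Y t) :
    fundamentalGram ε A = X 1 * gramIntegral Y 1 * (X 1)ᵀ := by
  have h1 : (1 : ℝ) ∈ Icc (0 : ℝ) 1 := by simp
  have hd : ∀ t ∈ Icc (0 : ℝ) 1, HasMatDeriv (fun r => X 1 * gramIntegral Y r * (X 1)ᵀ)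
      (X 1 * (Y t * (Y t)ᵀ) * (X 1)ᵀ) t := fun t ht =>
    (((HasMatDeriv.const _).mul (h.hasMatDeriv_gramIntegral ht)).mul
      (HasMatDeriv.const _)).congr_deriv (by simp)
  have hc : ContinuousOn (fun t => X 1 * (Y t * (Y t)ᵀ) * (X 1)ᵀ) (Icc 0 1) :=
    (continuousOn_const.mul (h.continuousOn_right.mul
      (continuous_id.matrix_transpose.comp_continuousOn h.continuousOn_right))).mul
      continuousOn_const
  ext i j
  have h2 := integral_unit_eq_sub (fun t ht => hd t ht i j)
    (continuousOn_pi.1 (continuousOn_pi.1 hc i) j)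
  simp only [gramIntegral_zero, Matrix.mul_zero, Matrix.zero_mul, Matrix.zero_apply,
    sub_zero] at h2
  rw [← h2]
  refine intervalIntegral.integral_congr fun t ht => ?_
  rw [uIcc_of_le zero_le_one] at ht
  simp only [hM t ht, Matrix.transpose_mul, Matrix.mul_assoc]

/-- The Lyapunov equation for the covariance. -/
theorem hasMatDeriv_freeCov (h : IsFundamentalPair ε A X Y) {t : ℝ} (ht : t ∈ Icc (0 : ℝ) 1)
    (hs : (A t).IsSymm) :
    HasMatDeriv (freeCov X Y)
      ((2 : ℝ) • (1 : Matrix (Fin d) (Fin d) ℝ)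
        - ε⁻¹ • (A t * freeCov X Y t + freeCov X Y t * A t)) t := by
  have h1 := ((((h.left_deriv t ht).mul (h.hasMatDeriv_gramIntegral ht)).mul
    (h.left_deriv t ht).transpose).const_smul 2)
  refine h1.congr_deriv ?_
  -- Differentiating the factor `R` in `2XRXᵀ` produces the constant source `2I` of the Lyapunov
  -- equation.
  have h2 : X t * (Y t * (Y t)ᵀ) * (X t)ᵀ = 1 := by
    rw [← Matrix.mul_assoc, Matrix.mul_assoc, ← Matrix.transpose_mul, h.left_mul_right ht]
    simp
  rw [Matrix.add_mul, h2]
  simp only [freeCov, Matrix.transpose_neg, Matrix.transpose_smul, Matrix.transpose_mul, hs.eq,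
    Matrix.mul_neg, Matrix.neg_mul, Matrix.smul_mul, Matrix.mul_smul, Matrix.mul_assoc]
  module

/-- For `w` fixed, `ρ(t) = w ⬝ R(t) w` has derivative `n(t) = |Y(t)ᵀ w|²`. -/
theorem hasDerivWithinAt_quad (h : IsFundamentalPair ε A X Y) (w : Fin d → ℝ) {t : ℝ}
    (ht : t ∈ Icc (0 : ℝ) 1) :
    HasDerivWithinAt (fun r => w ⬝ᵥ (gramIntegral Y r *ᵥ w))
      (((Y t)ᵀ *ᵥ w) ⬝ᵥ ((Y t)ᵀ *ᵥ w)) (Icc 0 1) t := by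
  have := (h.hasMatDeriv_gramIntegral ht).dotProduct_mulVec w w
  rwa [← Matrix.mulVec_mulVec, Matrix.dotProduct_mulVec, ← Matrix.mulVec_transpose] at this

theorem hasDerivWithinAt_normSq (h : IsFundamentalPair ε A X Y) (w : Fin d → ℝ) {t : ℝ}
    (ht : t ∈ Icc (0 : ℝ) 1) (hs : (A t).IsSymm) :
    HasDerivWithinAt (fun r => ((Y r)ᵀ *ᵥ w) ⬝ᵥ ((Y r)ᵀ *ᵥ w))
      (2 * ε⁻¹ * (((Y t)ᵀ *ᵥ w) ⬝ᵥ (A t *ᵥ ((Y t)ᵀ *ᵥ w)))) (Icc 0 1) t := by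
  have h1 := ((h.right_deriv t ht).mul (h.right_deriv t ht).transpose).dotProduct_mulVec w w
  have e1 : ∀ r, w ⬝ᵥ ((Y r * (Y r)ᵀ) *ᵥ w) = ((Y r)ᵀ *ᵥ w) ⬝ᵥ ((Y r)ᵀ *ᵥ w) := fun r => by
    rw [← Matrix.mulVec_mulVec, Matrix.dotProduct_mulVec, ← Matrix.mulVec_transpose]
  simp only [e1] at h1
  refine h1.congr_deriv ?_
  simp only [Matrix.transpose_smul, Matrix.transpose_mul, hs.eq, Matrix.add_mulVec,
    Matrix.smul_mul, Matrix.mul_smul, Matrix.smul_mulVec, dotProduct_add, dotProduct_smul,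
    smul_eq_mul, Matrix.mul_assoc]
  have : w ⬝ᵥ ((Y t * (A t * (Y t)ᵀ)) *ᵥ w) = ((Y t)ᵀ *ᵥ w) ⬝ᵥ (A t *ᵥ ((Y t)ᵀ *ᵥ w)) := by
    rw [← Matrix.mulVec_mulVec, Matrix.dotProduct_mulVec, ← Matrix.mulVec_transpose,
      ← Matrix.mulVec_mulVec]
  rw [this]
  ring

/-! ### Quadratic-form bounds for the free covariance and the bridge correction. -/

section Bounds

variable {a L : ℝ} (h : IsFundamentalPair ε A X Y) (hε : 0 < ε) (ha : 0 < a)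
  (hs : ∀ t ∈ Icc (0 : ℝ) 1, (A t).IsSymm)
  (hlow : ∀ t ∈ Icc (0 : ℝ) 1, ∀ v, a * (v ⬝ᵥ v) ≤ v ⬝ᵥ (A t *ᵥ v))
include h hε ha hs hlow

/-- Put `ρ = w·Rw` and `n = |Yᵀw|²`. Then `ρ' = n` and `n' ≥ (2a/ε)n`, so `n - (2a/ε)ρ` is
nondecreasing, with initial value `|w|² ≥ 0`. -/
theorem quad_le (w : Fin d → ℝ) {t : ℝ} (ht : t ∈ Icc (0 : ℝ) 1) :
    w ⬝ᵥ (gramIntegral Y t *ᵥ w) ≤ ε / (2 * a) * (((Y t)ᵀ *ᵥ w) ⬝ᵥ ((Y t)ᵀ *ᵥ w)) := by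
  have hm := monotoneOn_unit_of_hasDerivWithinAt (fun t ht =>
    (h.hasDerivWithinAt_normSq w ht (hs t ht)).sub
      ((h.hasDerivWithinAt_quad w ht).const_mul (2 * ε⁻¹ * a))) (fun t ht => by
        have h2 := mul_le_mul_of_nonneg_left (hlow t ht ((Y t)ᵀ *ᵥ w))
          (by positivity : 0 ≤ 2 * ε⁻¹)
        linarith) (by simp : (0 : ℝ) ∈ Icc (0 : ℝ) 1) ht ht.1
  simp only [Pi.sub_apply, gramIntegral_zero, h.right_zero] at hm
  simp only [Matrix.transpose_one, Matrix.one_mulVec, Matrix.zero_mulVec, dotProduct_zero,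
    mul_zero, sub_zero] at hm
  have h0 : 0 ≤ w ⬝ᵥ w := dotProduct_self_nonneg_real w
  have h3 : 2 * ε⁻¹ * a * (w ⬝ᵥ (gramIntegral Y t *ᵥ w))
      ≤ ((Y t)ᵀ *ᵥ w) ⬝ᵥ ((Y t)ᵀ *ᵥ w) := by linarith
  rw [div_mul_eq_mul_div, le_div_iff₀ (by positivity)]
  have h4 := mul_le_mul_of_nonneg_left h3 hε.le
  field_simp at h4
  linarith

/-- With the same `n`, coercivity of `A` makes `n` nondecreasing from `|w|²`, and `w·R(1)w` is its
integral over the unit interval. This makes `R(1)` invertible. -/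
theorem le_quad_one (w : Fin d → ℝ) : w ⬝ᵥ w ≤ w ⬝ᵥ (gramIntegral Y 1 *ᵥ w) := by
  have h0 : (0 : ℝ) ∈ Icc (0 : ℝ) 1 := by simp
  have hm := monotoneOn_unit_of_hasDerivWithinAt (fun t ht =>
    h.hasDerivWithinAt_normSq w ht (hs t ht)) (fun t ht => by
        have h1 : 0 ≤ ((Y t)ᵀ *ᵥ w) ⬝ᵥ ((Y t)ᵀ *ᵥ w) := dotProduct_self_nonneg_real _
        have h2 := (mul_nonneg ha.le h1).trans (hlow t ht ((Y t)ᵀ *ᵥ w))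
        positivity) h0
  have hm2 := monotoneOn_unit_of_hasDerivWithinAt (fun t ht =>
    (h.hasDerivWithinAt_quad w ht).sub ((hasDerivWithinAt_id t _).mul_const (w ⬝ᵥ w)))
    (fun t ht => by
      have h2 := hm ht ht.1
      simp only [h.right_zero, Matrix.transpose_one, Matrix.one_mulVec] at h2
      linarith) h0 (by simp : (1 : ℝ) ∈ Icc (0 : ℝ) 1) zero_le_one
  simp [gramIntegral_zero] at hm2
  linarith

/-- The upper bound on `A` reverses the comparison: `(2L/ε)ρ - n` is nondecreasing from `-|w|²`, and
`|w|² ≤ ρ(1)` absorbs the initial value. It serves as the lower bound for the determinant. -/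
theorem le_quad_one_of_le (hL : ∀ t ∈ Icc (0 : ℝ) 1, ∀ v, v ⬝ᵥ (A t *ᵥ v) ≤ L * (v ⬝ᵥ v))
    (w : Fin d → ℝ) :
    ((Y 1)ᵀ *ᵥ w) ⬝ᵥ ((Y 1)ᵀ *ᵥ w) ≤ (1 + 2 * L / ε) * (w ⬝ᵥ (gramIntegral Y 1 *ᵥ w)) := by
  have hm := monotoneOn_unit_of_hasDerivWithinAt (fun t ht =>
    ((h.hasDerivWithinAt_quad w ht).const_mul (2 * ε⁻¹ * L)).sub
    (h.hasDerivWithinAt_normSq w ht (hs t ht))) (fun t ht => by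
        have h2 := mul_le_mul_of_nonneg_left (hL t ht ((Y t)ᵀ *ᵥ w))
          (by positivity : 0 ≤ 2 * ε⁻¹)
        linarith) (by simp : (0 : ℝ) ∈ Icc (0 : ℝ) 1) (by simp : (1 : ℝ) ∈ Icc (0 : ℝ) 1)
        zero_le_one
  simp only [Pi.sub_apply, gramIntegral_zero, h.right_zero] at hm
  simp only [Matrix.transpose_one, Matrix.one_mulVec, Matrix.zero_mulVec, dotProduct_zero,
    mul_zero, zero_sub] at hm
  have h1 := h.le_quad_one hε ha hs hlow w
  have : (1 + 2 * L / ε) = 1 + 2 * ε⁻¹ * L := by ring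
  rw [this]
  linarith

omit h hε ha hs hlow in
theorem quad_conj (Z W : Matrix (Fin d) (Fin d) ℝ) (v : Fin d → ℝ) :
    v ⬝ᵥ ((Z * W * Zᵀ) *ᵥ v) = (Zᵀ *ᵥ v) ⬝ᵥ (W *ᵥ (Zᵀ *ᵥ v)) := by
  rw [Matrix.mul_assoc, ← Matrix.mulVec_mulVec, Matrix.dotProduct_mulVec,
    ← Matrix.mulVec_transpose, ← Matrix.mulVec_mulVec]

omit hε ha hs hlow in
theorem right_mulVec_left (v : Fin d → ℝ) {t : ℝ} (ht : t ∈ Icc (0 : ℝ) 1) :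
    (Y t)ᵀ *ᵥ ((X t)ᵀ *ᵥ v) = v := by
  rw [Matrix.mulVec_mulVec, ← Matrix.transpose_mul, h.left_mul_right ht]
  simp

omit hε ha hs hlow in
theorem posSemidef_gramIntegral {t : ℝ} (ht : t ∈ Icc (0 : ℝ) 1) :
    (gramIntegral Y t).PosSemidef := by
  refine Matrix.posSemidef_of_isSymm (isSymm_gramIntegral t) fun w => ?_
  have hm := monotoneOn_unit_of_hasDerivWithinAt (fun _ ht => h.hasDerivWithinAt_quad w ht)
    (fun t _ => dotProduct_self_nonneg_real _) (by simp : (0 : ℝ) ∈ Icc (0 : ℝ) 1) ht ht.1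
  simpa [gramIntegral_zero] using hm

theorem posDef_gramIntegral_one : (gramIntegral Y 1).PosDef := by
  refine Matrix.PosDef.of_dotProduct_mulVec_pos
    (h.posSemidef_gramIntegral (by simp)).1 fun v hv => ?_
  have h1 : 0 < v ⬝ᵥ v := by
    have h2 := dotProduct_self_nonneg_real v
    exact lt_of_le_of_ne h2 fun h3 => hv (dotProduct_self_eq_zero.1 h3.symm)
  have := h.le_quad_one hε ha hs hlow v
  simpa using h1.trans_le this

omit hε ha hs hlow in
theorem posSemidef_freeCov {t : ℝ} (ht : t ∈ Icc (0 : ℝ) 1) : (freeCov X Y t).PosSemidef := by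
  refine Matrix.posSemidef_of_isSymm (isSymm_freeCov t) fun v => ?_
  rw [freeCov, Matrix.smul_mulVec, dotProduct_smul, quad_conj, smul_eq_mul]
  have := (h.posSemidef_gramIntegral ht).dotProduct_nonneg ((X t)ᵀ *ᵥ v)
  positivity

/-- The choice `w = Xᵀv` in `quad_le` gives `Yᵀw = v`. -/
theorem freeCov_le (v : Fin d → ℝ) {t : ℝ} (ht : t ∈ Icc (0 : ℝ) 1) :
    v ⬝ᵥ (freeCov X Y t *ᵥ v) ≤ ε / a * (v ⬝ᵥ v) := by
  rw [freeCov, Matrix.smul_mulVec, dotProduct_smul, quad_conj, smul_eq_mul]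
  have h1 := h.quad_le hε ha hs hlow ((X t)ᵀ *ᵥ v) ht
  rw [h.right_mulVec_left v ht] at h1
  have : ε / a = 2 * (ε / (2 * a)) := by field_simp
  rw [this]
  linarith

theorem freeCov_sq_le (b : Fin d → ℝ) {t : ℝ} (ht : t ∈ Icc (0 : ℝ) 1) :
    (freeCov X Y t *ᵥ b) ⬝ᵥ (freeCov X Y t *ᵥ b) ≤ (ε / a) ^ 2 * (b ⬝ᵥ b) :=
  Matrix.mulVec_dotProduct_self_le (isSymm_freeCov t) (by positivity)
    (fun v => (h.posSemidef_freeCov ht).dotProduct_nonneg v)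
    (fun v => h.freeCov_le hε ha hs hlow v ht) b

theorem posSemidef_bridgeCorr (t : ℝ) : (bridgeCorr X Y t).PosSemidef := by
  refine Matrix.posSemidef_of_isSymm (isSymm_bridgeCorr t) fun v => ?_
  have e : X t * gramIntegral Y t * (gramIntegral Y 1)⁻¹ * gramIntegral Y t * (X t)ᵀ
      = (X t * gramIntegral Y t) * (gramIntegral Y 1)⁻¹ * (X t * gramIntegral Y t)ᵀ := by
    simp [Matrix.transpose_mul, (isSymm_gramIntegral t).eq, Matrix.mul_assoc]
  rw [bridgeCorr, e, Matrix.smul_mulVec, dotProduct_smul, quad_conj, smul_eq_mul]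
  have := (h.posDef_gramIntegral_one hε ha hs hlow).inv.posSemidef.dotProduct_nonneg
    ((X t * gramIntegral Y t)ᵀ *ᵥ v)
  positivity

/-- Writing `R(1)⁻¹ = BᵀB` and `XR = ½KYᵀ` turns `Q` into `½ZZᵀ` with `Z = K(BY)ᵀ`. The operator
bound `K ≤ ε/a` then leaves `|BY|² = Tr(R(1)⁻¹YYᵀ)`, whose time integral is explicit. -/
theorem trace_bridgeCorr_le {t : ℝ} (ht : t ∈ Icc (0 : ℝ) 1) :
    (bridgeCorr X Y t).trace
      ≤ 1 / 2 * (ε / a) ^ 2 * ((gramIntegral Y 1)⁻¹ * (Y t * (Y t)ᵀ)).trace := by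
  obtain ⟨B, hB⟩ := (h.posDef_gramIntegral_one hε ha hs hlow).inv.posSemidef.exists_eq_transpose_mul_self
  have e1 : ((gramIntegral Y 1)⁻¹ * (Y t * (Y t)ᵀ)).trace = frobSq ((B * Y t)ᵀ) := by
    rw [frobSq_transpose, frobSq_eq_trace, hB, Matrix.transpose_mul, Matrix.mul_assoc,
      Matrix.mul_assoc, ← Matrix.mul_assoc, Matrix.trace_mul_comm]
    simp only [Matrix.mul_assoc]
    rw [Matrix.trace_mul_comm]
    simp only [Matrix.mul_assoc]
  have e2 : X t * gramIntegral Y t = (1 / 2 : ℝ) • (freeCov X Y t * (Y t)ᵀ) := by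
    have : (X t)ᵀ * (Y t)ᵀ = 1 := by
      rw [← Matrix.transpose_mul, h.right_mul_left t ht, Matrix.transpose_one]
    simp [freeCov, Matrix.mul_assoc, this]
  have e3 : bridgeCorr X Y t
      = (1 / 2 : ℝ) • ((freeCov X Y t * (B * Y t)ᵀ) * (freeCov X Y t * (B * Y t)ᵀ)ᵀ) := by
    have : bridgeCorr X Y t = (2 : ℝ) • ((X t * gramIntegral Y t) * (gramIntegral Y 1)⁻¹
        * (X t * gramIntegral Y t)ᵀ) := by
      simp [bridgeCorr, Matrix.transpose_mul, (isSymm_gramIntegral t).eq, Matrix.mul_assoc]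
    rw [this, e2, hB]
    simp only [Matrix.transpose_smul, Matrix.transpose_mul, Matrix.transpose_transpose,
      (isSymm_freeCov (X := X) (Y := Y) t).eq, Matrix.smul_mul, Matrix.mul_smul, smul_smul,
      Matrix.mul_assoc]
    norm_num
  rw [e3, e1, Matrix.trace_smul, Matrix.trace_mul_comm, ← frobSq_eq_trace, smul_eq_mul, mul_assoc]
  exact mul_le_mul_of_nonneg_left
    (frobSq_mul_le (fun b => h.freeCov_sq_le hε ha hs hlow b ht) _) (by norm_num)

omit hε ha hs hlow in
theorem continuousOn_bridgeCorr : ContinuousOn (bridgeCorr X Y) (Icc 0 1) :=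
  ((((h.continuousOn_left.mul h.continuousOn_gramIntegral).mul continuousOn_const).mul
    h.continuousOn_gramIntegral).mul
    (continuous_id.matrix_transpose.comp_continuousOn h.continuousOn_left)).const_smul (2 : ℝ)

/-- `∫₀¹Tr(R(1)⁻¹YYᵀ) = Tr(R(1)⁻¹R(1)) = d`, whatever `ε` and `A` are. In the mean `Q` is thus of
order `ε²`, one order below `K`. -/
theorem integral_trace_bridgeCorr_le :
    ∫ t in (0 : ℝ)..1, (bridgeCorr X Y t).trace ≤ d / 2 * (ε / a) ^ 2 := by
  have hc : ContinuousOn (fun t => ((gramIntegral Y 1)⁻¹ * (Y t * (Y t)ᵀ)).trace) (Icc 0 1) :=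
    continuous_id.matrix_trace.comp_continuousOn
      (continuousOn_const.mul (h.continuousOn_right.mul
        (continuous_id.matrix_transpose.comp_continuousOn h.continuousOn_right)))
  have h1 := integral_unit_eq_sub (fun t ht =>
    (((HasMatDeriv.const (gramIntegral Y 1)⁻¹).mul
      (h.hasMatDeriv_gramIntegral ht)).congr_deriv (by simp)).trace) hc
  have hu : IsUnit (gramIntegral Y 1).det :=
    (h.posDef_gramIntegral_one hε ha hs hlow).det_pos.ne'.isUnit
  simp only [gramIntegral_zero] at h1
  rw [Matrix.nonsing_inv_mul _ hu, Matrix.mul_zero, Matrix.trace_zero,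
    Matrix.trace_one, Fintype.card_fin, sub_zero] at h1
  have h2 : ∫ t in (0 : ℝ)..1, (bridgeCorr X Y t).trace ≤ ∫ t in (0 : ℝ)..1,
      1 / 2 * (ε / a) ^ 2 * ((gramIntegral Y 1)⁻¹ * (Y t * (Y t)ᵀ)).trace := by
    refine intervalIntegral.integral_mono_on zero_le_one ?_ ?_
      fun t ht => h.trace_bridgeCorr_le hε ha hs hlow ht
    · refine ContinuousOn.intervalIntegrable ?_
      rw [uIcc_of_le zero_le_one]
      exact continuous_id.matrix_trace.comp_continuousOn
        (h.continuousOn_bridgeCorr)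
    · refine (ContinuousOn.intervalIntegrable ?_).const_mul _
      rwa [uIcc_of_le zero_le_one]
  rw [intervalIntegral.integral_const_mul, h1] at h2
  linarith

end Bounds

end IsFundamentalPair

/-! ## Integral identities for the bridge covariance -/

theorem intervalIntegrable_of_continuousOn_unit {u : ℝ → ℝ} (h : ContinuousOn u (Icc 0 1)) :
    IntervalIntegrable u volume 0 1 := by
  refine ContinuousOn.intervalIntegrable ?_
  rwa [uIcc_of_le zero_le_one]

theorem continuousOn_matrix_trace {d : ℕ} {W : ℝ → Matrix (Fin d) (Fin d) ℝ} {s : Set ℝ}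
    (h : ContinuousOn W s) : ContinuousOn (fun t => (W t).trace) s :=
  continuous_id.matrix_trace.comp_continuousOn h

theorem trace_mul_eq_sum {d : ℕ} (W Z : Matrix (Fin d) (Fin d) ℝ) :
    (W * Z).trace = ∑ i, ∑ j, W i j * Z j i := by
  simp [Matrix.trace, Matrix.mul_apply]

/-! ### Bounds, a.e. derivatives and inverses of matrix functions in `H¹`. -/

namespace MemH1Mat

variable {d : ℕ} {a : ℝ} {A : ℝ → Matrix (Fin d) (Fin d) ℝ} (hA : MemH1Mat a A)
include hA

theorem le_quad {t : ℝ} (ht : t ∈ Icc (0 : ℝ) 1) (v : Fin d → ℝ) :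
    a * (v ⬝ᵥ v) ≤ v ⬝ᵥ (A t *ᵥ v) := by
  have := (hA.lower t ht).dotProduct_nonneg v
  simp only [Matrix.sub_mulVec, Matrix.smul_mulVec, Matrix.one_mulVec, dotProduct_sub,
    dotProduct_smul, smul_eq_mul] at this
  linarith

theorem ac (i j : Fin d) : AbsolutelyContinuousOnInterval (fun t => A t i j) 0 1 :=
  (hA.memH1 i j).1

theorem continuousOn_apply (i j : Fin d) : ContinuousOn (fun t => A t i j) (Icc 0 1) :=
  (hA.ac i j).continuousOn_unit

theorem continuousOn : ContinuousOn A (Icc 0 1) :=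
  continuousOn_pi.2 fun i => continuousOn_pi.2 fun j => hA.continuousOn_apply i j

theorem integrableOn_deriv_sq (i j : Fin d) :
    IntervalIntegrable (fun t => matDeriv A t i j ^ 2) volume 0 1 := by
  rw [intervalIntegrable_iff_integrableOn_Ioo_of_le zero_le_one]
  exact (hA.memH1 i j).2.integrable_sq

theorem intervalIntegrable_matDeriv (i j : Fin d) :
    IntervalIntegrable (fun t => matDeriv A t i j) volume 0 1 :=
  (hA.ac i j).intervalIntegrable_deriv

omit hA in
theorem entry_le_h1NormSq (A : ℝ → Matrix (Fin d) (Fin d) ℝ) (i j : Fin d) :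
    (∫ t in (0 : ℝ)..1, A t i j ^ 2) + ∫ t in (0 : ℝ)..1, matDeriv A t i j ^ 2 ≤ h1NormSq A := by
  have h0 : ∀ i j, 0 ≤ (∫ t in (0 : ℝ)..1, A t i j ^ 2)
      + ∫ t in (0 : ℝ)..1, matDeriv A t i j ^ 2 := fun i j =>
    add_nonneg (intervalIntegral.integral_nonneg zero_le_one fun _ _ => sq_nonneg _)
      (intervalIntegral.integral_nonneg zero_le_one fun _ _ => sq_nonneg _)
  exact (Finset.single_le_sum (f := fun j => (∫ t in (0 : ℝ)..1, A t i j ^ 2)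
      + ∫ t in (0 : ℝ)..1, matDeriv A t i j ^ 2) (fun j _ => h0 i j) (Finset.mem_univ j)).trans
    (Finset.single_le_sum (f := fun i => ∑ j, ((∫ t in (0 : ℝ)..1, A t i j ^ 2)
      + ∫ t in (0 : ℝ)..1, matDeriv A t i j ^ 2))
      (fun i _ => Finset.sum_nonneg fun j _ => h0 i j) (Finset.mem_univ i))

omit hA in
theorem h1NormSq_nonneg (A : ℝ → Matrix (Fin d) (Fin d) ℝ) : 0 ≤ h1NormSq A :=
  Finset.sum_nonneg fun _ _ => Finset.sum_nonneg fun _ _ =>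
    add_nonneg (intervalIntegral.integral_nonneg zero_le_one fun _ _ => sq_nonneg _)
      (intervalIntegral.integral_nonneg zero_le_one fun _ _ => sq_nonneg _)

theorem sq_le {t : ℝ} (ht : t ∈ Icc (0 : ℝ) 1) (i j : Fin d) : A t i j ^ 2 ≤ 2 * h1NormSq A :=
  ((hA.memH1 i j).sq_le ht).trans
    (mul_le_mul_of_nonneg_left (entry_le_h1NormSq A i j) zero_le_two)

theorem abs_le {t : ℝ} (ht : t ∈ Icc (0 : ℝ) 1) (i j : Fin d) : |A t i j| ≤ 1 + h1NormSq A := by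
  have h1 := hA.sq_le ht i j
  rw [← sq_abs] at h1
  nlinarith [sq_nonneg (|A t i j| - 1)]

/-- The bound is linear in `‖A‖²_{H¹}`: each product of two entries costs one squared norm. Squaring
the entrywise bound `1 + ‖A‖²` would give a power too large for the error budget. -/
theorem abs_mul_self_le {t : ℝ} (ht : t ∈ Icc (0 : ℝ) 1) (i j : Fin d) :
    |(A t * A t) i j| ≤ 2 * d * (1 + h1NormSq A) := by
  rw [Matrix.mul_apply]
  refine (Finset.abs_sum_le_sum_abs _ _).trans ?_
  have : ∀ k ∈ Finset.univ, |A t i k * A t k j| ≤ 2 * (1 + h1NormSq A) := by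
    intro k _
    have h1 := hA.sq_le ht i k
    have h2 := hA.sq_le ht k j
    rw [abs_mul]
    rw [← sq_abs] at h1 h2
    nlinarith [sq_nonneg (|A t i k| - |A t k j|)]
  refine (Finset.sum_le_sum this).trans ?_
  simp
  linarith

theorem quad_le {t : ℝ} (ht : t ∈ Icc (0 : ℝ) 1) (v : Fin d → ℝ) :
    v ⬝ᵥ (A t *ᵥ v) ≤ d * (1 + h1NormSq A) * (v ⬝ᵥ v) := by
  have h1 : v ⬝ᵥ (A t *ᵥ v) ≤ ∑ i, ∑ j, (1 + h1NormSq A) * ((v i * v i + v j * v j) / 2) := by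
    simp only [dotProduct, Matrix.mulVec, Finset.mul_sum]
    refine Finset.sum_le_sum fun i _ => Finset.sum_le_sum fun j _ => ?_
    have h2 := hA.abs_le ht i j
    have h3 : |v i * v j| ≤ (v i * v i + v j * v j) / 2 := by
      rw [_root_.abs_le]
      constructor <;> nlinarith [sq_nonneg (v i + v j), sq_nonneg (v i - v j)]
    calc v i * (A t i j * v j) ≤ |v i * (A t i j * v j)| := le_abs_self _
      _ = |A t i j| * |v i * v j| := by rw [← abs_mul]; ring_nf
      _ ≤ _ := mul_le_mul h2 h3 (abs_nonneg _) (by linarith [h1NormSq_nonneg A])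
  refine h1.trans (le_of_eq ?_)
  simp only [dotProduct, ← Finset.mul_sum, ← Finset.sum_div, Finset.sum_add_distrib]
  simp only [Finset.sum_const, Finset.card_univ, Fintype.card_fin, nsmul_eq_mul]
  ring_nf
  rw [← Finset.sum_mul]
  ring

theorem integral_abs_matDeriv_le (i j : Fin d) :
    ∫ t in (0 : ℝ)..1, |matDeriv A t i j| ≤ 1 + h1NormSq A := by
  have h1 : ∫ t in (0 : ℝ)..1, |matDeriv A t i j|
      ≤ ∫ t in (0 : ℝ)..1, (1 + matDeriv A t i j ^ 2) :=
    intervalIntegral.integral_mono_on zero_le_one (hA.intervalIntegrable_matDeriv i j).abs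
      (.add (by simp) (hA.integrableOn_deriv_sq i j)) fun t _ => by
        rw [← sq_abs]
        nlinarith [sq_nonneg (|matDeriv A t i j| - 1), abs_nonneg (matDeriv A t i j)]
  rw [intervalIntegral.integral_add (by simp) (hA.integrableOn_deriv_sq i j)] at h1
  have h2 := entry_le_h1NormSq A i j
  have h3 : 0 ≤ ∫ t in (0 : ℝ)..1, A t i j ^ 2 :=
    intervalIntegral.integral_nonneg zero_le_one fun _ _ => sq_nonneg _
  simp at h1
  linarith

theorem ae_hasMatDeriv : ∀ᵐ t, t ∈ Ioo (0 : ℝ) 1 → ∀ i j,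
    HasDerivAt (fun s => A s i j) (matDeriv A t i j) t := by
  have : ∀ᵐ t, ∀ i j, t ∈ Icc (0 : ℝ) 1 → HasDerivAt (fun s => A s i j) (matDeriv A t i j) t :=
    ae_all_iff.2 fun i => ae_all_iff.2 fun j => (hA.ac i j).ae_hasDerivAt
  filter_upwards [this] with t h ht i j
  exact h i j (Ioo_subset_Icc_self ht)

section Inverse

variable (ha : 0 < a)
include ha

theorem posDef {t : ℝ} (ht : t ∈ Icc (0 : ℝ) 1) : (A t).PosDef := by
  refine Matrix.PosDef.of_dotProduct_mulVec_pos ?_ fun v hv => ?_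
  · rw [Matrix.IsHermitian, Matrix.conjTranspose_eq_transpose_of_trivial]
    exact hA.symm t ht
  · have h1 : 0 < v ⬝ᵥ v :=
      lt_of_le_of_ne (dotProduct_self_nonneg_real v) fun h3 => hv (dotProduct_self_eq_zero.1 h3.symm)
    have := hA.le_quad ht v
    simpa using (mul_pos ha h1).trans_le this

theorem mul_inv {t : ℝ} (ht : t ∈ Icc (0 : ℝ) 1) : A t * (A t)⁻¹ = 1 :=
  Matrix.mul_nonsing_inv _ (hA.posDef ha ht).det_pos.ne'.isUnit

theorem inv_mul {t : ℝ} (ht : t ∈ Icc (0 : ℝ) 1) : (A t)⁻¹ * A t = 1 :=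
  Matrix.nonsing_inv_mul _ (hA.posDef ha ht).det_pos.ne'.isUnit

omit ha in
theorem isSymm_inv {t : ℝ} (ht : t ∈ Icc (0 : ℝ) 1) : (A t)⁻¹.IsSymm := by
  rw [Matrix.IsSymm, Matrix.transpose_nonsing_inv, (hA.symm t ht).eq]

/-- With `w = A⁻¹v`, coercivity reads `a|w|² ≤ v·w`; insert this in `|v - aw|² ≥ 0`. -/
theorem inv_sq_le {t : ℝ} (ht : t ∈ Icc (0 : ℝ) 1) (v : Fin d → ℝ) :
    ((A t)⁻¹ *ᵥ v) ⬝ᵥ ((A t)⁻¹ *ᵥ v) ≤ (a⁻¹) ^ 2 * (v ⬝ᵥ v) := by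
  have h1 := hA.le_quad ht ((A t)⁻¹ *ᵥ v)
  rw [Matrix.mulVec_mulVec, hA.mul_inv ha ht, Matrix.one_mulVec] at h1
  set w := (A t)⁻¹ *ᵥ v
  have h2 := dotProduct_self_nonneg_real (v - a • w)
  simp only [dotProduct_sub, sub_dotProduct, dotProduct_smul, smul_dotProduct,
    smul_eq_mul, dotProduct_comm v w] at h2
  rw [inv_pow, inv_mul_eq_div, le_div_iff₀ (by positivity)]
  nlinarith

theorem inv_apply_sq_le {t : ℝ} (ht : t ∈ Icc (0 : ℝ) 1) (i j : Fin d) :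
    (A t)⁻¹ i j ^ 2 ≤ (a⁻¹) ^ 2 := by
  have h1 := hA.inv_sq_le ha ht (Pi.single j 1)
  simp only [Matrix.mulVec_single_one, single_dotProduct, Pi.single_eq_same, mul_one] at h1
  refine le_trans ?_ h1
  simp only [dotProduct, Matrix.col_apply, ← sq]
  exact Finset.single_le_sum (f := fun i => (A t)⁻¹ i j ^ 2) (fun _ _ => sq_nonneg _)
    (Finset.mem_univ i)

theorem inv_abs_le {t : ℝ} (ht : t ∈ Icc (0 : ℝ) 1) (i j : Fin d) : |(A t)⁻¹ i j| ≤ a⁻¹ :=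
  abs_le_of_sq_le_sq (hA.inv_apply_sq_le ha ht i j) (by positivity)

/-- The resolvent identity bounds increments of `A⁻¹` by those of `A`, with factor `a⁻¹` on either
side. -/
theorem ac_inv (i j : Fin d) : AbsolutelyContinuousOnInterval (fun t => (A t)⁻¹ i j) 0 1 := by
  refine .of_dist_le (c := a⁻¹ * a⁻¹) (Finset.univ : Finset (Fin d × Fin d))
    (u := fun p t => A t p.1 p.2) (fun p _ => hA.ac p.1 p.2) fun x hx y hy => ?_
  have e : (A x)⁻¹ - (A y)⁻¹ = (A x)⁻¹ * (A y - A x) * (A y)⁻¹ := by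
    rw [Matrix.mul_sub, Matrix.sub_mul, Matrix.mul_assoc, hA.mul_inv ha hy, hA.inv_mul ha hx]
    simp
  rw [Real.dist_eq, ← Matrix.sub_apply, e, Fintype.sum_prod_type, Finset.sum_comm]
  simp only [Matrix.mul_apply, Finset.sum_mul, Finset.mul_sum]
  refine (Finset.abs_sum_le_sum_abs _ _).trans ?_
  refine Finset.sum_le_sum fun l _ => ?_
  refine (Finset.abs_sum_le_sum_abs _ _).trans (Finset.sum_le_sum fun k _ => ?_)
  rw [abs_mul, abs_mul, Matrix.sub_apply, Real.dist_eq, abs_sub_comm (A y k l)]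
  have h1 := hA.inv_abs_le ha hx i k
  have h2 := hA.inv_abs_le ha hy l j
  calc |(A x)⁻¹ i k| * |A x k l - A y k l| * |(A y)⁻¹ l j|
      ≤ a⁻¹ * |A x k l - A y k l| * a⁻¹ := by gcongr
    _ = _ := by ring

/-- Absolute continuity supplies a derivative `D` a.e.; differentiating `AA⁻¹ = 1` identifies it. -/
theorem ae_hasDerivAt_inv : ∀ᵐ t, t ∈ Ioo (0 : ℝ) 1 → ∀ i j,
    HasDerivAt (fun s => (A s)⁻¹ i j) ((-((A t)⁻¹ * matDeriv A t * (A t)⁻¹)) i j) t := by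
  have h1 : ∀ᵐ t, ∀ i j, t ∈ Icc (0 : ℝ) 1 →
      HasDerivAt (fun s => (A s)⁻¹ i j) (deriv (fun s => (A s)⁻¹ i j) t) t :=
    ae_all_iff.2 fun i => ae_all_iff.2 fun j => (hA.ac_inv ha i j).ae_hasDerivAt
  filter_upwards [h1, hA.ae_hasMatDeriv] with t h1 h2 ht
  have ht' := Ioo_subset_Icc_self ht
  set D : Matrix (Fin d) (Fin d) ℝ := Matrix.of fun i j => deriv (fun s => (A s)⁻¹ i j) t
  have h3 : HasMatDeriv (fun s => (A s)⁻¹) D t := fun i j => (h1 i j ht').hasDerivWithinAt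
  have h4 : HasMatDeriv A (matDeriv A t) t := fun i j => (h2 ht i j).hasDerivWithinAt
  have h5 := h4.mul h3
  have h6 : matDeriv A t * (A t)⁻¹ + A t * D = 0 := by
    ext i j
    have h7 := h5 i j
    have h8 : HasDerivWithinAt (fun r => (A r * (A r)⁻¹) i j) 0 (Icc 0 1) t := by
      refine (hasDerivWithinAt_const t (Icc 0 1) ((1 : Matrix (Fin d) (Fin d) ℝ) i j)).congr_of_mem
        (fun s hs => ?_) ht'
      rw [hA.mul_inv ha hs]
    exact (uniqueDiffOn_Icc zero_lt_one t ht').eq_deriv _ h7 h8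
  have h7 : D = -((A t)⁻¹ * matDeriv A t * (A t)⁻¹) := by
    have h8 : A t * D = -(matDeriv A t * (A t)⁻¹) := by
      rw [eq_neg_iff_add_eq_zero, add_comm]; exact h6
    calc D = (A t)⁻¹ * (A t * D) := by rw [← Matrix.mul_assoc, hA.inv_mul ha ht', Matrix.one_mul]
      _ = _ := by rw [h8, Matrix.mul_neg, Matrix.mul_assoc]
  intro i j
  rw [← h7]
  exact h1 i j ht'

end Inverse

end MemH1Mat

theorem intervalIntegrable_finset_sum {ι : Type*} (s : Finset ι) {u : ι → ℝ → ℝ} {b c : ℝ}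
    (h : ∀ i ∈ s, IntervalIntegrable (u i) volume b c) :
    IntervalIntegrable (fun t => ∑ i ∈ s, u i t) volume b c := by
  simpa only [Finset.sum_fn] using IntervalIntegrable.sum s h

/-! ### Trace inequalities. -/

section Generic

variable {d : ℕ}

theorem trace_mul_mul_self_ge {B E : Matrix (Fin d) (Fin d) ℝ} {a : ℝ}
    (hB : ∀ v, a * (v ⬝ᵥ v) ≤ v ⬝ᵥ (B *ᵥ v)) :
    a * frobSq E ≤ (Eᵀ * (B * E)).trace := by
  rw [frobSq_eq_sum_col, Finset.mul_sum]
  exact Finset.sum_le_sum fun j _ => hB fun i => E i j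

theorem trace_transpose_mul_le (E W : Matrix (Fin d) (Fin d) ℝ) {c : ℝ} (hc : 0 < c) :
    2 * (Eᵀ * W).trace ≤ c * frobSq E + c⁻¹ * frobSq W := by
  have e : (Eᵀ * W).trace = ∑ i, ∑ j, E i j * W i j := by
    rw [trace_mul_eq_sum, Finset.sum_comm]
    rfl
  rw [e, frobSq, frobSq]
  simp only [Finset.mul_sum]
  rw [← Finset.sum_add_distrib]
  refine Finset.sum_le_sum fun i _ => ?_
  rw [← Finset.sum_add_distrib]
  refine Finset.sum_le_sum fun j _ => ?_
  have h1 : 0 ≤ c⁻¹ * (c * E i j - W i j) ^ 2 := by positivity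
  have h2 : c⁻¹ * (c * E i j - W i j) ^ 2
      = c * E i j ^ 2 + c⁻¹ * W i j ^ 2 - 2 * (E i j * W i j) := by
    field_simp
    ring
  linarith

/-- The `L^∞`–`L¹` pairing used for all error terms. `W` is controlled pointwise, while `Z` (in turn
`A'`, `Q` and `ε⁻¹K - A⁻¹`) is controlled only in the mean. -/
theorem abs_integral_trace_mul_le {W Z : ℝ → Matrix (Fin d) (Fin d) ℝ} {σ κ : ℝ} (hσ : 0 ≤ σ)
    (hW : ∀ t ∈ Icc (0 : ℝ) 1, ∀ i j, |W t i j| ≤ σ)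
    (hZi : ∀ i j, IntervalIntegrable (fun t => Z t i j) volume 0 1)
    (hZ : ∀ i j, ∫ t in (0 : ℝ)..1, |Z t i j| ≤ κ) :
    |∫ t in (0 : ℝ)..1, (W t * Z t).trace| ≤ d ^ 2 * (σ * κ) := by
  have hZa : ∀ i j, IntervalIntegrable (fun t => σ * |Z t i j|) volume 0 1 :=
    fun i j => (hZi i j).abs.const_mul σ
  have hsum : IntervalIntegrable (fun t => ∑ i, ∑ j, σ * |Z t j i|) volume 0 1 :=
    intervalIntegrable_finset_sum _ fun i _ => intervalIntegrable_finset_sum _ fun j _ => hZa j i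
  have h1 : |∫ t in (0 : ℝ)..1, (W t * Z t).trace|
      ≤ ∫ t in (0 : ℝ)..1, ∑ i, ∑ j, σ * |Z t j i| := by
    rw [← Real.norm_eq_abs]
    refine intervalIntegral.norm_integral_le_of_norm_le zero_le_one (.of_forall fun t ht => ?_) hsum
    refine (abs_trace_mul_le _ _).trans (Finset.sum_le_sum fun i _ => Finset.sum_le_sum fun j _ => ?_)
    exact mul_le_mul_of_nonneg_right (hW t (Ioc_subset_Icc_self ht) i j) (abs_nonneg _)
  refine h1.trans ?_
  rw [intervalIntegral.integral_finsetSum fun i _ =>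
    intervalIntegrable_finset_sum _ fun j _ => hZa j i]
  calc ∑ i, ∫ t in (0 : ℝ)..1, ∑ j, σ * |Z t j i|
      ≤ ∑ i : Fin d, ∑ j : Fin d, σ * κ := by
        refine Finset.sum_le_sum fun i _ => ?_
        rw [intervalIntegral.integral_finsetSum fun j _ => hZa j i]
        refine Finset.sum_le_sum fun j _ => ?_
        rw [intervalIntegral.integral_const_mul]
        exact mul_le_mul_of_nonneg_left (hZ j i) hσ
    _ = d ^ 2 * (σ * κ) := by simp; ring

end Generic

/-! ### Consequences of the Lyapunov equation. -/

namespace IsFundamentalPair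

variable {d : ℕ} {ε a : ℝ} {A X Y : ℝ → Matrix (Fin d) (Fin d) ℝ}
  (h : IsFundamentalPair ε A X Y) (hε : 0 < ε) (ha : 0 < a) (hA : MemH1Mat a A)
include h hε ha hA

omit hε ha in
theorem continuousOn_freeCov : ContinuousOn (freeCov X Y) (Icc 0 1) :=
  HasMatDeriv.continuousOn fun _ ht => h.hasMatDeriv_freeCov ht (hA.symm _ ht)

theorem trace_freeCov_le {t : ℝ} (ht : t ∈ Icc (0 : ℝ) 1) :
    (freeCov X Y t).trace ≤ d * (ε / a) := by
  have : ∀ i, freeCov X Y t i i ≤ ε / a := fun i => by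
    have := h.freeCov_le hε ha hA.symm (fun t ht => hA.le_quad ht) (Pi.single i 1) ht
    simpa using this
  calc (freeCov X Y t).trace ≤ ∑ _i : Fin d, ε / a := Finset.sum_le_sum fun i _ => this i
    _ = _ := by simp

theorem abs_freeCov_le {t : ℝ} (ht : t ∈ Icc (0 : ℝ) 1) (i j : Fin d) :
    |freeCov X Y t i j| ≤ d * (ε / a) :=
  ((h.posSemidef_freeCov ht).abs_apply_le_trace i j).trans
    (h.trace_freeCov_le hε ha hA ht)

omit hε ha in
/-- The integrated Lyapunov equation tested against `A`. -/
theorem integral_trace_sq_mul_freeCov :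
    (∫ t in (0 : ℝ)..1, ε⁻¹ * (A t * A t * freeCov X Y t).trace)
      = (∫ t in (0 : ℝ)..1, (A t).trace)
        + 1 / 2 * (∫ t in (0 : ℝ)..1, (freeCov X Y t * matDeriv A t).trace)
        - 1 / 2 * (A 1 * freeCov X Y 1).trace := by
  have hKc := h.continuousOn_freeCov hA
  have hKac : ∀ i j, AbsolutelyContinuousOnInterval (fun t => freeCov X Y t i j) 0 1 := fun i j =>
    .of_hasDerivWithinAt (fun t ht => h.hasMatDeriv_freeCov ht (hA.symm t ht) i j)
      (continuousOn_pi.1 (continuousOn_pi.1 ((continuousOn_const (c := (2 : ℝ) • 1)).sub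
        (((hA.continuousOn.mul hKc).add (hKc.mul hA.continuousOn)).const_smul ε⁻¹)) i) j)
  have hac : AbsolutelyContinuousOnInterval (fun t => (A t * freeCov X Y t).trace) 0 1 := by
    simp only [trace_mul_eq_sum]
    exact .fun_sum_unit _ fun i _ => .fun_sum_unit _ fun j _ => (hA.ac i j).fun_mul (hKac j i)
  -- `d/dt Tr(AK) = Tr(KA') + 2Tr A - 2ε⁻¹Tr(A²K)`, and `K(0) = 0` removes the lower endpoint.
  obtain ⟨-, h2⟩ := hac.integral_eq_sub_of_ae_hasDerivAt (u' := fun t =>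
      (freeCov X Y t * matDeriv A t).trace + (2 * (A t).trace
        - 2 * (ε⁻¹ * (A t * A t * freeCov X Y t).trace))) (by
    filter_upwards [hA.ae_hasMatDeriv] with t h1 ht
    have ht' := Ioo_subset_Icc_self ht
    have h3 : HasMatDeriv A (matDeriv A t) t := fun i j => (h1 ht i j).hasDerivWithinAt
    refine ((h3.mul (h.hasMatDeriv_freeCov ht' (hA.symm t ht'))).trace.congr_deriv ?_).hasDerivAt
      (Icc_mem_nhds ht.1 ht.2)
    rw [Matrix.trace_add, Matrix.trace_mul_comm (matDeriv A t), Matrix.mul_sub, Matrix.mul_smul,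
      Matrix.mul_smul, Matrix.mul_add, Matrix.mul_one, Matrix.trace_sub, Matrix.trace_smul,
      Matrix.trace_smul, Matrix.trace_add, ← Matrix.mul_assoc, ← Matrix.mul_assoc,
      Matrix.trace_mul_comm (A t * freeCov X Y t), ← Matrix.mul_assoc]
    simp only [smul_eq_mul]
    ring)
  have i1 : IntervalIntegrable (fun t => (freeCov X Y t * matDeriv A t).trace) volume 0 1 := by
    simp only [trace_mul_eq_sum]
    refine intervalIntegrable_finset_sum _ fun i _ => intervalIntegrable_finset_sum _ fun j _ => ?_
    refine (hA.intervalIntegrable_matDeriv j i).continuousOn_mul ?_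
    rw [uIcc_of_le zero_le_one]
    exact (hKac i j).continuousOn_unit
  have i2 : IntervalIntegrable (fun t => 2 * (A t).trace) volume 0 1 :=
    (intervalIntegrable_of_continuousOn_unit (continuousOn_matrix_trace hA.continuousOn)).const_mul _
  have i3 : IntervalIntegrable (fun t => 2 * (ε⁻¹ * (A t * A t * freeCov X Y t).trace))
      volume 0 1 :=
    ((intervalIntegrable_of_continuousOn_unit (continuousOn_matrix_trace
      ((hA.continuousOn.mul hA.continuousOn).mul hKc))).const_mul _).const_mul _
  have h0 : freeCov X Y 0 = 0 := by simp [freeCov, gramIntegral_zero]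
  rw [intervalIntegral.integral_add i1 (i2.sub i3), intervalIntegral.integral_sub i2 i3,
    intervalIntegral.integral_const_mul, intervalIntegral.integral_const_mul, h0] at h2
  simp only [Matrix.mul_zero, Matrix.trace_zero, sub_zero] at h2
  linarith

/-- `L²` closeness of the scaled covariance to its local equilibrium `A⁻¹`. -/
theorem integral_frobSq_freeCov_sub_inv_le :
    ∫ t in (0 : ℝ)..1, frobSq (ε⁻¹ • freeCov X Y t - (A t)⁻¹)
      ≤ ε * ((2 * a)⁻¹ * (d ^ 2 * a⁻¹ ^ 2) + ε * ((2 * a)⁻¹ ^ 2 * a⁻¹ ^ 4 * h1NormSq A)) := by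
  have hKc := h.continuousOn_freeCov hA
  have hKac : ∀ i j, AbsolutelyContinuousOnInterval (fun t => freeCov X Y t i j) 0 1 := fun i j =>
    .of_hasDerivWithinAt (fun t ht => h.hasMatDeriv_freeCov ht (hA.symm t ht) i j)
      (continuousOn_pi.1 (continuousOn_pi.1 ((continuousOn_const (c := (2 : ℝ) • 1)).sub
        (((hA.continuousOn.mul hKc).add (hKc.mul hA.continuousOn)).const_smul ε⁻¹)) i) j)
  set E : ℝ → Matrix (Fin d) (Fin d) ℝ := fun t => ε⁻¹ • freeCov X Y t - (A t)⁻¹ with hE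
  have hEac : ∀ i j, AbsolutelyContinuousOnInterval (fun t => E t i j) 0 1 := fun i j =>
    ((hKac i j).const_mul ε⁻¹).fun_sub (hA.ac_inv ha i j)
  have hEs : ∀ t ∈ Icc (0 : ℝ) 1, (E t)ᵀ = E t := fun t ht => by
    simp only [hE, Matrix.transpose_sub, Matrix.transpose_smul, (isSymm_freeCov t).eq,
      (hA.isSymm_inv ht).eq]
  set W : ℝ → Matrix (Fin d) (Fin d) ℝ := fun t => (A t)⁻¹ * matDeriv A t * (A t)⁻¹
  have hac : AbsolutelyContinuousOnInterval (fun t => ((E t)ᵀ * E t).trace) 0 1 := by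
    simp only [trace_mul_eq_sum, Matrix.transpose_apply]
    exact .fun_sum_unit _ fun i _ => .fun_sum_unit _ fun j _ => (hEac j i).fun_mul (hEac j i)
  -- Since `A⁻¹` annihilates the right-hand side of the Lyapunov equation, `E' = W - ε⁻¹(AE + EA)`
  -- with forcing `W = -(A⁻¹)'`. Differentiating `|E|²` gives a dissipation term and the pairing
  -- with `W`.
  obtain ⟨i1, h2⟩ := hac.integral_eq_sub_of_ae_hasDerivAt (u' := fun t =>
      -(4 * ε⁻¹) * ((E t)ᵀ * (A t * E t)).trace + 2 * ((E t)ᵀ * W t).trace) (by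
    filter_upwards [hA.ae_hasDerivAt_inv ha] with t h1 ht
    have ht' := Ioo_subset_Icc_self ht
    have h3 : HasMatDeriv (fun s => (A s)⁻¹) (-W t) t := fun i j => (h1 ht i j).hasDerivWithinAt
    have h4 : HasMatDeriv E _ t :=
      ((h.hasMatDeriv_freeCov ht' (hA.symm t ht')).const_smul ε⁻¹).sub h3
    have h5 : ε⁻¹ • ((2 : ℝ) • (1 : Matrix (Fin d) (Fin d) ℝ)
        - ε⁻¹ • (A t * freeCov X Y t + freeCov X Y t * A t)) - (-W t)
        = W t - ε⁻¹ • (A t * E t + E t * A t) := by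
      simp only [hE, Matrix.mul_sub, Matrix.sub_mul, hA.mul_inv ha ht', hA.inv_mul ha ht',
        Matrix.mul_smul, Matrix.smul_mul]
      module
    rw [h5] at h4
    refine ((h4.transpose.mul h4).trace.congr_deriv ?_).hasDerivAt (Icc_mem_nhds ht.1 ht.2)
    rw [Matrix.trace_add, ← Matrix.trace_transpose (_ᵀ * E t), Matrix.transpose_mul,
      Matrix.transpose_transpose, Matrix.mul_sub, Matrix.mul_smul, Matrix.mul_add,
      Matrix.trace_sub, Matrix.trace_smul, Matrix.trace_add, hEs t ht',
      Matrix.trace_mul_comm (E t) (E t * A t), Matrix.mul_assoc (E t)]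
    simp only [smul_eq_mul]
    ring)
  have hEc : ContinuousOn E (Icc 0 1) :=
    continuousOn_pi.2 fun i => continuousOn_pi.2 fun j => (hEac i j).continuousOn_unit
  have hfc : ContinuousOn (fun t => frobSq (E t)) (Icc 0 1) := by
    simp only [frobSq_eq_trace]
    exact hac.continuousOn_unit
  have hfi := intervalIntegrable_of_continuousOn_unit hfc
  have hAi : IntervalIntegrable (fun t => frobSq (matDeriv A t)) volume 0 1 :=
    intervalIntegrable_finset_sum _ fun i _ => intervalIntegrable_finset_sum _ fun j _ =>
      hA.integrableOn_deriv_sq i j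
  have hAle : ∫ t in (0 : ℝ)..1, frobSq (matDeriv A t) ≤ h1NormSq A := by
    simp only [frobSq]
    rw [intervalIntegral.integral_finsetSum fun i _ =>
      intervalIntegrable_finset_sum _ fun j _ => hA.integrableOn_deriv_sq i j]
    refine Finset.sum_le_sum fun i _ => ?_
    rw [intervalIntegral.integral_finsetSum fun j _ => hA.integrableOn_deriv_sq i j]
    refine Finset.sum_le_sum fun j _ => ?_
    have : 0 ≤ ∫ t in (0 : ℝ)..1, A t i j ^ 2 :=
      intervalIntegral.integral_nonneg zero_le_one fun _ _ => sq_nonneg _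
    linarith
  -- The dissipation is at least `4aε⁻¹|E|²`. Half of it absorbs the pairing with `W` by Young's
  -- inequality.
  have h3 : ∀ t ∈ Icc (0 : ℝ) 1,
      -(4 * ε⁻¹) * ((E t)ᵀ * (A t * E t)).trace + 2 * ((E t)ᵀ * W t).trace
      ≤ -(2 * a * ε⁻¹) * frobSq (E t) + (2 * a * ε⁻¹)⁻¹ * (a⁻¹ ^ 4 * frobSq (matDeriv A t)) := by
    intro t ht
    have h4 := trace_mul_mul_self_ge (E := E t) fun v => hA.le_quad ht v
    have h5 := trace_transpose_mul_le (E t) (W t) (c := 2 * a * ε⁻¹) (by positivity)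
    have h6 : frobSq (W t) ≤ a⁻¹ ^ 4 * frobSq (matDeriv A t) := by
      have e1 := frobSq_mul_le (hA.inv_sq_le ha ht) (matDeriv A t * (A t)⁻¹)
      have e2 := frobSq_mul_le (hA.inv_sq_le ha ht) (matDeriv A t)ᵀ
      have e3 : frobSq (matDeriv A t * (A t)⁻¹) = frobSq ((A t)⁻¹ * (matDeriv A t)ᵀ) := by
        rw [← frobSq_transpose, Matrix.transpose_mul, (hA.isSymm_inv ht).eq]
      rw [frobSq_transpose] at e2
      rw [e3, ← Matrix.mul_assoc] at e1
      refine e1.trans ((mul_le_mul_of_nonneg_left e2 (by positivity)).trans (le_of_eq ?_))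
      ring
    have h7 : (2 * a * ε⁻¹)⁻¹ * frobSq (W t)
        ≤ (2 * a * ε⁻¹)⁻¹ * (a⁻¹ ^ 4 * frobSq (matDeriv A t)) :=
      mul_le_mul_of_nonneg_left h6 (by positivity)
    have h8 : 4 * ε⁻¹ * (a * frobSq (E t)) ≤ 4 * ε⁻¹ * ((E t)ᵀ * (A t * E t)).trace :=
      mul_le_mul_of_nonneg_left h4 (by positivity)
    linarith
  have h4 := intervalIntegral.integral_mono_on zero_le_one i1
    ((hfi.const_mul _).add ((hAi.const_mul _).const_mul _)) h3
  rw [h2, intervalIntegral.integral_add (hfi.const_mul _) ((hAi.const_mul _).const_mul _)] at h4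
  simp only [intervalIntegral.integral_const_mul, ← frobSq_eq_trace] at h4
  -- The initial layer: `K(0) = 0` makes `E(0) = -A(0)⁻¹`, which is not small, and contributes the
  -- leading term of order `ε`.
  have h5 : frobSq (E 0) ≤ d ^ 2 * a⁻¹ ^ 2 := by
    have h0 : freeCov X Y 0 = 0 := by simp [freeCov, gramIntegral_zero]
    calc frobSq (E 0) ≤ ∑ _i : Fin d, ∑ _j : Fin d, a⁻¹ ^ 2 := by
          refine Finset.sum_le_sum fun i _ => Finset.sum_le_sum fun j _ => ?_
          have := hA.inv_apply_sq_le ha (by simp : (0 : ℝ) ∈ Icc (0 : ℝ) 1) i j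
          simpa [hE, h0] using this
      _ = _ := by simp; ring
  have h6 := frobSq_nonneg (E 1)
  set I := ∫ t in (0 : ℝ)..1, frobSq (E t)
  have h7 : 2 * a * ε⁻¹ * I ≤ d ^ 2 * a⁻¹ ^ 2 + (2 * a * ε⁻¹)⁻¹ * (a⁻¹ ^ 4 * h1NormSq A) := by
    have := mul_le_mul_of_nonneg_left hAle (by positivity : 0 ≤ (2 * a * ε⁻¹)⁻¹ * a⁻¹ ^ 4)
    linarith
  have h8 := mul_le_mul_of_nonneg_left h7 (by positivity : 0 ≤ (2 * a)⁻¹ * ε)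
  calc I = (2 * a)⁻¹ * ε * (2 * a * ε⁻¹ * I) := by field_simp
    _ ≤ _ := h8
    _ = _ := by field_simp

end IsFundamentalPair

/-- An eigenvalue is the value of the form at a unit eigenvector, and the determinant is their
product. -/
theorem Matrix.PosSemidef.pow_le_det {d : ℕ} {S : Matrix (Fin d) (Fin d) ℝ} (hS : S.PosSemidef)
    {lo hi : ℝ} (hlo0 : 0 ≤ lo) (hlo : ∀ v, lo * (v ⬝ᵥ v) ≤ v ⬝ᵥ (S *ᵥ v))
    (hhi : ∀ v, v ⬝ᵥ (S *ᵥ v) ≤ hi * (v ⬝ᵥ v)) : lo ^ d ≤ S.det ∧ S.det ≤ hi ^ d := by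
  have key : ∀ i, lo ≤ hS.1.eigenvalues i ∧ hS.1.eigenvalues i ≤ hi := by
    intro i
    set v : Fin d → ℝ := (hS.1.eigenvectorBasis i).ofLp with hv
    have h1 : S *ᵥ v = hS.1.eigenvalues i • v := hS.1.mulVec_eigenvectorBasis i
    have h2 : v ⬝ᵥ v = 1 := by
      have := hS.1.eigenvectorBasis.orthonormal.1 i
      have h3 := EuclideanSpace.real_norm_sq_eq (hS.1.eigenvectorBasis i)
      rw [this] at h3
      simp only [dotProduct, ← sq, hv]
      rw [← h3]
      norm_num
    have h3 := hlo v
    have h4 := hhi v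
    rw [h1, dotProduct_smul, h2] at h3 h4
    simp at h3 h4
    exact ⟨h3, h4⟩
  have hdet : S.det = ∏ i, hS.1.eigenvalues i := by
    rw [hS.1.det_eq_prod_eigenvalues]
    simp
  rw [hdet]
  constructor
  · calc lo ^ d = ∏ _i : Fin d, lo := by simp
      _ ≤ _ := Finset.prod_le_prod (fun _ _ => hlo0) fun i _ => (key i).1
  · calc _ ≤ ∏ _i : Fin d, hi :=
        Finset.prod_le_prod (fun i _ => hlo0.trans (key i).1) fun i _ => (key i).2
      _ = _ := by simp

/-! ### Log-determinant, quadratic term and tested covariance. -/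

namespace IsFundamentalPair

variable {d : ℕ} {ε a : ℝ} {A X Y : ℝ → Matrix (Fin d) (Fin d) ℝ}
  (h : IsFundamentalPair ε A X Y) (hε : 0 < ε) (ha : 0 < a) (hA : MemH1Mat a A)
include h hε ha hA

/-- The Gram matrix is `X(1)R(1)X(1)ᵀ`. Its form at `v` is that of `R(1)` at `X(1)ᵀv`, which lies
between `c⁻¹|v|²` and `(ε/2a)|v|²`. Multiplied by `ε`, the resulting logarithms are negligible. -/
theorem abs_log_det_le (hM : ∀ t ∈ Icc (0 : ℝ) 1, fundamentalMatrix ε A 1 t = X 1 * Y t) :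
    |Real.log (fundamentalGram ε A).det|
      ≤ d * (Real.log (1 + 2 * (d * (1 + h1NormSq A)) / ε) + |Real.log (ε / (2 * a))|) := by
  have h1 : (1 : ℝ) ∈ Icc (0 : ℝ) 1 := by simp
  have hN := MemH1Mat.h1NormSq_nonneg A
  set c := 1 + 2 * (d * (1 + h1NormSq A)) / ε with hc
  have hc1 : 1 ≤ c := by
    rw [hc]
    have : 0 ≤ 2 * (d * (1 + h1NormSq A)) / ε := by positivity
    linarith
  have hG := h.fundamentalGram_eq hM
  have hps : (fundamentalGram ε A).PosSemidef := by
    refine Matrix.posSemidef_of_isSymm ?_ fun v => ?_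
    · rw [hG]
      simp [Matrix.IsSymm, Matrix.transpose_mul, (isSymm_gramIntegral (Y := Y) 1).eq,
        Matrix.mul_assoc]
    · rw [hG, quad_conj]
      exact (h.posSemidef_gramIntegral h1).dotProduct_nonneg _
  obtain ⟨h2, h3⟩ := hps.pow_le_det (lo := c⁻¹) (hi := ε / (2 * a)) (by positivity)
    (fun v => by
      rw [hG, quad_conj, inv_mul_le_iff₀ (by positivity)]
      have := h.le_quad_one_of_le hε ha hA.symm (fun t ht => hA.le_quad ht)
        (fun t ht => hA.quad_le ht) ((X 1)ᵀ *ᵥ v)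
      rwa [h.right_mulVec_left v h1] at this)
    (fun v => by
      rw [hG, quad_conj]
      have := h.quad_le hε ha hA.symm (fun t ht => hA.le_quad ht) ((X 1)ᵀ *ᵥ v) h1
      rwa [h.right_mulVec_left v h1] at this)
  have h4 := Real.log_le_log (by positivity) h2
  have h5 := Real.log_le_log (lt_of_lt_of_le (by positivity) h2) h3
  rw [Real.log_pow, Real.log_inv] at h4
  rw [Real.log_pow] at h5
  have h6 : 0 ≤ Real.log c := Real.log_nonneg hc1
  have h7 : (d : ℝ) * Real.log (ε / (2 * a)) ≤ d * |Real.log (ε / (2 * a))| :=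
    mul_le_mul_of_nonneg_left (le_abs_self _) (by positivity)
  have h8 : 0 ≤ (d : ℝ) * |Real.log (ε / (2 * a))| := by positivity
  have h9 : 0 ≤ (d : ℝ) * Real.log c := by positivity
  rw [abs_le, mul_add]
  constructor <;> linarith

omit hA in
theorem abs_bridgeCorr_le (hA : MemH1Mat a A) (t : ℝ) (i j : Fin d) :
    |bridgeCorr X Y t i j| ≤ (bridgeCorr X Y t).trace :=
  (h.posSemidef_bridgeCorr hε ha hA.symm (fun _ ht => hA.le_quad ht) t).abs_apply_le_trace i j

theorem integral_abs_bridgeCorr_le (i j : Fin d) :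
    ∫ t in (0 : ℝ)..1, |bridgeCorr X Y t i j| ≤ d / 2 * (ε / a) ^ 2 := by
  have hc := h.continuousOn_bridgeCorr
  refine le_trans (intervalIntegral.integral_mono_on zero_le_one
    (intervalIntegrable_of_continuousOn_unit
      (continuousOn_pi.1 (continuousOn_pi.1 hc i) j)).abs
    (intervalIntegrable_of_continuousOn_unit (continuousOn_matrix_trace hc))
    fun t _ => h.abs_bridgeCorr_le hε ha hA t i j) ?_
  exact h.integral_trace_bridgeCorr_le hε ha hA.symm fun _ ht => hA.le_quad ht

omit hε ha hA in
theorem intervalIntegrable_bridgeCorr (i j : Fin d) :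
    IntervalIntegrable (fun t => bridgeCorr X Y t i j) volume 0 1 :=
  intervalIntegrable_of_continuousOn_unit
    (continuousOn_pi.1 (continuousOn_pi.1 h.continuousOn_bridgeCorr i) j)

/-- The expected quadratic term is `∫ Tr A` up to a small error. -/
theorem abs_integral_trace_schrodingerPotential_sub_le
    (hC : ∀ t ∈ Icc (0 : ℝ) 1, ∀ i, bridgeCorr X Y t i i ≤ freeCov X Y t i i) :
    |ε * (∫ t in (0 : ℝ)..1,
        (schrodingerPotential ε A t * (freeCov X Y t - bridgeCorr X Y t)).trace)
      - ∫ t in (0 : ℝ)..1, (A t).trace|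
      ≤ ε * ((3 * d ^ 3 * a⁻¹ + d ^ 4 * a⁻¹ ^ 2) * (1 + h1NormSq A)) := by
  have hKc := h.continuousOn_freeCov hA
  have hQc := h.continuousOn_bridgeCorr
  have hCc : ContinuousOn (fun t => freeCov X Y t - bridgeCorr X Y t) (Icc 0 1) := hKc.sub hQc
  have hN := MemH1Mat.h1NormSq_nonneg A
  have h1 : (1 : ℝ) ∈ Icc (0 : ℝ) 1 := by simp
  have i1 : IntervalIntegrable (fun t => ε⁻¹ * (A t * A t * freeCov X Y t).trace) volume 0 1 :=
    ((intervalIntegrable_of_continuousOn_unit (continuousOn_matrix_trace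
      ((hA.continuousOn.mul hA.continuousOn).mul hKc))).const_mul _)
  have i2 : IntervalIntegrable (fun t => ε⁻¹ * (A t * A t * bridgeCorr X Y t).trace) volume 0 1 :=
    ((intervalIntegrable_of_continuousOn_unit (continuousOn_matrix_trace
      ((hA.continuousOn.mul hA.continuousOn).mul hQc))).const_mul _)
  have i3 : IntervalIntegrable
      (fun t => ((freeCov X Y t - bridgeCorr X Y t) * matDeriv A t).trace) volume 0 1 := by
    simp only [trace_mul_eq_sum]
    refine intervalIntegrable_finset_sum _ fun i _ => intervalIntegrable_finset_sum _ fun j _ => ?_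
    refine (hA.intervalIntegrable_matDeriv j i).continuousOn_mul ?_
    rw [uIcc_of_le zero_le_one]
    exact continuousOn_pi.1 (continuousOn_pi.1 hCc i) j
  -- Three pieces: the main term `ε⁻¹Tr(A²K)`, known from the Lyapunov identity; `ε⁻¹Tr(A²Q)`, small
  -- since `Q` is of order `ε²` in the mean; and the `A'` term, small since the covariance is `O(ε)`
  -- pointwise.
  have e1 : ∀ t, ε * (schrodingerPotential ε A t * (freeCov X Y t - bridgeCorr X Y t)).trace
      = ε⁻¹ * (A t * A t * freeCov X Y t).trace - ε⁻¹ * (A t * A t * bridgeCorr X Y t).trace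
        - ((freeCov X Y t - bridgeCorr X Y t) * matDeriv A t).trace := by
    intro t
    rw [schrodingerPotential, Matrix.sub_mul, Matrix.trace_sub, Matrix.smul_mul, Matrix.smul_mul,
      Matrix.trace_smul, Matrix.trace_smul, Matrix.trace_mul_comm (matDeriv A t), Matrix.mul_sub,
      Matrix.trace_sub]
    simp only [smul_eq_mul]
    field_simp
  have hK : ∀ t ∈ Icc (0 : ℝ) 1, ∀ i j, |freeCov X Y t i j| ≤ d * (ε / a) :=
    fun t ht i j => h.abs_freeCov_le hε ha hA ht i j
  have hCb : ∀ t ∈ Icc (0 : ℝ) 1, ∀ i j,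
      |(freeCov X Y t - bridgeCorr X Y t) i j| ≤ 2 * (d * (ε / a)) := by
    intro t ht i j
    have h2 := h.abs_bridgeCorr_le hε ha hA t i j
    -- A pointwise bound on `Q` is needed against `A'`. It comes from `hC`, which expresses that the
    -- variances of the bridge are nonnegative.
    have h3 : (bridgeCorr X Y t).trace ≤ (freeCov X Y t).trace :=
      Finset.sum_le_sum fun i _ => hC t ht i
    have h4 := h.trace_freeCov_le hε ha hA ht
    have h5 := hK t ht i j
    rw [Matrix.sub_apply]
    have := abs_sub (freeCov X Y t i j) (bridgeCorr X Y t i j)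
    linarith
  have b1 := abs_integral_trace_mul_le (by positivity) hK hA.intervalIntegrable_matDeriv
    hA.integral_abs_matDeriv_le
  have b2 := abs_integral_trace_mul_le (by positivity) hCb hA.intervalIntegrable_matDeriv
    hA.integral_abs_matDeriv_le
  have b3 := abs_integral_trace_mul_le (by positivity) (fun t ht => hA.abs_mul_self_le ht)
    h.intervalIntegrable_bridgeCorr (h.integral_abs_bridgeCorr_le hε ha hA)
  have b4 : |(A 1 * freeCov X Y 1).trace| ≤ d ^ 2 * ((1 + h1NormSq A) * (d * (ε / a))) := by
    refine (abs_trace_mul_le _ _).trans ?_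
    calc _ ≤ ∑ _i : Fin d, ∑ _j : Fin d, (1 + h1NormSq A) * (d * (ε / a)) :=
          Finset.sum_le_sum fun i _ => Finset.sum_le_sum fun j _ =>
            mul_le_mul (hA.abs_le h1 i j) (hK 1 h1 j i) (abs_nonneg _) (by positivity)
      _ = _ := by simp; ring
  rw [← intervalIntegral.integral_const_mul]
  simp only [e1]
  rw [intervalIntegral.integral_sub (i1.sub i2) i3, intervalIntegral.integral_sub i1 i2,
    h.integral_trace_sq_mul_freeCov hA, intervalIntegral.integral_const_mul]
  set I1 := ∫ t in (0 : ℝ)..1, (freeCov X Y t * matDeriv A t).trace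
  set I2 := ∫ t in (0 : ℝ)..1, (A t * A t * bridgeCorr X Y t).trace
  set I3 := ∫ t in (0 : ℝ)..1, ((freeCov X Y t - bridgeCorr X Y t) * matDeriv A t).trace
  set T := (A 1 * freeCov X Y 1).trace
  have b5 : |ε⁻¹ * I2| ≤ ε⁻¹ * (d ^ 2 * (2 * d * (1 + h1NormSq A) * (d / 2 * (ε / a) ^ 2))) := by
    rw [abs_mul, abs_of_pos (inv_pos.2 hε)]
    exact mul_le_mul_of_nonneg_left b3 (by positivity)
  have e2 : ε⁻¹ * (d ^ 2 * (2 * d * (1 + h1NormSq A) * (d / 2 * (ε / a) ^ 2)))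
      = ε * (d ^ 4 * a⁻¹ ^ 2 * (1 + h1NormSq A)) := by
    field_simp
  rw [e2] at b5
  have e3 : (d : ℝ) ^ 2 * (d * (ε / a) * (1 + h1NormSq A))
      = ε * (d ^ 3 * a⁻¹ * (1 + h1NormSq A)) := by
    field_simp
  have e4 : (d : ℝ) ^ 2 * (2 * (d * (ε / a)) * (1 + h1NormSq A))
      = 2 * (ε * (d ^ 3 * a⁻¹ * (1 + h1NormSq A))) := by
    rw [← e3]; ring
  have e5 : (d : ℝ) ^ 2 * ((1 + h1NormSq A) * (d * (ε / a)))
      = ε * (d ^ 3 * a⁻¹ * (1 + h1NormSq A)) := by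
    rw [← e3]; ring
  rw [e3] at b1
  rw [e4] at b2
  rw [e5] at b4
  rw [abs_le] at b1 b2 b4 b5 ⊢
  constructor <;> linarith [b1.1, b1.2, b2.1, b2.2, b4.1, b4.2, b5.1, b5.2]

/-- The covariance, tested against a bounded field, is close to `ε A⁻¹`. -/
theorem abs_integral_trace_mul_cov_sub_le {S : ℝ → Matrix (Fin d) (Fin d) ℝ} {σ b : ℝ}
    (hSc : ContinuousOn S (Icc 0 1)) (hσ : 0 ≤ σ)
    (hS : ∀ t ∈ Icc (0 : ℝ) 1, ∀ i j, |S t i j| ≤ σ) (hε1 : ε ≤ 1) (hb : ε * h1NormSq A ≤ b) :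
    |ε⁻¹ * (∫ t in (0 : ℝ)..1, (S t * (freeCov X Y t - bridgeCorr X Y t)).trace)
      - ∫ t in (0 : ℝ)..1, (S t * (A t)⁻¹).trace|
      ≤ √ε * (d ^ 2 * (σ * (1 + (2 * a)⁻¹ * (d ^ 2 * a⁻¹ ^ 2) + (2 * a)⁻¹ ^ 2 * a⁻¹ ^ 4 * b
        + d * a⁻¹ ^ 2))) := by
  have hKc := h.continuousOn_freeCov hA
  have hQc := h.continuousOn_bridgeCorr
  have hIc : ContinuousOn (fun t => (A t)⁻¹) (Icc 0 1) :=
    continuousOn_pi.2 fun i => continuousOn_pi.2 fun j => (hA.ac_inv ha i j).continuousOn_unit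
  set E : ℝ → Matrix (Fin d) (Fin d) ℝ := fun t => ε⁻¹ • freeCov X Y t - (A t)⁻¹ with hE
  have hEc : ContinuousOn E (Icc 0 1) := (hKc.const_smul ε⁻¹).sub hIc
  have hEi : ∀ i j, ContinuousOn (fun t => E t i j) (Icc 0 1) := fun i j =>
    continuousOn_pi.1 (continuousOn_pi.1 hEc i) j
  have hr : 0 < √ε := Real.sqrt_pos.2 hε
  have hrr : √ε * √ε = ε := Real.mul_self_sqrt hε.le
  have hfi : IntervalIntegrable (fun t => frobSq (E t)) volume 0 1 := by
    refine intervalIntegrable_of_continuousOn_unit ?_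
    unfold frobSq
    exact continuousOn_finsetSum _ fun i _ => continuousOn_finsetSum _ fun j _ => (hEi i j).pow 2
  have hEint : ∀ i j, ∫ t in (0 : ℝ)..1, |E t i j|
      ≤ √ε * (1 + (2 * a)⁻¹ * (d ^ 2 * a⁻¹ ^ 2) + (2 * a)⁻¹ ^ 2 * a⁻¹ ^ 4 * b) := by
    intro i j
    -- Passing from `L²` to `L¹`: Young's inequality with weight `√ε` balances a constant of size
    -- `√ε` against `∫|E|² = O(ε)`.
    have h1 : ∫ t in (0 : ℝ)..1, |E t i j| ≤ ∫ t in (0 : ℝ)..1, (√ε + (√ε)⁻¹ * frobSq (E t)) := by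
      refine intervalIntegral.integral_mono_on zero_le_one
        (intervalIntegrable_of_continuousOn_unit (hEi i j)).abs
        (.add (by simp) (hfi.const_mul _)) fun t _ => ?_
      have h2 := abs_apply_sq_le_frobSq (E t) i j
      rw [← sq_abs] at h2
      have h3 : (√ε)⁻¹ * |E t i j| ^ 2 ≤ (√ε)⁻¹ * frobSq (E t) :=
        mul_le_mul_of_nonneg_left h2 (by positivity)
      have h4 : 0 ≤ (√ε)⁻¹ * (|E t i j| - √ε) ^ 2 := by positivity
      have h5 : (√ε)⁻¹ * (|E t i j| - √ε) ^ 2 = (√ε)⁻¹ * |E t i j| ^ 2 - 2 * |E t i j| + √ε := by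
        field_simp
        ring
      have := abs_nonneg (E t i j)
      linarith
    rw [intervalIntegral.integral_add (by simp) (hfi.const_mul _),
      intervalIntegral.integral_const_mul] at h1
    have h2 := h.integral_frobSq_freeCov_sub_inv_le hε ha hA
    have h3 : (√ε)⁻¹ * (∫ t in (0 : ℝ)..1, frobSq (E t))
        ≤ √ε * ((2 * a)⁻¹ * (d ^ 2 * a⁻¹ ^ 2) + (2 * a)⁻¹ ^ 2 * a⁻¹ ^ 4 * b) := by
      rw [inv_mul_le_iff₀ hr, ← mul_assoc, hrr]
      refine h2.trans (mul_le_mul_of_nonneg_left ?_ hε.le)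
      have : (2 * a)⁻¹ ^ 2 * a⁻¹ ^ 4 * (ε * h1NormSq A) ≤ (2 * a)⁻¹ ^ 2 * a⁻¹ ^ 4 * b :=
        mul_le_mul_of_nonneg_left hb (by positivity)
      linarith
    simp at h1
    refine h1.trans ?_
    simp only [inv_pow] at h3 ⊢
    linarith
  have b1 := abs_integral_trace_mul_le hσ hS
    (fun i j => intervalIntegrable_of_continuousOn_unit (hEi i j)) hEint
  have b2 := abs_integral_trace_mul_le hσ hS
    h.intervalIntegrable_bridgeCorr (h.integral_abs_bridgeCorr_le hε ha hA)
  have i1 : IntervalIntegrable (fun t => (S t * E t).trace) volume 0 1 :=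
    intervalIntegrable_of_continuousOn_unit (continuousOn_matrix_trace (hSc.mul hEc))
  have i2 : IntervalIntegrable (fun t => (S t * bridgeCorr X Y t).trace) volume 0 1 :=
    intervalIntegrable_of_continuousOn_unit (continuousOn_matrix_trace (hSc.mul hQc))
  have i3 : IntervalIntegrable (fun t => (S t * (A t)⁻¹).trace) volume 0 1 :=
    intervalIntegrable_of_continuousOn_unit (continuousOn_matrix_trace (hSc.mul hIc))
  have i4 : IntervalIntegrable (fun t => (S t * (freeCov X Y t - bridgeCorr X Y t)).trace)
      volume 0 1 :=
    intervalIntegrable_of_continuousOn_unit (continuousOn_matrix_trace (hSc.mul (hKc.sub hQc)))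
  have e1 : ε⁻¹ * (∫ t in (0 : ℝ)..1, (S t * (freeCov X Y t - bridgeCorr X Y t)).trace)
      - ∫ t in (0 : ℝ)..1, (S t * (A t)⁻¹).trace
      = (∫ t in (0 : ℝ)..1, (S t * E t).trace)
        - ε⁻¹ * ∫ t in (0 : ℝ)..1, (S t * bridgeCorr X Y t).trace := by
    rw [← intervalIntegral.integral_const_mul, ← intervalIntegral.integral_const_mul,
      ← intervalIntegral.integral_sub (i4.const_mul _) i3,
      ← intervalIntegral.integral_sub i1 (i2.const_mul _)]
    refine intervalIntegral.integral_congr fun t _ => ?_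
    simp only [hE, Matrix.mul_sub, Matrix.mul_smul, Matrix.trace_sub, Matrix.trace_smul,
      smul_eq_mul]
    ring
  rw [e1]
  have b3 : |ε⁻¹ * ∫ t in (0 : ℝ)..1, (S t * bridgeCorr X Y t).trace|
      ≤ √ε * (d ^ 2 * (σ * (d * a⁻¹ ^ 2))) := by
    rw [abs_mul, abs_of_pos (inv_pos.2 hε)]
    refine (mul_le_mul_of_nonneg_left b2 (by positivity)).trans ?_
    have e2 : ε⁻¹ * (d ^ 2 * (σ * (d / 2 * (ε / a) ^ 2)))
        = (ε / 2) * (d ^ 2 * (σ * (d * a⁻¹ ^ 2))) := by field_simp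
    rw [e2]
    refine mul_le_mul_of_nonneg_right ?_ (by positivity)
    have : √ε ≤ 1 := Real.sqrt_le_one.2 hε1
    nlinarith
  refine (abs_sub _ _).trans ((add_le_add b1 b3).trans (le_of_eq ?_))
  ring

end IsFundamentalPair

/-! ## The Dirichlet problem for `-∂ₜ² + B_ε` -/

section VectorCalculus

variable {d : ℕ} {v w : ℝ → Fin d → ℝ} {v' w' : Fin d → ℝ} {t : ℝ} {s : Set ℝ}

theorem HasMatDeriv.mulVec {X : ℝ → Matrix (Fin d) (Fin d) ℝ} {X' : Matrix (Fin d) (Fin d) ℝ}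
    (hX : HasMatDeriv X X' t) (hv : HasDerivWithinAt v v' (Icc 0 1) t) :
    HasDerivWithinAt (fun r => X r *ᵥ v r) (X' *ᵥ v t + X t *ᵥ v') (Icc 0 1) t := by
  refine hasDerivWithinAt_pi.2 fun i => ?_
  have h := HasDerivWithinAt.fun_sum (u := Finset.univ) fun j _ =>
    (hX i j).mul (hasDerivWithinAt_pi.1 hv j)
  rw [Pi.add_apply]
  simp only [Matrix.mulVec, dotProduct]
  rw [← Finset.sum_add_distrib]
  exact h

theorem HasDerivWithinAt.dotProduct_pi (hv : HasDerivWithinAt v v' s t)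
    (hw : HasDerivWithinAt w w' s t) :
    HasDerivWithinAt (fun r => v r ⬝ᵥ w r) (v' ⬝ᵥ w t + v t ⬝ᵥ w') s t := by
  have h := HasDerivWithinAt.fun_sum (u := Finset.univ) fun j _ =>
    (hasDerivWithinAt_pi.1 hv j).mul (hasDerivWithinAt_pi.1 hw j)
  simp only [dotProduct]
  rw [← Finset.sum_add_distrib]
  exact h

theorem hasDerivWithinAt_euclidean_of_pi (hv : HasDerivWithinAt v v' s t) :
    HasDerivWithinAt (fun r => (WithLp.toLp 2 (v r) : EuclideanSpace ℝ (Fin d)))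
      (WithLp.toLp 2 v') s t :=
  (PiLp.continuousLinearEquiv 2 ℝ (fun _ : Fin d => ℝ)).symm.toContinuousLinearMap.hasFDerivAt
    |>.comp_hasDerivWithinAt t hv

theorem hasDerivAt_ofLp {φ : ℝ → EuclideanSpace ℝ (Fin d)} {φ' : EuclideanSpace ℝ (Fin d)}
    (h : HasDerivAt φ φ' t) : HasDerivAt (fun r => (φ r).ofLp) φ'.ofLp t :=
  (PiLp.continuousLinearEquiv 2 ℝ (fun _ : Fin d => ℝ)).toContinuousLinearMap.hasFDerivAt
    |>.comp_hasDerivAt t h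

theorem ContinuousOn.matrix_mulVec_pi {W : ℝ → Matrix (Fin d) (Fin d) ℝ} (hW : ContinuousOn W s)
    (hv : ContinuousOn v s) : ContinuousOn (fun t => W t *ᵥ v t) s := by
  refine continuousOn_pi.2 fun i => ?_
  simp only [Matrix.mulVec, dotProduct]
  exact continuousOn_finsetSum _ fun j _ => (continuousOn_pi.1 (continuousOn_pi.1 hW i) j).mul (continuousOn_pi.1 hv j)

theorem ContinuousOn.dotProduct_pi (hv : ContinuousOn v s) (hw : ContinuousOn w s) :
    ContinuousOn (fun t => v t ⬝ᵥ w t) s :=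
  continuousOn_finsetSum _ fun j _ => (continuousOn_pi.1 hv j).mul (continuousOn_pi.1 hw j)

theorem continuous_ofLp_comp {φ : ℝ → EuclideanSpace ℝ (Fin d)} (h : ContinuousOn φ s) :
    ContinuousOn (fun r => (φ r).ofLp) s :=
  (PiLp.continuous_ofLp 2 (fun _ : Fin d => ℝ)).comp_continuousOn h

theorem euclidean_inner_eq_dotProduct (x y : EuclideanSpace ℝ (Fin d)) :
    inner ℝ x y = x.ofLp ⬝ᵥ y.ofLp := by
  rw [EuclideanSpace.inner_eq_star_dotProduct, dotProduct_comm]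
  simp

theorem dotProduct_integral {b c : ℝ} (x : Fin d → ℝ)
    (hv : ∀ i, IntervalIntegrable (fun r => v r i) volume b c) :
    x ⬝ᵥ (fun i => ∫ r in b..c, v r i) = ∫ r in b..c, x ⬝ᵥ v r := by
  simp only [dotProduct]
  rw [intervalIntegral.integral_finsetSum fun i _ => (hv i).const_mul _]
  simp only [intervalIntegral.integral_const_mul]

end VectorCalculus

namespace IsFundamentalPair

variable {d : ℕ} {ε a : ℝ} {A X Y : ℝ → Matrix (Fin d) (Fin d) ℝ}
  (h : IsFundamentalPair ε A X Y) (hε : 0 < ε) (ha : 0 < a) (hA : MemH1Mat a A)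

include h hε ha hA in
/-- The Green function of the Dirichlet problem. -/
theorem exists_isDirichletSolution {g : ℝ → EuclideanSpace ℝ (Fin d)} (hg : Continuous g) :
    ∃ u, IsDirichletSolution ε A g u ∧ ∀ s ∈ Icc (0 : ℝ) 1, ∀ c : Fin d → ℝ,
      c ⬝ᵥ (u s).ofLp = ∫ r in (0 : ℝ)..1, (g r).ofLp ⬝ᵥ (X r *ᵥ
        (gramIntegral Y (min r s) *ᵥ ((X s)ᵀ *ᵥ c) - gramIntegral Y r *ᵥ
          ((gramIntegral Y 1)⁻¹ *ᵥ (gramIntegral Y s *ᵥ ((X s)ᵀ *ᵥ c))))) := by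
  have h0 : (0 : ℝ) ∈ Icc (0 : ℝ) 1 := by simp
  have h1 : (1 : ℝ) ∈ Icc (0 : ℝ) 1 := by simp
  have hgc : ContinuousOn (fun r => (g r).ofLp) (Icc 0 1) := continuous_ofLp_comp hg.continuousOn
  have hXt : ContinuousOn (fun r => (X r)ᵀ) (Icc 0 1) :=
    continuous_id.matrix_transpose.comp_continuousOn h.continuousOn_left
  have hjc : ContinuousOn (fun r => (X r)ᵀ *ᵥ (g r).ofLp) (Icc 0 1) := hXt.matrix_mulVec_pi hgc
  have hlc : ContinuousOn (fun r => gramIntegral Y r *ᵥ ((X r)ᵀ *ᵥ (g r).ofLp)) (Icc 0 1) :=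
    h.continuousOn_gramIntegral.matrix_mulVec_pi hjc
  set J : ℝ → Fin d → ℝ := fun t i => ∫ r in (0 : ℝ)..t, ((X r)ᵀ *ᵥ (g r).ofLp) i with hJ
  set L : ℝ → Fin d → ℝ := fun t i =>
    ∫ r in (0 : ℝ)..t, (gramIntegral Y r *ᵥ ((X r)ᵀ *ᵥ (g r).ofLp)) i with hL
  have hJd : ∀ t ∈ Icc (0 : ℝ) 1, HasDerivWithinAt J ((X t)ᵀ *ᵥ (g t).ofLp) (Icc 0 1) t :=
    fun t ht => hasDerivWithinAt_pi.2 fun i =>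
      hasDerivWithinAt_unit_integral (continuousOn_pi.1 hjc i) ht
  have hLd : ∀ t ∈ Icc (0 : ℝ) 1,
      HasDerivWithinAt L (gramIntegral Y t *ᵥ ((X t)ᵀ *ᵥ (g t).ofLp)) (Icc 0 1) t :=
    fun t ht => hasDerivWithinAt_pi.2 fun i =>
      hasDerivWithinAt_unit_integral (continuousOn_pi.1 hlc i) ht
  set P := gramIntegral Y 1 with hP
  have hPu : P * P⁻¹ = 1 := Matrix.mul_nonsing_inv _
    (h.posDef_gramIntegral_one hε ha hA.symm fun _ ht => hA.le_quad ht).det_pos.ne'.isUnit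
  -- Variation of constants for the two factors: `w = Yᵀp` solves `w' = ε⁻¹Aw - g`, and `v = Xq`
  -- solves `v' + ε⁻¹Av = w`. The constant `-R(1)⁻¹L(1)` in `p` is chosen so that `q(1) = 0`.
  set p : ℝ → Fin d → ℝ := fun t => J 1 - P⁻¹ *ᵥ L 1 - J t with hp
  have hpd : ∀ t ∈ Icc (0 : ℝ) 1,
      HasDerivWithinAt p (-((X t)ᵀ *ᵥ (g t).ofLp)) (Icc 0 1) t := fun t ht =>
    (hJd t ht).const_sub _
  set q : ℝ → Fin d → ℝ := fun t => L t + gramIntegral Y t *ᵥ p t with hq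
  have hqd : ∀ t ∈ Icc (0 : ℝ) 1,
      HasDerivWithinAt q ((Y t * (Y t)ᵀ) *ᵥ p t) (Icc 0 1) t := fun t ht => by
    refine ((hLd t ht).add ((h.hasMatDeriv_gramIntegral ht).mulVec (hpd t ht))).congr_deriv ?_
    rw [Matrix.mulVec_neg]
    abel
  have hL0 : L 0 = 0 := by funext i; simp [hL]
  have hq0 : q 0 = 0 := by simp [hq, hL0, gramIntegral_zero]
  have hq1 : q 1 = 0 := by
    simp only [hq, hp]
    rw [sub_right_comm, sub_self, zero_sub, Matrix.mulVec_neg, Matrix.mulVec_mulVec, hPu,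
      Matrix.one_mulVec]
    simp
  set w : ℝ → Fin d → ℝ := fun t => (Y t)ᵀ *ᵥ p t with hw
  set v : ℝ → Fin d → ℝ := fun t => X t *ᵥ q t with hv
  have hwd : ∀ t ∈ Icc (0 : ℝ) 1,
      HasDerivWithinAt w (ε⁻¹ • (A t *ᵥ w t) - (g t).ofLp) (Icc 0 1) t := fun t ht => by
    refine ((h.right_deriv t ht).transpose.mulVec (hpd t ht)).congr_deriv ?_
    rw [Matrix.transpose_smul, Matrix.transpose_mul, (hA.symm t ht).eq, Matrix.smul_mulVec,
      Matrix.mulVec_neg, h.right_mulVec_left _ ht, ← Matrix.mulVec_mulVec, ← sub_eq_add_neg]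
  have hvd : ∀ t ∈ Icc (0 : ℝ) 1,
      HasDerivWithinAt v (w t - ε⁻¹ • (A t *ᵥ v t)) (Icc 0 1) t := fun t ht => by
    refine ((h.left_deriv t ht).mulVec (hqd t ht)).congr_deriv ?_
    rw [Matrix.neg_mulVec, Matrix.smul_mulVec, ← Matrix.mulVec_mulVec, Matrix.mulVec_mulVec _ (X t),
      ← Matrix.mul_assoc, h.left_mul_right ht, Matrix.one_mul]
    abel
  have hwc : ContinuousOn w (Icc 0 1) := fun t ht => (hwd t ht).continuousWithinAt
  have hvc : ContinuousOn v (Icc 0 1) := fun t ht => (hvd t ht).continuousWithinAt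
  have hv'c : ContinuousOn (fun t => w t - ε⁻¹ • (A t *ᵥ v t)) (Icc 0 1) :=
    hwc.sub ((hA.continuousOn.matrix_mulVec_pi hvc).const_smul ε⁻¹)
  have hw'c : ContinuousOn (fun t => ε⁻¹ • (A t *ᵥ w t) - (g t).ofLp) (Icc 0 1) :=
    ((hA.continuousOn.matrix_mulVec_pi hwc).const_smul ε⁻¹).sub hgc
  have hvac : ∀ i, AbsolutelyContinuousOnInterval (fun t => v t i) 0 1 := fun i =>
    .of_hasDerivWithinAt (fun t ht => hasDerivWithinAt_pi.1 (hvd t ht) i) (continuousOn_pi.1 hv'c i)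
  have hwac : ∀ i, AbsolutelyContinuousOnInterval (fun t => w t i) 0 1 := fun i =>
    .of_hasDerivWithinAt (fun t ht => hasDerivWithinAt_pi.1 (hwd t ht) i) (continuousOn_pi.1 hw'c i)
  set u : ℝ → EuclideanSpace ℝ (Fin d) := fun t => WithLp.toLp 2 (v t) with hu
  have hud : ∀ t ∈ Icc (0 : ℝ) 1, HasDerivWithinAt u
      (WithLp.toLp 2 (w t - ε⁻¹ • (A t *ᵥ v t))) (Icc 0 1) t := fun t ht =>
    hasDerivWithinAt_euclidean_of_pi (hvd t ht)
  have hu'c : ContinuousOn (fun t => (WithLp.toLp 2 (w t - ε⁻¹ • (A t *ᵥ v t)) :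
      EuclideanSpace ℝ (Fin d))) (Icc 0 1) :=
    (PiLp.continuous_toLp 2 (fun _ : Fin d => ℝ)).comp_continuousOn hv'c
  have hud' : ∀ t ∈ Ioo (0 : ℝ) 1,
      deriv u t = WithLp.toLp 2 (w t - ε⁻¹ • (A t *ᵥ v t)) := fun t ht =>
    ((hud t (Ioo_subset_Icc_self ht)).hasDerivAt (Icc_mem_nhds ht.1 ht.2)).deriv
  refine ⟨u, ⟨⟨.of_hasDerivWithinAt hud hu'c, ?_⟩, ?_, ?_, ?_⟩, ?_⟩
  · have h2 : MemLp (fun t => (WithLp.toLp 2 (w t - ε⁻¹ • (A t *ᵥ v t)) :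
        EuclideanSpace ℝ (Fin d))) 2 (volume.restrict (Ioo 0 1)) := by
      obtain ⟨C, hC⟩ := isCompact_Icc.exists_bound_of_continuousOn hu'c
      refine MemLp.of_bound ((hu'c.mono Ioo_subset_Icc_self).aestronglyMeasurable measurableSet_Ioo)
        C ?_
      filter_upwards [ae_restrict_mem measurableSet_Ioo] with t ht
      exact hC t (Ioo_subset_Icc_self ht)
    refine (memLp_congr_ae ?_).2 h2
    filter_upwards [ae_restrict_mem measurableSet_Ioo] with t ht using hud' t ht
  · simp [hu, hv, hq0]
  · simp [hu, hv, hq1]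
  · intro φ hφ _ hsupp
    have hφ0 : ∀ t ∉ Ioo (0 : ℝ) 1, φ t = 0 := fun t ht =>
      image_eq_zero_of_notMem_tsupport fun hm => ht (hsupp hm)
    have hφd : ∀ t, HasDerivAt (fun r => (φ r).ofLp) (deriv φ t).ofLp t := fun t =>
      hasDerivAt_ofLp ((hφ.differentiable (by simp)) t).hasDerivAt
    have hφ'c : Continuous (fun t => (deriv φ t).ofLp) :=
      (PiLp.continuous_ofLp 2 (fun _ : Fin d => ℝ)).comp (hφ.continuous_deriv (by simp))
    have hφac : ∀ i, AbsolutelyContinuousOnInterval (fun t => (φ t).ofLp i) 0 1 := fun i =>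
      .of_hasDerivWithinAt (fun t _ => (hasDerivAt_pi.1 (hφd t) i).hasDerivWithinAt)
        (continuous_pi_iff.1 hφ'c i).continuousOn
    -- `Θ'` is the weak integrand minus `g·φ`, and `Θ` vanishes at both ends with `φ`. The term `A'`
    -- in `B_ε` arises from differentiating `A` in `Θ`, so no second derivative of `u` occurs.
    set Θ : ℝ → ℝ := fun t => w t ⬝ᵥ (φ t).ofLp - ε⁻¹ * ((φ t).ofLp ⬝ᵥ (A t *ᵥ v t)) with hΘ
    have hΘac : AbsolutelyContinuousOnInterval Θ 0 1 := by
      simp only [hΘ, dotProduct, Matrix.mulVec]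
      exact (AbsolutelyContinuousOnInterval.fun_sum_unit _ fun i _ =>
        (hwac i).fun_mul (hφac i)).fun_sub
        ((AbsolutelyContinuousOnInterval.fun_sum_unit _ fun i _ => (hφac i).fun_mul
          (.fun_sum_unit _ fun j _ => (hA.ac i j).fun_mul (hvac j))).const_mul _)
    have hgφ : IntervalIntegrable (fun t => inner ℝ (g t) (φ t)) volume 0 1 :=
      (hg.inner hφ.continuous).intervalIntegrable _ _
    obtain ⟨i1, i2⟩ := hΘac.integral_eq_sub_of_ae_hasDerivAt (u' := fun t =>
        (inner ℝ (deriv u t) (deriv φ t)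
          + (schrodingerPotential ε A t *ᵥ (u t).ofLp) ⬝ᵥ (φ t).ofLp)
        - inner ℝ (g t) (φ t)) (by
      filter_upwards [hA.ae_hasMatDeriv] with t h2 ht
      have ht' := Ioo_subset_Icc_self ht
      have h3 : HasMatDeriv A (matDeriv A t) t := fun i j => (h2 ht i j).hasDerivWithinAt
      have h4 := (hφd t).hasDerivWithinAt (s := Icc 0 1)
      refine ((((hwd t ht').dotProduct_pi h4).sub
        ((h4.dotProduct_pi (h3.mulVec (hvd t ht'))).const_mul ε⁻¹)).congr_deriv ?_).hasDerivAt
        (Icc_mem_nhds ht.1 ht.2)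
      rw [hud' t ht]
      simp only [euclidean_inner_eq_dotProduct, hu, schrodingerPotential, Matrix.sub_mulVec,
        Matrix.smul_mulVec, sub_dotProduct, smul_dotProduct, dotProduct_sub, dotProduct_add,
        dotProduct_smul, Matrix.mulVec_sub, Matrix.mulVec_smul, smul_eq_mul,
        ← Matrix.mulVec_mulVec]
      simp only [dotProduct_comm (φ t).ofLp, dotProduct_comm (deriv φ t).ofLp]
      ring)
    have i3 : ∫ t in (0 : ℝ)..1, (inner ℝ (deriv u t) (deriv φ t)
          + (schrodingerPotential ε A t *ᵥ (u t).ofLp) ⬝ᵥ (φ t).ofLp)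
        = ∫ t in (0 : ℝ)..1, (((inner ℝ (deriv u t) (deriv φ t)
          + (schrodingerPotential ε A t *ᵥ (u t).ofLp) ⬝ᵥ (φ t).ofLp)
          - inner ℝ (g t) (φ t)) + inner ℝ (g t) (φ t)) := by simp
    rw [i3, intervalIntegral.integral_add i1 hgφ, i2]
    simp [hΘ, hφ0 0 (by simp), hφ0 1 (by simp)]
  · intro s hs c
    set x := (X s)ᵀ *ᵥ c with hx
    -- The `r < s` and `r > s` parts of the first kernel term come from `L(s)` and `J(1) - J(s)`;
    -- `min r s` merges them.
    have e1 : c ⬝ᵥ (u s).ofLp = x ⬝ᵥ L s + (gramIntegral Y s *ᵥ x) ⬝ᵥ (J 1 - J s)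
        - (P⁻¹ *ᵥ (gramIntegral Y s *ᵥ x)) ⬝ᵥ L 1 := by
      have hPs : P⁻¹.IsSymm := by
        rw [Matrix.IsSymm, Matrix.transpose_nonsing_inv, (isSymm_gramIntegral 1).eq]
      simp only [hu, hv]
      rw [Matrix.dotProduct_mulVec, ← Matrix.mulVec_transpose, ← hx]
      simp only [hq, hp]
      rw [dotProduct_add, (isSymm_gramIntegral s).dotProduct_mulVec_comm,
        ← hPs.dotProduct_mulVec_comm, sub_right_comm, dotProduct_sub]
      ring
    have hsub : ∀ {b c : ℝ}, b ∈ Icc (0 : ℝ) 1 → c ∈ Icc (0 : ℝ) 1 → uIcc b c ⊆ Icc 0 1 :=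
      fun hb hc => uIcc_subset_Icc hb hc
    have hji : ∀ {b c : ℝ}, b ∈ Icc (0 : ℝ) 1 → c ∈ Icc (0 : ℝ) 1 → ∀ i,
        IntervalIntegrable (fun r => ((X r)ᵀ *ᵥ (g r).ofLp) i) volume b c := fun hb hc i =>
      ((continuousOn_pi.1 hjc i).mono (hsub hb hc)).intervalIntegrable
    have hli : ∀ {b c : ℝ}, b ∈ Icc (0 : ℝ) 1 → c ∈ Icc (0 : ℝ) 1 → ∀ i,
        IntervalIntegrable (fun r => (gramIntegral Y r *ᵥ ((X r)ᵀ *ᵥ (g r).ofLp)) i)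
          volume b c := fun hb hc i =>
      ((continuousOn_pi.1 hlc i).mono (hsub hb hc)).intervalIntegrable
    have e2 : J 1 - J s = fun i => ∫ r in s..1, ((X r)ᵀ *ᵥ (g r).ofLp) i := by
      funext i
      exact intervalIntegral.integral_interval_sub_left (hji h0 h1 i) (hji h0 hs i)
    rw [e1, e2, hL, dotProduct_integral _ (hli h0 hs), dotProduct_integral _ (hji hs h1),
      dotProduct_integral _ (hli h0 h1)]
    have hmin : ContinuousOn (fun r => gramIntegral Y (min r s) *ᵥ x) (Icc 0 1) := by
      refine ContinuousOn.matrix_mulVec_pi (h.continuousOn_gramIntegral.comp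
        (continuous_id.min continuous_const).continuousOn fun r hr =>
          ⟨le_min hr.1 hs.1, (min_le_left _ _).trans hr.2⟩) continuousOn_const
    have c1 : ContinuousOn (fun r => (g r).ofLp ⬝ᵥ (X r *ᵥ (gramIntegral Y (min r s) *ᵥ x)))
        (Icc 0 1) := hgc.dotProduct_pi (h.continuousOn_left.matrix_mulVec_pi hmin)
    have c2 : ContinuousOn (fun r => (g r).ofLp ⬝ᵥ (X r *ᵥ (gramIntegral Y r *ᵥ
        (P⁻¹ *ᵥ (gramIntegral Y s *ᵥ x))))) (Icc 0 1) :=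
      hgc.dotProduct_pi (h.continuousOn_left.matrix_mulVec_pi
        (h.continuousOn_gramIntegral.matrix_mulVec_pi continuousOn_const))
    have e3 : ∀ r (y : Fin d → ℝ), y ⬝ᵥ ((X r)ᵀ *ᵥ (g r).ofLp) = (g r).ofLp ⬝ᵥ (X r *ᵥ y) := by
      intro r y
      rw [Matrix.dotProduct_mulVec, ← Matrix.mulVec_transpose, Matrix.transpose_transpose,
        dotProduct_comm]
    have e4 : ∀ r (y : Fin d → ℝ), y ⬝ᵥ (gramIntegral Y r *ᵥ ((X r)ᵀ *ᵥ (g r).ofLp))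
        = (g r).ofLp ⬝ᵥ (X r *ᵥ (gramIntegral Y r *ᵥ y)) := by
      intro r y
      rw [(isSymm_gramIntegral r).dotProduct_mulVec_comm, e3]
    simp only [e3, e4, Matrix.mulVec_sub, dotProduct_sub]
    rw [intervalIntegral.integral_sub (intervalIntegrable_of_continuousOn_unit c1)
      (intervalIntegrable_of_continuousOn_unit c2),
      ← intervalIntegral.integral_add_adjacent_intervals
        (c1.mono (hsub h0 hs)).intervalIntegrable (c1.mono (hsub hs h1)).intervalIntegrable]
    congr 2
    · refine intervalIntegral.integral_congr fun r hr => ?_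
      rw [uIcc_of_le hs.1] at hr
      simp only [min_eq_left hr.2]
    · refine intervalIntegral.integral_congr fun r hr => ?_
      rw [uIcc_of_le hs.2] at hr
      simp only [min_eq_right hr.1]

end IsFundamentalPair

/-! ## The one-point covariance of the bridge law -/

section PathFunctionals

variable {d : ℕ}

theorem continuous_pathEval_uncurry :
    Continuous fun p : PathSpace d × ℝ => pathEval p.1 p.2 :=
  continuous_eval.comp (continuous_fst.prodMk ((continuous_projIcc (h := zero_le_one' ℝ)).comp continuous_snd))

theorem continuous_pathEval (z : PathSpace d) : Continuous (pathEval z) :=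
  z.continuous.comp continuous_projIcc

theorem norm_pathEval_le (z : PathSpace d) (t : ℝ) : ‖pathEval z t‖ ≤ ‖z‖ :=
  z.norm_coe_le_norm _

/-- Evaluation of a path at time `t` as a continuous linear map. -/
noncomputable def pathEvalCLM (d : ℕ) (t : ℝ) : PathSpace d →L[ℝ] EuclideanSpace ℝ (Fin d) :=
  LinearMap.mkContinuous
    { toFun := fun z => pathEval z t
      map_add' := fun _ _ => rfl
      map_smul' := fun _ _ => rfl } 1 fun z => by
        rw [one_mul]
        exact norm_pathEval_le z t

/-- The `i`-th coordinate of a path at time `t` as a continuous linear functional. -/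
noncomputable def pathCoord (d : ℕ) (t : ℝ) (i : Fin d) : StrongDual ℝ (PathSpace d) :=
  (EuclideanSpace.proj i).comp (pathEvalCLM d t)

@[simp] theorem pathCoord_apply (z : PathSpace d) (t : ℝ) (i : Fin d) :
    pathCoord d t i z = (pathEval z t).ofLp i := rfl

/-- The pairing `z ↦ ∫₀¹ ⟨f(t), z(t)⟩ dt` as a continuous linear functional. -/
noncomputable def pathPairing {f : ℝ → EuclideanSpace ℝ (Fin d)} (hf : Continuous f) :
    StrongDual ℝ (PathSpace d) :=
  LinearMap.mkContinuousOfExistsBound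
    { toFun := fun z => ∫ t in (0 : ℝ)..1, inner ℝ (f t) (pathEval z t)
      map_add' := fun x y => by
        rw [← intervalIntegral.integral_add
          ((hf.inner (continuous_pathEval x)).intervalIntegrable _ _)
          ((hf.inner (continuous_pathEval y)).intervalIntegrable _ _)]
        simp only [← inner_add_right]
        rfl
      map_smul' := fun c x => by
        rw [RingHom.id_apply, smul_eq_mul, ← intervalIntegral.integral_const_mul]
        simp only [← inner_smul_right_eq_smul, ← smul_eq_mul]
        rfl } (by
    obtain ⟨C, hC⟩ := isCompact_Icc.exists_bound_of_continuousOn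
      (hf.continuousOn (s := Icc (0 : ℝ) 1))
    refine ⟨C, fun z => ?_⟩
    have := intervalIntegral.norm_integral_le_of_norm_le_const (a := (0 : ℝ)) (b := 1)
      (f := fun t => inner ℝ (f t) (pathEval z t)) (C := C * ‖z‖) fun t ht => by
        rw [uIoc_of_le zero_le_one] at ht
        have h1 := hC t (Ioc_subset_Icc_self ht)
        exact (norm_inner_le_norm _ _).trans (mul_le_mul h1 (norm_pathEval_le z t)
          (norm_nonneg _) ((norm_nonneg _).trans h1))
    simpa using this)

@[simp] theorem pathPairing_apply {f : ℝ → EuclideanSpace ℝ (Fin d)} (hf : Continuous f)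
    (z : PathSpace d) :
    pathPairing hf z = ∫ t in (0 : ℝ)..1, inner ℝ (f t) (pathEval z t) := rfl

theorem memLp_of_continuous {f : ℝ → EuclideanSpace ℝ (Fin d)} (hf : Continuous f) :
    MemLp f 2 (volume.restrict (Ioo 0 1)) := by
  obtain ⟨C, hC⟩ := isCompact_Icc.exists_bound_of_continuousOn
    (hf.continuousOn (s := Icc (0 : ℝ) 1))
  refine MemLp.of_bound hf.aestronglyMeasurable C ?_
  filter_upwards [ae_restrict_mem measurableSet_Ioo] with t ht
  exact hC t (Ioo_subset_Icc_self ht)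

/-- The fundamental lemma of the calculus of variations for a continuous path. -/
theorem eq_of_forall_integral_inner_eq {z : PathSpace d} {k : ℝ → EuclideanSpace ℝ (Fin d)}
    (hk : ContinuousOn k (Icc 0 1))
    (h : ∀ f : ℝ → EuclideanSpace ℝ (Fin d), Continuous f →
      ∫ t in (0 : ℝ)..1, inner ℝ (f t) (pathEval z t) = ∫ t in (0 : ℝ)..1, inner ℝ (f t) (k t))
    {t : ℝ} (ht : t ∈ Icc (0 : ℝ) 1) : pathEval z t = k t := by
  set e : ℝ → EuclideanSpace ℝ (Fin d) :=
    fun t => pathEval z t - IccExtend (zero_le_one' ℝ) ((Icc 0 1).domRestrict k) t with he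
  have hec : Continuous e :=
    (continuous_pathEval z).sub (continuousOn_iff_continuous_domRestrict.1 hk).Icc_extend'
  have hee : ∀ t ∈ Icc (0 : ℝ) 1, e t = pathEval z t - k t := fun t ht => by
    simp only [he]
    rw [IccExtend_of_mem _ _ ht]
    rfl
  have h1 : ∫ t in (0 : ℝ)..1, ‖e t‖ ^ 2 = 0 := by
    have h2 : ∀ t ∈ uIcc (0 : ℝ) 1, ‖e t‖ ^ 2
        = inner ℝ (e t) (pathEval z t) - inner ℝ (e t) (k t) := fun t ht => by
      rw [uIcc_of_le zero_le_one] at ht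
      rw [← inner_sub_right, ← hee t ht, real_inner_self_eq_norm_sq]
    rw [intervalIntegral.integral_congr h2, intervalIntegral.integral_sub
      ((hec.inner (continuous_pathEval z)).intervalIntegrable _ _)
      (intervalIntegrable_of_continuousOn_unit (hec.continuousOn.inner hk)), h e hec, sub_self]
  have h2 : ∀ t ∈ Icc (0 : ℝ) 1, e t = 0 := by
    by_contra! hcon
    obtain ⟨s, hs, hne⟩ := hcon
    have : 0 < ∫ t in (0 : ℝ)..1, ‖e t‖ ^ 2 :=
      intervalIntegral.integral_pos zero_lt_one (hec.norm.pow 2).continuousOn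
        (fun _ _ => sq_nonneg _) ⟨s, hs, by positivity⟩
    linarith
  have := h2 t ht
  rw [hee t ht] at this
  exact sub_eq_zero.1 this

end PathFunctionals

namespace IsBridgeLaw

variable {d : ℕ} {ε a : ℝ} {A X Y : ℝ → Matrix (Fin d) (Fin d) ℝ} {ν : Measure (PathSpace d)}

/-- The Bochner integral `∫Λ(z)z dν` is the covariance operator applied to `Λ`. As it takes values
in continuous paths, it can be identified at every time from its `L²` pairings alone. -/
theorem integrable_dual_smul (hν : IsBridgeLaw ε A ν) (Λ : StrongDual ℝ (PathSpace d)) :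
    Integrable (fun z => Λ z • z) ν := by
  have := hν.gaussian
  have h2 := IsGaussian.memLp_two_id (μ := ν)
  exact memLp_one_iff_integrable.1 (h2.smul (Λ.comp_memLp' h2))

theorem dual_integral_smul (hν : IsBridgeLaw ε A ν) (Λ Γ : StrongDual ℝ (PathSpace d)) :
    Γ (∫ z, Λ z • z ∂ν) = ∫ z, Λ z * Γ z ∂ν := by
  rw [← Γ.integral_comp_comm (hν.integrable_dual_smul Λ)]
  simp

/-- The law is specified only through `L²` pairings. Pointwise covariances are reached by replacing
one pairing at a time by an evaluation, using continuity of the covariance paths and of the Green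
kernel. -/
theorem integral_coord_mul_coord (hν : IsBridgeLaw ε A ν) (h : IsFundamentalPair ε A X Y)
    (hε : 0 < ε) (ha : 0 < a) (hA : MemH1Mat a A) {s : ℝ} (hs : s ∈ Icc (0 : ℝ) 1) (i j : Fin d) :
    ∫ z, (pathEval z s).ofLp i * (pathEval z s).ofLp j ∂ν
      = (freeCov X Y s - bridgeCorr X Y s) i j := by
  -- First replacement: the covariance path of the pairing with `g` is `2u`.
  have step1 : ∀ (g u : ℝ → EuclideanSpace ℝ (Fin d)) (hg : Continuous g),
      IsDirichletSolution ε A g u → ∀ t ∈ Icc (0 : ℝ) 1,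
        pathEval (∫ z, pathPairing hg z • z ∂ν) t = (2 : ℝ) • u t := by
    intro g u hg hu t ht
    refine eq_of_forall_integral_inner_eq (hu.memH1.1.continuousOn_unit.const_smul (2 : ℝ))
      (fun f hf => ?_) ht
    have h1 := hν.covariance f g u (memLp_of_continuous hf) (memLp_of_continuous hg) hu
    have h2 := hν.dual_integral_smul (pathPairing hg) (pathPairing hf)
    rw [pathPairing_apply] at h2
    rw [h2]
    simp only [Pi.smul_apply, inner_smul_right, intervalIntegral.integral_const_mul]
    rw [← h1]
    exact integral_congr_ae (.of_forall fun z => mul_comm _ _)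
  set c : Fin d → ℝ := Pi.single i 1
  set x := (X s)ᵀ *ᵥ c with hx
  set k : ℝ → EuclideanSpace ℝ (Fin d) := fun r => WithLp.toLp 2 ((2 : ℝ) • (X r *ᵥ
        (gramIntegral Y (min r s) *ᵥ x - gramIntegral Y r *ᵥ
          ((gramIntegral Y 1)⁻¹ *ᵥ (gramIntegral Y s *ᵥ x))))) with hk
  have hmin : ContinuousOn (fun r => gramIntegral Y (min r s) *ᵥ x) (Icc 0 1) := by
    refine ContinuousOn.matrix_mulVec_pi (h.continuousOn_gramIntegral.comp
      (continuous_id.min continuous_const).continuousOn fun r hr =>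
        ⟨le_min hr.1 hs.1, (min_le_left _ _).trans hr.2⟩) continuousOn_const
  have hkc : ContinuousOn k (Icc 0 1) :=
    (PiLp.continuous_toLp 2 (fun _ : Fin d => ℝ)).comp_continuousOn
      ((h.continuousOn_left.matrix_mulVec_pi (hmin.sub
        (h.continuousOn_gramIntegral.matrix_mulVec_pi continuousOn_const))).const_smul (2 : ℝ))
  -- Second replacement: by symmetry of the covariance, the path of the functional `zᵢ(s)` pairs
  -- with every `g` as twice the Green kernel does.
  have step2 : pathEval (∫ z, pathCoord d s i z • z ∂ν) s = k s := by
    refine eq_of_forall_integral_inner_eq hkc (fun g hg => ?_) hs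
    obtain ⟨u, hu, hker⟩ := h.exists_isDirichletSolution hε ha hA hg
    have h1 := hν.dual_integral_smul (pathCoord d s i) (pathPairing hg)
    have h2 := hν.dual_integral_smul (pathPairing hg) (pathCoord d s i)
    rw [pathCoord_apply, step1 g u hg hu s hs] at h2
    have h3 := hker s hs c
    simp only [c, single_dotProduct, one_mul] at h3
    rw [pathPairing_apply] at h1
    rw [h1]
    simp only [mul_comm (pathCoord d s i _)]
    rw [← h2, PiLp.smul_apply, smul_eq_mul, h3, ← intervalIntegral.integral_const_mul]
    refine intervalIntegral.integral_congr fun r _ => ?_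
    simp only [hk, euclidean_inner_eq_dotProduct, dotProduct_smul, smul_eq_mul]
    rfl
  have h4 := hν.dual_integral_smul (pathCoord d s i) (pathCoord d s j)
  rw [pathCoord_apply, step2] at h4
  simp only [pathCoord_apply] at h4
  rw [← h4]
  have h5 : (freeCov X Y s - bridgeCorr X Y s) *ᵥ c = (k s).ofLp := by
    simp only [hk, hx, min_self, freeCov, bridgeCorr, Matrix.sub_mulVec, Matrix.smul_mulVec,
      Matrix.mulVec_sub, ← Matrix.mulVec_mulVec, smul_sub]
  rw [← h5]
  have hsym : (freeCov X Y s - bridgeCorr X Y s) j i = (freeCov X Y s - bridgeCorr X Y s) i j := by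
    rw [Matrix.sub_apply, Matrix.sub_apply, (IsFundamentalPair.isSymm_freeCov s).apply,
      (IsFundamentalPair.isSymm_bridgeCorr s).apply]
  simp [c, ← hsym]

theorem integral_coord (hν : IsBridgeLaw ε A ν) (t : ℝ) (i : Fin d) :
    ∫ z, (pathEval z t).ofLp i ∂ν = 0 := by
  have := hν.gaussian
  have h1 := IsGaussian.integral_dual (μ := ν) (pathCoord d t i)
  rw [hν.mean_zero, map_zero] at h1
  exact h1

end IsBridgeLaw

/-! ## Gaussian moments of the one-point marginals -/

/-- For `s ≤ 1/(4v)` the weighted density is at most `√2` times the Gaussian density of variance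
`2v`. The degenerate case `v = 0` is a Dirac mass. -/
theorem lintegral_exp_sq_gaussianReal_le {v : ℝ≥0} {s : ℝ} (hs : 4 * s * v ≤ 1) :
    ∫⁻ x, ENNReal.ofReal (Real.exp (s * x ^ 2)) ∂(gaussianReal 0 v) ≤ ENNReal.ofReal 2 := by
  rcases eq_or_ne v 0 with rfl | hv
  · rw [gaussianReal_zero_var, lintegral_dirac]
    simp
  have hv0 : (0 : ℝ) < v := NNReal.coe_pos.2 (pos_iff_ne_zero.2 hv)
  have hm : Measurable fun x : ℝ => ENNReal.ofReal (Real.exp (s * x ^ 2)) := by fun_prop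
  rw [gaussianReal_of_var_ne_zero _ hv, lintegral_withDensity_eq_lintegral_mul _
    (measurable_gaussianPDF 0 v) hm]
  have h2v : (2 * v : ℝ≥0) ≠ 0 := by simpa using hv
  calc ∫⁻ x, (gaussianPDF 0 v * fun x => ENNReal.ofReal (Real.exp (s * x ^ 2))) x
      ≤ ∫⁻ x, ENNReal.ofReal 2 * gaussianPDF 0 (2 * v) x := by
        refine lintegral_mono fun x => ?_
        simp only [Pi.mul_apply, gaussianPDF]
        rw [← ENNReal.ofReal_mul (gaussianPDFReal_nonneg _ _ _), ← ENNReal.ofReal_mul (by norm_num)]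
        refine ENNReal.ofReal_le_ofReal ?_
        simp only [gaussianPDFReal, sub_zero]
        have e1 : √(2 * Real.pi * ((2 * v : ℝ≥0) : ℝ)) = √2 * √(2 * Real.pi * v) := by
          rw [← Real.sqrt_mul (by norm_num)]
          push_cast
          ring_nf
        have e2 : (√2)⁻¹ * 2 = √2 := by
          rw [inv_mul_eq_iff_eq_mul₀ (by positivity)]
          exact (Real.mul_self_sqrt (by norm_num)).symm
        have e3 : (1 : ℝ) ≤ √2 := by rw [Real.one_le_sqrt]; norm_num
        rw [e1, mul_inv, mul_assoc, ← Real.exp_add]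
        have h3 : -x ^ 2 / (2 * v) + s * x ^ 2 ≤ -x ^ 2 / (2 * ((2 * v : ℝ≥0) : ℝ)) := by
          push_cast
          rw [div_add' _ _ _ (by positivity), div_le_div_iff₀ (by positivity) (by positivity)]
          have : 0 ≤ x ^ 2 * v * (1 - 4 * s * v) :=
            mul_nonneg (by positivity) (by linarith)
          nlinarith
        have h4 := Real.exp_le_exp.2 h3
        have h5 : (0 : ℝ) ≤ (√(2 * Real.pi * v))⁻¹ := by positivity
        calc (√(2 * Real.pi * v))⁻¹ * Real.exp (-x ^ 2 / (2 * v) + s * x ^ 2)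
            ≤ (√(2 * Real.pi * v))⁻¹ * Real.exp (-x ^ 2 / (2 * ((2 * v : ℝ≥0) : ℝ))) :=
              mul_le_mul_of_nonneg_left h4 h5
          _ ≤ √2 * ((√(2 * Real.pi * v))⁻¹ * Real.exp (-x ^ 2 / (2 * ((2 * v : ℝ≥0) : ℝ)))) :=
              le_mul_of_one_le_left (by positivity) e3
          _ = _ := by nth_rewrite 1 [← e2]; ring
    _ = ENNReal.ofReal 2 := by
        rw [lintegral_const_mul _ (measurable_gaussianPDF _ _), lintegral_gaussianPDF_eq_one 0 h2v,
          mul_one]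

/-- Bounding `‖x‖²` by `d` times the largest squared coordinate reduces exponential moments to
one-dimensional marginals, with no independence required. The `1` covers `d = 0`. -/
theorem EuclideanSpace.exp_mul_norm_sq_le {d : ℕ} (x : EuclideanSpace ℝ (Fin d)) {β : ℝ}
    (hβ : 0 ≤ β) :
    Real.exp (β * ‖x‖ ^ 2) ≤ 1 + ∑ i, Real.exp (β * d * (x.ofLp i) ^ 2) := by
  rw [EuclideanSpace.real_norm_sq_eq]
  rcases isEmpty_or_nonempty (Fin d) with he | hne
  · simp
  obtain ⟨i, -, hi⟩ := Finset.exists_max_image Finset.univ (fun i => (x.ofLp i) ^ 2)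
    Finset.univ_nonempty
  have h1 : β * ∑ j, (x.ofLp j) ^ 2 ≤ β * d * (x.ofLp i) ^ 2 := by
    rw [mul_assoc]
    refine mul_le_mul_of_nonneg_left ((Finset.sum_le_sum hi).trans ?_) hβ
    simp
  have h2 := Finset.single_le_sum (f := fun i => Real.exp (β * d * (x.ofLp i) ^ 2))
    (fun _ _ => (Real.exp_pos _).le) (Finset.mem_univ i)
  have h3 := Real.exp_le_exp.2 h1
  simp only at h2
  linarith

namespace IsBridgeLaw

variable {d : ℕ} {ε a : ℝ} {A X Y : ℝ → Matrix (Fin d) (Fin d) ℝ} {ν : Measure (PathSpace d)}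

/-- The difference is a second moment of the law. -/
theorem bridgeCorr_le_freeCov (hν : IsBridgeLaw ε A ν) (h : IsFundamentalPair ε A X Y)
    (hε : 0 < ε) (ha : 0 < a) (hA : MemH1Mat a A) {t : ℝ} (ht : t ∈ Icc (0 : ℝ) 1) (i : Fin d) :
    bridgeCorr X Y t i i ≤ freeCov X Y t i i := by
  have h1 := hν.integral_coord_mul_coord h hε ha hA ht i i
  rw [Matrix.sub_apply] at h1
  have h2 : 0 ≤ ∫ z, (pathEval z t).ofLp i * (pathEval z t).ofLp i ∂ν :=
    integral_nonneg fun z => mul_self_nonneg _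
  linarith

/-- The variance is a diagonal entry of `K - Q`, with `Q ≥ 0` and `K ≤ ε/a`. -/
theorem map_coord (hν : IsBridgeLaw ε A ν) (h : IsFundamentalPair ε A X Y)
    (hε : 0 < ε) (ha : 0 < a) (hA : MemH1Mat a A) {t : ℝ} (ht : t ∈ Icc (0 : ℝ) 1) (i : Fin d) :
    ∃ v : ℝ≥0, (v : ℝ) ≤ ε / a ∧ ν.map (pathCoord d t i) = gaussianReal 0 v := by
  have := hν.gaussian
  have h1 := IsGaussian.map_eq_gaussianReal (μ := ν) (pathCoord d t i)
  have h2 : ∫ z, pathCoord d t i z ∂ν = 0 := hν.integral_coord t i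
  refine ⟨_, ?_, by rw [h1, h2]⟩
  rw [variance_of_integral_eq_zero (pathCoord d t i).continuous.aemeasurable h2]
  have h3 : ∫ z, (pathCoord d t i z) ^ 2 ∂ν = (freeCov X Y t - bridgeCorr X Y t) i i := by
    rw [← hν.integral_coord_mul_coord h hε ha hA ht i i]
    simp only [pathCoord_apply, sq]
  have h4 : 0 ≤ bridgeCorr X Y t i i :=
    (h.posSemidef_bridgeCorr hε ha hA.symm (fun _ ht => hA.le_quad ht) t).diag_nonneg
  have h5 : freeCov X Y t i i ≤ ε / a := by
    have := h.freeCov_le hε ha hA.symm (fun t ht => hA.le_quad ht) (Pi.single i 1) ht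
    simpa using this
  have h6 : ∫ z, (pathCoord d t i z) ^ 2 ∂ν ≤ ε / a := by
    rw [h3, Matrix.sub_apply]; linarith
  simpa using ⟨h6, by positivity⟩

theorem lintegral_exp_norm_sq_le (hν : IsBridgeLaw ε A ν) (h : IsFundamentalPair ε A X Y)
    (hε : 0 < ε) (ha : 0 < a) (hA : MemH1Mat a A) {t : ℝ} (ht : t ∈ Icc (0 : ℝ) 1) {β : ℝ}
    (hβ : 0 ≤ β) (hβ' : 4 * (β * d) * (ε / a) ≤ 1) :
    ∫⁻ z, ENNReal.ofReal (Real.exp (β * ‖pathEval z t‖ ^ 2)) ∂ν ≤ ENNReal.ofReal (1 + d * 2) := by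
  have := hν.gaussian
  have hm : ∀ i, Measurable (pathCoord d t i) := fun i => (pathCoord d t i).continuous.measurable
  have hm2 : ∀ i : Fin d, Measurable fun z : PathSpace d =>
      ENNReal.ofReal (Real.exp (β * d * (pathCoord d t i z) ^ 2)) := fun i =>
    ENNReal.measurable_ofReal.comp (Real.measurable_exp.comp (((hm i).pow_const 2).const_mul _))
  calc ∫⁻ z, ENNReal.ofReal (Real.exp (β * ‖pathEval z t‖ ^ 2)) ∂ν
      ≤ ∫⁻ z, (1 + ∑ i, ENNReal.ofReal (Real.exp (β * d * (pathCoord d t i z) ^ 2))) ∂ν := by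
        refine lintegral_mono fun z => ?_
        have h1 := ENNReal.ofReal_le_ofReal (EuclideanSpace.exp_mul_norm_sq_le (pathEval z t) hβ)
        rwa [ENNReal.ofReal_add zero_le_one (Finset.sum_nonneg fun _ _ => (Real.exp_pos _).le),
          ENNReal.ofReal_one, ENNReal.ofReal_sum_of_nonneg fun _ _ => (Real.exp_pos _).le] at h1
    _ = 1 + ∑ i, ∫⁻ z, ENNReal.ofReal (Real.exp (β * d * (pathCoord d t i z) ^ 2)) ∂ν := by
        rw [lintegral_add_left measurable_const, lintegral_finsetSum _ fun i _ => hm2 i]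
        simp
    _ ≤ 1 + ∑ _i : Fin d, ENNReal.ofReal 2 := by
        refine add_le_add le_rfl (Finset.sum_le_sum fun i _ => ?_)
        obtain ⟨v, hv1, hv2⟩ := hν.map_coord h hε ha hA ht i
        have h3 := lintegral_map (μ := ν) (f := fun x : ℝ =>
          ENNReal.ofReal (Real.exp (β * d * x ^ 2))) (by fun_prop) (hm i)
        rw [← h3, hv2]
        refine lintegral_exp_sq_gaussianReal_le (le_trans ?_ hβ')
        exact mul_le_mul_of_nonneg_left hv1 (by positivity)
    _ = ENNReal.ofReal (1 + d * 2) := by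
        rw [Finset.sum_const, Finset.card_univ, Fintype.card_fin, nsmul_eq_mul,
          ENNReal.ofReal_add (by norm_num) (by positivity), ENNReal.ofReal_one,
          ENNReal.ofReal_mul (by positivity), ENNReal.ofReal_natCast]

theorem integrable_exp_norm_sq (hν : IsBridgeLaw ε A ν) (h : IsFundamentalPair ε A X Y)
    (hε : 0 < ε) (ha : 0 < a) (hA : MemH1Mat a A) {t : ℝ} (ht : t ∈ Icc (0 : ℝ) 1) {β : ℝ}
    (hβ : 0 ≤ β) (hβ' : 4 * (β * d) * (ε / a) ≤ 1) :
    Integrable (fun z => Real.exp (β * ‖pathEval z t‖ ^ 2)) ν ∧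
      ∫ z, Real.exp (β * ‖pathEval z t‖ ^ 2) ∂ν ≤ 1 + d * 2 := by
  have h1 := hν.lintegral_exp_norm_sq_le h hε ha hA ht hβ hβ'
  have hc : Continuous fun z : PathSpace d => Real.exp (β * ‖pathEval z t‖ ^ 2) :=
    Real.continuous_exp.comp (continuous_const.mul
      (((pathEvalCLM d t).continuous.norm).pow 2))
  refine ⟨⟨hc.aestronglyMeasurable, ?_⟩, ?_⟩
  · rw [hasFiniteIntegral_iff_ofReal (.of_forall fun _ => (Real.exp_pos _).le)]
    exact h1.trans_lt ENNReal.ofReal_lt_top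
  · rw [integral_eq_lintegral_of_nonneg_ae (.of_forall fun _ => (Real.exp_pos _).le)
      hc.aestronglyMeasurable]
    exact ENNReal.toReal_le_of_le_ofReal (by positivity) h1

end IsBridgeLaw

/-- Polynomial factors are absorbed by a Gaussian weight. -/
theorem mul_exp_sq_le {c β y : ℝ} (hβ : 0 < β) (hc : 2 * c ≤ β) :
    y * Real.exp (c * y ^ 2) ≤ (√β)⁻¹ * Real.exp (β * y ^ 2) ∧
    y ^ 3 * Real.exp (c * y ^ 2) ≤ 9 * (√β)⁻¹ ^ 3 * Real.exp (β * y ^ 2) := by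
  have hb : 0 < √β := Real.sqrt_pos.2 hβ
  set x := √β * y with hx
  have hx2 : x ^ 2 = β * y ^ 2 := by rw [hx, mul_pow, Real.sq_sqrt hβ.le]
  have hy : y = (√β)⁻¹ * x := by rw [hx]; field_simp
  -- Half of the weight `e^{βy²}` pays for `e^{cy²}`, the other half for the power of `y`.
  have h1 : Real.exp (c * y ^ 2) ≤ Real.exp (x ^ 2 / 2) := by
    refine Real.exp_le_exp.2 ?_
    rw [hx2]
    nlinarith [sq_nonneg y]
  have h2 : Real.exp (β * y ^ 2) = Real.exp (x ^ 2 / 2) * Real.exp (x ^ 2 / 2) := by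
    rw [← Real.exp_add, ← hx2]; ring_nf
  have h3 : |x| ≤ Real.exp (x ^ 2 / 2) := by
    have := Real.add_one_le_exp (x ^ 2 / 2)
    rw [← sq_abs] at this ⊢
    nlinarith [sq_nonneg (|x| - 1)]
  have h4 : |x| ^ 3 ≤ 9 * Real.exp (x ^ 2 / 2) := by
    have h5 := Real.quadratic_le_exp_of_nonneg (by positivity : 0 ≤ x ^ 2 / 2)
    rw [← sq_abs] at h5 ⊢
    have h6 := abs_nonneg x
    nlinarith [sq_nonneg (|x| ^ 2 - |x|), sq_nonneg (|x| - 1), pow_nonneg h6 3,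
      sq_nonneg (|x| ^ 2 - 2 * |x|)]
  have h7 := Real.exp_pos (x ^ 2 / 2)
  have h8 : 0 < Real.exp (c * y ^ 2) := Real.exp_pos _
  constructor
  · calc y * Real.exp (c * y ^ 2) ≤ ((√β)⁻¹ * |x|) * Real.exp (c * y ^ 2) := by
          refine mul_le_mul_of_nonneg_right ?_ h8.le
          rw [hy]
          exact mul_le_mul_of_nonneg_left (le_abs_self _) (by positivity)
      _ ≤ ((√β)⁻¹ * Real.exp (x ^ 2 / 2)) * Real.exp (x ^ 2 / 2) := by gcongr
      _ = _ := by rw [h2]; ring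
  · calc y ^ 3 * Real.exp (c * y ^ 2) ≤ ((√β)⁻¹ ^ 3 * |x| ^ 3) * Real.exp (c * y ^ 2) := by
          refine mul_le_mul_of_nonneg_right ?_ h8.le
          rw [hy, mul_pow, ← abs_pow]
          exact mul_le_mul_of_nonneg_left (le_abs_self _) (by positivity)
      _ ≤ ((√β)⁻¹ ^ 3 * (9 * Real.exp (x ^ 2 / 2))) * Real.exp (x ^ 2 / 2) := by gcongr
      _ = _ := by rw [h2]; ring

/-! ## Partial derivatives of the potential -/

/-- The `i`-th partial derivative. -/
noncomputable def partialDeriv {d : ℕ} (i : Fin d) (F : EuclideanSpace ℝ (Fin d) → ℝ)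
    (x : EuclideanSpace ℝ (Fin d)) : ℝ :=
  fderiv ℝ F x (EuclideanSpace.single i 1)

section PartialDeriv

variable {d : ℕ} {F G : EuclideanSpace ℝ (Fin d) → ℝ}

theorem contDiff_partialDeriv {n m : WithTop ℕ∞} (hF : ContDiff ℝ n F) (hmn : m + 1 ≤ n)
    (i : Fin d) : ContDiff ℝ m (partialDeriv i F) :=
  (hF.fderiv_right hmn).clm_apply contDiff_const

theorem iteratedFDeriv_succ_apply_eq {n : ℕ} (hF : ContDiff ℝ (n + 1) F)
    (x : EuclideanSpace ℝ (Fin d)) (v : Fin (n + 1) → EuclideanSpace ℝ (Fin d)) :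
    iteratedFDeriv ℝ (n + 1) F x v
      = fderiv ℝ (fun y => iteratedFDeriv ℝ n F y (Fin.tail v)) x (v 0) := by
  rw [iteratedFDeriv_succ_apply_left]
  have h1 : DifferentiableAt ℝ (iteratedFDeriv ℝ n F) x :=
    ((hF.iteratedFDeriv_right (m := 1) (i := n) (by rw [add_comm])).differentiable (by simp)) x
  have h2 := (ContinuousMultilinearMap.apply ℝ (fun _ : Fin n => EuclideanSpace ℝ (Fin d)) ℝ
    (Fin.tail v)).hasFDerivAt.comp x h1.hasFDerivAt
  have h3 := h2.fderiv
  simp only [Function.comp_def, ContinuousMultilinearMap.apply_apply] at h3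
  rw [h3]
  rfl

theorem iteratedFDeriv_two_single (hF : ContDiff ℝ 2 F) (x : EuclideanSpace ℝ (Fin d))
    (i j : Fin d) :
    iteratedFDeriv ℝ 2 F x ![EuclideanSpace.single i 1, EuclideanSpace.single j 1]
      = partialDeriv i (partialDeriv j F) x := by
  rw [iteratedFDeriv_succ_apply_eq (n := 1) (by exact_mod_cast hF)]
  simp only [partialDeriv, Matrix.cons_val_zero]
  congr 2
  funext y
  rw [iteratedFDeriv_one_apply]
  rfl

theorem iteratedFDeriv_three_single (hF : ContDiff ℝ 3 F) (x : EuclideanSpace ℝ (Fin d))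
    (i j k : Fin d) :
    iteratedFDeriv ℝ 3 F x ![EuclideanSpace.single i 1, EuclideanSpace.single j 1,
      EuclideanSpace.single k 1] = partialDeriv i (partialDeriv j (partialDeriv k F)) x := by
  rw [iteratedFDeriv_succ_apply_eq (n := 2) (by exact_mod_cast hF)]
  rw [partialDeriv]
  simp only [Matrix.cons_val_zero]
  congr 2
  funext y
  rw [← iteratedFDeriv_two_single (hF.of_le (by norm_num))]
  rfl

theorem partialDeriv_comm (hF : ContDiff ℝ 2 F) (i j : Fin d) :
    partialDeriv i (partialDeriv j F) = partialDeriv j (partialDeriv i F) := by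
  funext x
  rw [← iteratedFDeriv_two_single hF, ← iteratedFDeriv_two_single hF]
  simp only [iteratedFDeriv_two_apply]
  exact (hF.contDiffAt.isSymmSndFDerivAt (by simp)) _ _

theorem partialDeriv_mul (hF : Differentiable ℝ F) (hG : Differentiable ℝ G) (i : Fin d) :
    partialDeriv i (fun x => F x * G x)
      = fun x => F x * partialDeriv i G x + G x * partialDeriv i F x := by
  funext x
  simp only [partialDeriv]
  rw [fderiv_fun_mul (hF x) (hG x)]
  rfl

theorem partialDeriv_const_mul (hF : Differentiable ℝ F) (c : ℝ) (i : Fin d) :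
    partialDeriv i (fun x => c * F x) = fun x => c * partialDeriv i F x := by
  funext x
  simp only [partialDeriv]
  rw [fderiv_const_mul (hF x)]
  rfl

theorem partialDeriv_sum {ι : Type*} (s : Finset ι) {F : ι → EuclideanSpace ℝ (Fin d) → ℝ}
    (hF : ∀ k ∈ s, Differentiable ℝ (F k)) (i : Fin d) :
    partialDeriv i (fun x => ∑ k ∈ s, F k x) = fun x => ∑ k ∈ s, partialDeriv i (F k) x := by
  funext x
  simp only [partialDeriv]
  rw [fderiv_fun_sum fun k hk => hF k hk x]
  simp

theorem euclidean_eq_sum_single (v : EuclideanSpace ℝ (Fin d)) :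
    v = ∑ k, v.ofLp k • EuclideanSpace.single k (1 : ℝ) := by
  ext i
  simp [Finset.sum_apply, Pi.single_apply]

theorem fderiv_apply_eq_sum (x v : EuclideanSpace ℝ (Fin d)) :
    fderiv ℝ F x v = ∑ k, v.ofLp k * partialDeriv k F x := by
  conv_lhs => rw [euclidean_eq_sum_single v]
  simp [partialDeriv]

theorem gradient_ofLp (x : EuclideanSpace ℝ (Fin d)) (k : Fin d) :
    (∇ F x).ofLp k = partialDeriv k F x := by
  rw [partialDeriv, ← inner_gradient_left, EuclideanSpace.inner_single_right]
  simp

theorem norm_gradient_sq (x : EuclideanSpace ℝ (Fin d)) :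
    ‖∇ F x‖ ^ 2 = ∑ k, partialDeriv k F x ^ 2 := by
  rw [EuclideanSpace.real_norm_sq_eq]
  simp only [gradient_ofLp]

theorem laplacian_eq_sum (hF : ContDiff ℝ 2 F) :
    Δ F = fun x => ∑ i, partialDeriv i (partialDeriv i F) x := by
  rw [InnerProductSpace.laplacian_eq_iteratedFDeriv_orthonormalBasis F
    (EuclideanSpace.basisFun (Fin d) ℝ)]
  funext x
  refine Finset.sum_congr rfl fun i _ => ?_
  rw [EuclideanSpace.basisFun_apply, iteratedFDeriv_two_single hF]

end PartialDeriv

/-! ### Derivatives of `½|∇V|²` and Bochner's identity. -/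

section Potential

variable {d : ℕ} {V : EuclideanSpace ℝ (Fin d) → ℝ}

/-- `½ |∇V|²`. -/
noncomputable def halfGradSq (V : EuclideanSpace ℝ (Fin d) → ℝ)
    (x : EuclideanSpace ℝ (Fin d)) : ℝ :=
  1 / 2 * ‖∇ V x‖ ^ 2

theorem pathPotential_eq (V : EuclideanSpace ℝ (Fin d) → ℝ) (ε : ℝ) :
    pathPotential V ε = halfGradSq V - ε • (Δ V) := rfl

theorem halfGradSq_eq : halfGradSq V = fun x => 1 / 2 * ∑ k, partialDeriv k V x ^ 2 := by
  funext x
  rw [halfGradSq, norm_gradient_sq]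

theorem contDiff_halfGradSq (hV : ContDiff ℝ 5 V) : ContDiff ℝ 4 (halfGradSq V) := by
  rw [halfGradSq_eq]
  exact contDiff_const.mul (ContDiff.sum fun k _ =>
    (contDiff_partialDeriv hV (by norm_num) k).pow 2)

theorem contDiff_laplacian (hV : ContDiff ℝ 5 V) : ContDiff ℝ 3 (Δ V) := by
  rw [laplacian_eq_sum (hV.of_le (by norm_num))]
  exact ContDiff.sum fun i _ =>
    contDiff_partialDeriv (contDiff_partialDeriv (m := 4) hV (by norm_num) i) (by norm_num) i

theorem hessianMatrix_apply (hV : ContDiff ℝ 5 V) (x : EuclideanSpace ℝ (Fin d)) (i j : Fin d) :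
    hessianMatrix V x i j = partialDeriv i (partialDeriv j V) x :=
  iteratedFDeriv_two_single (hV.of_le (by norm_num)) x i j

theorem isSymm_hessianMatrix (hV : ContDiff ℝ 5 V) (x : EuclideanSpace ℝ (Fin d)) :
    (hessianMatrix V x).IsSymm := by
  ext i j
  rw [Matrix.transpose_apply, hessianMatrix_apply hV, hessianMatrix_apply hV,
    partialDeriv_comm (hV.of_le (by norm_num))]

theorem thirdDerivGradMatrix_apply (hV : ContDiff ℝ 5 V) (x : EuclideanSpace ℝ (Fin d))
    (i j : Fin d) : thirdDerivGradMatrix V x i j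
      = ∑ k, partialDeriv i (partialDeriv j (partialDeriv k V)) x * partialDeriv k V x := by
  simp only [thirdDerivGradMatrix, Matrix.of_apply]
  refine Finset.sum_congr rfl fun k _ => ?_
  rw [iteratedFDeriv_three_single (hV.of_le (by norm_num)), gradient_ofLp]

theorem laplacian_eq_trace (hV : ContDiff ℝ 5 V) (x : EuclideanSpace ℝ (Fin d)) :
    (Δ V) x = (hessianMatrix V x).trace := by
  rw [laplacian_eq_sum (hV.of_le (by norm_num))]
  simp only [Matrix.trace, Matrix.diag_apply, hessianMatrix_apply hV]

theorem partialDeriv_halfGradSq (hV : ContDiff ℝ 5 V) (j : Fin d) :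
    partialDeriv j (halfGradSq V)
      = fun x => ∑ k, partialDeriv k V x * partialDeriv j (partialDeriv k V) x := by
  have h1 : ∀ k, Differentiable ℝ (partialDeriv k V) := fun k =>
    (contDiff_partialDeriv (m := 4) hV (by norm_num) k).differentiable (by norm_num)
  rw [halfGradSq_eq]
  simp only [sq]
  rw [partialDeriv_const_mul (Differentiable.fun_sum fun k _ => (h1 k).fun_mul (h1 k)),
    partialDeriv_sum _ fun k _ => (h1 k).fun_mul (h1 k)]
  funext x
  simp only [partialDeriv_mul (h1 _) (h1 _)]
  rw [Finset.mul_sum]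
  refine Finset.sum_congr rfl fun k _ => ?_
  ring

/-- The product rule; this is where both the squared Hessian and the term `D³V·∇V` of the expansion
originate. -/
theorem partialDeriv_partialDeriv_halfGradSq (hV : ContDiff ℝ 5 V) (i j : Fin d)
    (x : EuclideanSpace ℝ (Fin d)) :
    partialDeriv i (partialDeriv j (halfGradSq V)) x
      = (hessianMatrix V x ^ 2 + thirdDerivGradMatrix V x) i j := by
  have h1 : ∀ k, Differentiable ℝ (partialDeriv k V) := fun k =>
    (contDiff_partialDeriv (m := 4) hV (by norm_num) k).differentiable (by norm_num)
  have h2 : ∀ j k, Differentiable ℝ (partialDeriv j (partialDeriv k V)) := fun j k =>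
    (contDiff_partialDeriv (m := 3) (contDiff_partialDeriv (m := 4) hV (by norm_num) k)
      (by norm_num) j).differentiable (by norm_num)
  rw [partialDeriv_halfGradSq hV, partialDeriv_sum _ fun k _ => (h1 k).fun_mul (h2 j k),
    Matrix.add_apply, sq, Matrix.mul_apply, thirdDerivGradMatrix_apply hV, add_comm,
    ← Finset.sum_add_distrib]
  refine Finset.sum_congr rfl fun k _ => ?_
  rw [partialDeriv_mul (h1 k) (h2 j k), hessianMatrix_apply hV, hessianMatrix_apply hV,
    partialDeriv_comm (hV.of_le (by norm_num)) k j]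
  ring

/-- Bochner's identity for `½ |∇V|²`. -/
theorem sum_partialDeriv_halfGradSq (hV : ContDiff ℝ 5 V) (x : EuclideanSpace ℝ (Fin d)) :
    ∑ i, partialDeriv i (partialDeriv i (halfGradSq V)) x
      = frobSq (hessianMatrix V x) + fderiv ℝ (Δ V) x (∇ V x) := by
  have h2 : ∀ j k, Differentiable ℝ (partialDeriv j (partialDeriv k V)) := fun j k =>
    (contDiff_partialDeriv (m := 3) (contDiff_partialDeriv (m := 4) hV (by norm_num) k)
      (by norm_num) j).differentiable (by norm_num)
  have h3 : ∀ k, ContDiff ℝ 2 (partialDeriv k V) := fun k =>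
    contDiff_partialDeriv hV (by norm_num) k
  simp only [partialDeriv_partialDeriv_halfGradSq hV, Matrix.add_apply, Finset.sum_add_distrib]
  congr 1
  · rw [frobSq_eq_trace, (isSymm_hessianMatrix hV x).eq, sq]
    rfl
  -- Commuting partial derivatives turns the trace of `D³V·∇V` into `∇ΔV·∇V`.
  · rw [fderiv_apply_eq_sum]
    simp only [thirdDerivGradMatrix_apply hV, gradient_ofLp]
    rw [Finset.sum_comm]
    refine Finset.sum_congr rfl fun k _ => ?_
    rw [laplacian_eq_sum (hV.of_le (by norm_num)), partialDeriv_sum _ fun i _ => h2 i i,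
      Finset.mul_sum]
    refine Finset.sum_congr rfl fun i _ => ?_
    rw [mul_comm, partialDeriv_comm (h3 i) k i, partialDeriv_comm (hV.of_le (by norm_num)) k i]

end Potential

/-! ## Growth of the potential -/

/-- Growth at most like a Gaussian exponential. -/
def HasGaussianGrowth {d : ℕ} (F : EuclideanSpace ℝ (Fin d) → ℝ) : Prop :=
  ∃ C ≥ (0 : ℝ), ∃ c ≥ (0 : ℝ), ∀ x, |F x| ≤ C * Real.exp (c * ‖x‖ ^ 2)

namespace HasGaussianGrowth

variable {d : ℕ} {F G : EuclideanSpace ℝ (Fin d) → ℝ}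

theorem mono (hG : HasGaussianGrowth G) (h : ∀ x, |F x| ≤ |G x|) : HasGaussianGrowth F := by
  obtain ⟨C, hC, c, hc, hb⟩ := hG
  exact ⟨C, hC, c, hc, fun x => (h x).trans (hb x)⟩

theorem const (r : ℝ) : HasGaussianGrowth fun _ : EuclideanSpace ℝ (Fin d) => r :=
  ⟨|r|, abs_nonneg r, 0, le_rfl, fun x => by simp⟩

theorem norm : HasGaussianGrowth fun x : EuclideanSpace ℝ (Fin d) => ‖x‖ :=
  ⟨1, zero_le_one, 1, zero_le_one, fun x => by
    rw [abs_norm]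
    nlinarith [Real.add_one_le_exp (1 * ‖x‖ ^ 2), sq_nonneg (‖x‖ - 1), norm_nonneg x]⟩

theorem add (hF : HasGaussianGrowth F) (hG : HasGaussianGrowth G) :
    HasGaussianGrowth fun x => F x + G x := by
  obtain ⟨C, hC, c, hc, hb⟩ := hF
  obtain ⟨C', hC', c', hc', hb'⟩ := hG
  refine ⟨C + C', by positivity, c + c', by positivity, fun x => ?_⟩
  have h1 : C * Real.exp (c * ‖x‖ ^ 2) ≤ C * Real.exp ((c + c') * ‖x‖ ^ 2) := by
    gcongr; linarith
  have h2 : C' * Real.exp (c' * ‖x‖ ^ 2) ≤ C' * Real.exp ((c + c') * ‖x‖ ^ 2) := by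
    gcongr; linarith
  have := abs_add_le (F x) (G x)
  linarith [hb x, hb' x]

theorem mul (hF : HasGaussianGrowth F) (hG : HasGaussianGrowth G) :
    HasGaussianGrowth fun x => F x * G x := by
  obtain ⟨C, hC, c, hc, hb⟩ := hF
  obtain ⟨C', hC', c', hc', hb'⟩ := hG
  refine ⟨C * C', by positivity, c + c', by positivity, fun x => ?_⟩
  rw [abs_mul, add_mul, Real.exp_add]
  exact (mul_le_mul (hb x) (hb' x) (abs_nonneg _) (by positivity)).trans_eq (by ring)

theorem abs (hF : HasGaussianGrowth F) : HasGaussianGrowth fun x => |F x| :=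
  hF.mono fun x => (abs_abs (F x)).le

theorem sum {ι : Type*} (s : Finset ι) {F : ι → EuclideanSpace ℝ (Fin d) → ℝ}
    (hF : ∀ i ∈ s, HasGaussianGrowth (F i)) : HasGaussianGrowth fun x => ∑ i ∈ s, F i x := by
  classical
  induction s using Finset.induction_on with
  | empty => simpa using const 0
  | insert i s hi ih =>
    simp only [Finset.sum_insert hi]
    exact (hF _ (Finset.mem_insert_self _ _)).add
      (ih fun j hj => hF j (Finset.mem_insert_of_mem hj))

/-- A bound by the growth of another function on unit balls. -/
theorem of_forall_exists (hG : HasGaussianGrowth G)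
    (h : ∀ x, ∃ y, ‖y‖ ≤ ‖x‖ + 1 ∧ |F x| ≤ |G y|) : HasGaussianGrowth F := by
  obtain ⟨C, hC, c, hc, hb⟩ := hG
  refine ⟨C * Real.exp (2 * c), by positivity, 2 * c, by positivity, fun x => ?_⟩
  obtain ⟨y, hy, hxy⟩ := h x
  refine (hxy.trans (hb y)).trans ?_
  rw [mul_assoc, ← Real.exp_add]
  gcongr
  have : ‖y‖ ^ 2 ≤ (‖x‖ + 1) ^ 2 := by gcongr
  nlinarith [sq_nonneg (‖x‖ - 1), mul_le_mul_of_nonneg_left this hc,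
    mul_nonneg hc (sq_nonneg (‖x‖ - 1))]

theorem exists_shift_le (hF : HasGaussianGrowth F) (M : ℝ) :
    ∃ K ≥ (0 : ℝ), ∃ c ≥ (0 : ℝ), ∀ m, ‖m‖ ≤ M → ∀ z, ∀ s ∈ Icc (0 : ℝ) 1,
      |F (m + s • z)| ≤ K * Real.exp (c * ‖z‖ ^ 2) := by
  obtain ⟨C, hC, c, hc, hb⟩ := hF
  refine ⟨C * Real.exp (2 * c * M ^ 2), by positivity, 2 * c, by positivity,
    fun m hm z s hs => (hb _).trans ?_⟩
  rw [mul_assoc, ← Real.exp_add]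
  gcongr
  have h1 : ‖m + s • z‖ ≤ M + ‖z‖ := by
    refine (norm_add_le _ _).trans (add_le_add hm ?_)
    rw [norm_smul, Real.norm_eq_abs, abs_of_nonneg hs.1]
    exact mul_le_of_le_one_left (norm_nonneg _) hs.2
  have h2 : ‖m + s • z‖ ^ 2 ≤ (M + ‖z‖) ^ 2 := by gcongr
  nlinarith [mul_le_mul_of_nonneg_left h2 hc, mul_nonneg hc (sq_nonneg (M - ‖z‖))]

end HasGaussianGrowth

/-! ### Taylor estimates along segments. -/

section Lines

variable {d : ℕ} {F : EuclideanSpace ℝ (Fin d) → ℝ}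

theorem hasDerivAt_line (hF : Differentiable ℝ F) (m z : EuclideanSpace ℝ (Fin d)) (s : ℝ) :
    HasDerivAt (fun s : ℝ => F (m + s • z)) (∑ k, z.ofLp k * partialDeriv k F (m + s • z)) s := by
  have h1 : HasDerivAt (fun s : ℝ => m + s • z) z s := by
    simpa using ((hasDerivAt_id s).smul_const z).const_add m
  have h2 := (hF (m + s • z)).hasFDerivAt.comp_hasDerivAt s h1
  rw [fderiv_apply_eq_sum] at h2
  exact h2

theorem abs_sub_le_of_abs_deriv_le {φ φ' : ℝ → ℝ} {K : ℝ}
    (h : ∀ s ∈ Icc (0 : ℝ) 1, HasDerivAt φ (φ' s) s) (hb : ∀ s ∈ Icc (0 : ℝ) 1, |φ' s| ≤ K) :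
    ∀ s ∈ Icc (0 : ℝ) 1, |φ s - φ 0| ≤ K := by
  intro s hs
  have h1 := (convex_Icc (0 : ℝ) 1).norm_image_sub_le_of_norm_hasDerivWithin_le (f := φ) (f' := φ')
    (C := K) (fun x hx => (h x hx).hasDerivWithinAt) (fun x hx => hb x hx)
    (left_mem_Icc.2 zero_le_one) hs
  have hK : 0 ≤ K := (abs_nonneg _).trans (hb s hs)
  rw [Real.norm_eq_abs, Real.norm_eq_abs, sub_zero, abs_of_nonneg hs.1] at h1
  exact h1.trans (mul_le_of_le_one_right hK hs.2)

/-- Second order Taylor expansion on `[0,1]`, with a non-optimal constant. -/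
theorem abs_taylor_two_le {φ φ₁ φ₂ φ₃ : ℝ → ℝ} {K : ℝ}
    (h0 : ∀ s, HasDerivAt φ (φ₁ s) s) (h1 : ∀ s, HasDerivAt φ₁ (φ₂ s) s)
    (h2 : ∀ s, HasDerivAt φ₂ (φ₃ s) s) (hb : ∀ s ∈ Icc (0 : ℝ) 1, |φ₃ s| ≤ K) :
    |φ 1 - φ 0 - φ₁ 0 - 1 / 2 * φ₂ 0| ≤ K := by
  have e2 := abs_sub_le_of_abs_deriv_le (fun s _ => h2 s) hb
  have e1 := abs_sub_le_of_abs_deriv_le (φ := fun s => φ₁ s - s * φ₂ 0)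
    (φ' := fun s => φ₂ s - φ₂ 0) (fun s _ => by
      simpa using (h1 s).fun_sub ((hasDerivAt_id' s).mul_const (φ₂ 0))) e2
  have e0 := abs_sub_le_of_abs_deriv_le (φ := fun s => φ s - s * φ₁ 0 - s ^ 2 / 2 * φ₂ 0)
    (φ' := fun s => φ₁ s - φ₁ 0 - s * φ₂ 0) (fun s _ => by
      have e3 := (((h0 s).sub ((hasDerivAt_id s).mul_const (φ₁ 0))).sub
        (((hasDerivAt_pow 2 s).div_const 2).mul_const (φ₂ 0)))
      refine e3.congr_deriv ?_
      push_cast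
      ring) (fun s hs => by
      have := e1 s hs
      simp only [zero_mul, sub_zero] at this
      rwa [sub_right_comm] at this) 1 (right_mem_Icc.2 zero_le_one)
  convert e0 using 2
  ring

theorem abs_sum_coord_mul_le (z : EuclideanSpace ℝ (Fin d)) (v : Fin d → ℝ) :
    |∑ k, z.ofLp k * v k| ≤ ‖z‖ * ∑ k, |v k| := by
  rw [Finset.mul_sum]
  refine (Finset.abs_sum_le_sum_abs _ _).trans (Finset.sum_le_sum fun k _ => ?_)
  rw [abs_mul]
  exact mul_le_mul_of_nonneg_right (PiLp.norm_apply_le z k) (abs_nonneg _)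

/-- Mean value inequality along the ray from the origin; the extra factor `‖x‖` has Gaussian growth
too. -/
theorem HasGaussianGrowth.of_partialDeriv (hF : Differentiable ℝ F)
    (h : ∀ i, HasGaussianGrowth (partialDeriv i F)) : HasGaussianGrowth F := by
  obtain ⟨K, hK, c, hc, hb⟩ :=
    (HasGaussianGrowth.sum Finset.univ fun i _ => (h i).abs).exists_shift_le 0
  have h1 : HasGaussianGrowth fun x : EuclideanSpace ℝ (Fin d) =>
      ‖x‖ * (K * Real.exp (c * ‖x‖ ^ 2)) := by
    refine HasGaussianGrowth.norm.mul ⟨K, hK, c, hc, fun x => ?_⟩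
    rw [abs_of_nonneg (by positivity)]
  refine ((HasGaussianGrowth.const |F 0|).add h1).mono fun x => ?_
  have h2 := abs_sub_le_of_abs_deriv_le (φ := fun s : ℝ => F (0 + s • x))
    (K := ‖x‖ * (K * Real.exp (c * ‖x‖ ^ 2))) (fun s _ => hasDerivAt_line hF 0 x s)
    (fun s hs => (abs_sum_coord_mul_le x _).trans (by
      gcongr
      exact (le_abs_self _).trans (hb 0 (by simp) x s hs))) 1 (right_mem_Icc.2 zero_le_one)
  simp only [zero_add, one_smul, zero_smul] at h2
  rw [abs_of_nonneg (a := |F 0| + _) (by positivity)]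
  have h3 := abs_sub_abs_le_abs_sub (F x) (F 0)
  linarith

/-- Second order Taylor expansion with a remainder controlled by the third derivatives. -/
theorem exists_abs_taylor_le (hF : ContDiff ℝ 3 F)
    (h : ∀ i j k, HasGaussianGrowth (partialDeriv i (partialDeriv j (partialDeriv k F)))) (M : ℝ) :
    ∃ K ≥ (0 : ℝ), ∃ c ≥ (0 : ℝ), ∀ m, ‖m‖ ≤ M → ∀ z,
      |F (m + z) - F m - ∑ i, z.ofLp i * partialDeriv i F m
        - 1 / 2 * ∑ i, z.ofLp i * ∑ j, z.ofLp j * partialDeriv j (partialDeriv i F) m|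
        ≤ K * (‖z‖ ^ 3 * Real.exp (c * ‖z‖ ^ 2)) := by
  obtain ⟨K, hK, c, hc, hb⟩ :=
    (HasGaussianGrowth.sum Finset.univ fun i _ => (HasGaussianGrowth.sum Finset.univ fun j _ =>
      (HasGaussianGrowth.sum Finset.univ fun k _ => (h k j i).abs))).exists_shift_le M
  have d1 : ∀ i, ContDiff ℝ 2 (partialDeriv i F) := contDiff_partialDeriv hF (by norm_num)
  have d2 : ∀ i j, ContDiff ℝ 1 (partialDeriv j (partialDeriv i F)) := fun i =>
    contDiff_partialDeriv (d1 i) (by norm_num)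
  refine ⟨K, hK, c, hc, fun m hm z => ?_⟩
  have key := abs_taylor_two_le (φ := fun s : ℝ => F (m + s • z))
    (φ₁ := fun s => ∑ i, z.ofLp i * partialDeriv i F (m + s • z))
    (φ₂ := fun s => ∑ i, z.ofLp i * ∑ j, z.ofLp j * partialDeriv j (partialDeriv i F) (m + s • z))
    (φ₃ := fun s => ∑ i, z.ofLp i * ∑ j, z.ofLp j * ∑ k, z.ofLp k *
      partialDeriv k (partialDeriv j (partialDeriv i F)) (m + s • z))
    (K := K * (‖z‖ ^ 3 * Real.exp (c * ‖z‖ ^ 2)))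
    (fun s => hasDerivAt_line (hF.differentiable (by norm_num)) m z s)
    (fun s => HasDerivAt.fun_sum fun i _ => HasDerivAt.const_mul _
      (hasDerivAt_line ((d1 i).differentiable (by norm_num)) m z s))
    (fun s => HasDerivAt.fun_sum fun i _ => HasDerivAt.const_mul _ (HasDerivAt.fun_sum fun j _ =>
      HasDerivAt.const_mul _ (hasDerivAt_line ((d2 i j).differentiable (by norm_num)) m z s)))
    (fun s hs => by
      have h1 := (le_abs_self _).trans (hb m hm z s hs)
      calc _ ≤ ‖z‖ * ∑ i, (‖z‖ * ∑ j, (‖z‖ * ∑ k,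
            |partialDeriv k (partialDeriv j (partialDeriv i F)) (m + s • z)|)) := by
            refine (abs_sum_coord_mul_le z _).trans ?_
            gcongr with i
            refine (abs_sum_coord_mul_le z _).trans ?_
            gcongr with j
            exact abs_sum_coord_mul_le z _
        _ = ‖z‖ ^ 3 * ∑ i, ∑ j, ∑ k,
            |partialDeriv k (partialDeriv j (partialDeriv i F)) (m + s • z)| := by
            simp only [← Finset.mul_sum]
            ring
        _ ≤ ‖z‖ ^ 3 * (K * Real.exp (c * ‖z‖ ^ 2)) := by gcongr
        _ = _ := by ring)
  simpa using key

/-- A function of Gaussian growth with continuous derivative is locally Lipschitz, with Gaussian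
growth of the increments. -/
theorem exists_abs_sub_le (hF : ContDiff ℝ 1 F) (h : HasGaussianGrowth F) (M : ℝ) :
    ∃ K ≥ (0 : ℝ), ∃ c ≥ (0 : ℝ), ∀ m, ‖m‖ ≤ M → ∀ z,
      |F (m + z) - F m| ≤ K * (‖z‖ * Real.exp (c * ‖z‖ ^ 2)) := by
  obtain ⟨K, hK, c, hc, hb⟩ := h.exists_shift_le M
  have h1 : ContinuousOn (fun x => ∑ k, |partialDeriv k F x|)
      (Metric.closedBall (0 : EuclideanSpace ℝ (Fin d)) (M + 1)) :=
    (continuous_finsetSum _ fun k _ =>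
      (contDiff_partialDeriv (m := 0) hF (by norm_num) k).continuous.abs).continuousOn
  obtain ⟨L, hL⟩ := (isCompact_closedBall _ _).exists_bound_of_continuousOn h1
  refine ⟨2 * K + |L|, by positivity, c, hc, fun m hm z => ?_⟩
  have hE : 1 ≤ Real.exp (c * ‖z‖ ^ 2) := Real.one_le_exp (by positivity)
  -- No growth of the derivative is assumed. For `‖z‖ ≤ 1` a Lipschitz constant on the ball of
  -- radius `M + 1` suffices; for `‖z‖ ≥ 1` the growth of `F` itself does, the factor `‖z‖` being
  -- free.
  rcases le_total ‖z‖ 1 with hz | hz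
  · have h2 := abs_sub_le_of_abs_deriv_le (φ := fun s : ℝ => F (m + s • z))
      (K := ‖z‖ * |L|) (fun s _ => hasDerivAt_line (hF.differentiable (by norm_num)) m z s)
      (fun s hs => (abs_sum_coord_mul_le z _).trans (by
        gcongr
        refine (le_abs_self _).trans ((hL _ ?_).trans (le_abs_self L))
        rw [mem_closedBall_zero_iff]
        refine (norm_add_le _ _).trans (add_le_add hm ?_)
        rw [norm_smul, Real.norm_eq_abs, abs_of_nonneg hs.1]
        exact mul_le_one₀ hs.2 (norm_nonneg _) hz)) 1 (right_mem_Icc.2 zero_le_one)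
    simp only [one_smul, zero_smul, add_zero] at h2
    refine h2.trans ?_
    have h3 : ‖z‖ * |L| ≤ (‖z‖ * |L|) * Real.exp (c * ‖z‖ ^ 2) :=
      le_mul_of_one_le_right (by positivity) hE
    have h4 : 0 ≤ 2 * K * (‖z‖ * Real.exp (c * ‖z‖ ^ 2)) := by positivity
    linarith
  · have h2 := hb m hm z 1 (right_mem_Icc.2 zero_le_one)
    have h3 := hb m hm z 0 (left_mem_Icc.2 zero_le_one)
    simp only [one_smul, zero_smul, add_zero] at h2 h3
    have h4 : K * Real.exp (c * ‖z‖ ^ 2) ≤ K * (‖z‖ * Real.exp (c * ‖z‖ ^ 2)) := by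
      gcongr
      exact le_mul_of_one_le_left (by positivity) hz
    have h5 : 0 ≤ |L| * (‖z‖ * Real.exp (c * ‖z‖ ^ 2)) := by positivity
    have := abs_sub (F (m + z)) (F m)
    linarith

end Lines

/-! ### Interior estimate for the Laplacian. -/

section Bernstein

variable {d : ℕ} {V : EuclideanSpace ℝ (Fin d) → ℝ}

theorem trace_sq_le_frobSq (W : Matrix (Fin d) (Fin d) ℝ) : W.trace ^ 2 ≤ d * frobSq W := by
  have h1 := sq_sum_le_card_mul_sum_sq (s := Finset.univ) (f := fun i => W i i)
  rw [Finset.card_univ, Fintype.card_fin] at h1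
  refine h1.trans ?_
  gcongr
  refine Finset.sum_le_sum fun i _ => ?_
  exact Finset.single_le_sum (f := fun j => W i j ^ 2) (fun _ _ => sq_nonneg _) (Finset.mem_univ i)

/-- Bernstein's interior estimate: the Laplacian is controlled on unit balls by `½ |∇V|²` and its
Laplacian. -/
theorem exists_laplacian_sq_le (hV : ContDiff ℝ 5 V) (x₀ : EuclideanSpace ℝ (Fin d)) :
    ∃ p, ‖p‖ ≤ ‖x₀‖ + 1 ∧ (Δ V) x₀ ^ 2 ≤
      2 * d * |∑ i, partialDeriv i (partialDeriv i (halfGradSq V)) p|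
        + 8 * d ^ 2 * halfGradSq V p := by
  set g := Δ V with hg
  have hgd : Differentiable ℝ g := (contDiff_laplacian hV).differentiable (by norm_num)
  set η : EuclideanSpace ℝ (Fin d) → ℝ := fun x => 1 - ‖x - x₀‖ ^ 2 with hη
  have hηc : Continuous η := by fun_prop
  -- The cut-off `η` is `1` at the centre and `0` on the unit sphere, so the maximum of `(ηg)²`
  -- dominates `g(x₀)²` and, unless it is zero, is attained inside.
  obtain ⟨p, hp, hmax⟩ := (isCompact_closedBall x₀ (1 : ℝ)).exists_isMaxOn
    ⟨x₀, Metric.mem_closedBall_self zero_le_one⟩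
    (f := fun x => η x * g x * (η x * g x)) (by
      have := hgd.continuous
      fun_prop)
  have hp1 : ‖p - x₀‖ ≤ 1 := by simpa [dist_eq_norm] using hp
  have hpn : ‖p‖ ≤ ‖x₀‖ + 1 := by
    have := norm_add_le (p - x₀) x₀
    rw [sub_add_cancel] at this
    linarith
  refine ⟨p, hpn, ?_⟩
  have hf0 : 0 ≤ halfGradSq V p := by rw [halfGradSq]; positivity
  have hle : g x₀ ^ 2 ≤ η p * g p * (η p * g p) := by
    have := hmax (Metric.mem_closedBall_self (x := x₀) zero_le_one)
    simpa [hη, sq] using this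
  refine hle.trans ?_
  have hη1 : η p ≤ 1 := by simp only [hη]; nlinarith [sq_nonneg ‖p - x₀‖]
  have hη0 : 0 ≤ η p := by simp only [hη]; nlinarith [norm_nonneg (p - x₀)]
  by_cases hz : η p * g p = 0
  · rw [hz, mul_zero]
    exact add_nonneg (by positivity) (mul_nonneg (by positivity) hf0)
  have hηp : 0 < η p := lt_of_le_of_ne hη0 fun h => hz (by rw [← h, zero_mul])
  have hpint : Metric.closedBall x₀ 1 ∈ 𝓝 p := by
    refine mem_of_superset (Metric.isOpen_ball.mem_nhds ?_) Metric.ball_subset_closedBall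
    rw [Metric.mem_ball, dist_eq_norm]
    simp only [hη] at hηp
    nlinarith [norm_nonneg (p - x₀)]
  have hηd : HasFDerivAt η (-((2 : ℝ) • innerSL ℝ (p - x₀))) p := by
    have := (((hasFDerivAt_id p).sub_const x₀).norm_sq).const_sub 1
    refine this.congr_fderiv ?_
    ext v
    simp
  have hprod := hηd.fun_mul (hgd p).hasFDerivAt
  have hzero := (hmax.isLocalMax hpint).hasFDerivAt_eq_zero (hprod.fun_mul hprod)
  have h1 := congrArg (fun L => L (∇ V p)) hzero
  simp only [add_apply, smul_apply, neg_apply, zero_apply, smul_eq_mul,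
    innerSL_apply_apply] at h1
  set w := fderiv ℝ g p (∇ V p) with hw
  set q := inner ℝ (p - x₀) (∇ V p) with hq
  -- Criticality `η∇g = -g∇η` at `p`, contracted with `∇V`. It trades the third-order quantity `w =
  -- ∇ΔV·∇V` for `g` and `∇V`.
  have h2 : η p * w = 2 * g p * q := by
    have h3 : (η p * g p) * (η p * w - 2 * g p * q) = 0 := by linear_combination h1 / 2
    rcases mul_eq_zero.1 h3 with h | h
    · exact absurd h hz
    · linarith
  have hqb : |q| ≤ ‖∇ V p‖ := (abs_real_inner_le_norm _ _).trans
    (mul_le_of_le_one_left (norm_nonneg _) hp1)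
  have hB := sum_partialDeriv_halfGradSq hV p
  set Lf := ∑ i, partialDeriv i (partialDeriv i (halfGradSq V)) p with hLf
  have hT := trace_sq_le_frobSq (hessianMatrix V p)
  rw [← laplacian_eq_trace hV, ← hg] at hT
  set y := η p * g p with hy
  have hfr : frobSq (hessianMatrix V p) = Lf - w := by linarith
  rw [hfr] at hT
  -- `g² ≤ d|D²V|²` combined with Bochner's identity. The cross term is absorbed at the end by `(y +
  -- 2dq)² ≥ 0`.
  have h4 : y * y ≤ d * (η p ^ 2 * Lf) - 2 * d * y * q := by
    calc y * y = η p ^ 2 * g p ^ 2 := by rw [hy]; ring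
      _ ≤ η p ^ 2 * (d * (Lf - w)) := by gcongr
      _ = d * (η p ^ 2 * Lf) - d * η p * (η p * w) := by ring
      _ = _ := by rw [h2, hy]; ring
  have h5 : η p ^ 2 * Lf ≤ |Lf| := by
    calc η p ^ 2 * Lf ≤ η p ^ 2 * |Lf| := by gcongr; exact le_abs_self _
      _ ≤ |Lf| := mul_le_of_le_one_left (abs_nonneg _) (pow_le_one₀ hη0 hη1)
  have h6 : (d : ℝ) * (η p ^ 2 * Lf) ≤ d * |Lf| := by gcongr
  have h7 : q ^ 2 ≤ 2 * halfGradSq V p := by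
    rw [halfGradSq, ← sq_abs q]
    nlinarith [abs_nonneg q, norm_nonneg (∇ V p)]
  have h8 : (d : ℝ) ^ 2 * q ^ 2 ≤ d ^ 2 * (2 * halfGradSq V p) := by gcongr
  nlinarith [sq_nonneg (y + 2 * d * q)]

end Bernstein

/-! ### Gaussian growth of the functions entering the expansion. -/

namespace IsAdmissiblePotential

variable {d : ℕ} {V : EuclideanSpace ℝ (Fin d) → ℝ}

/-- At fixed `x` the quantities in the growth condition are continuous in `ε`, so the limsup is the
value at `ε = 0`, where only `½|∇V|²` remains. -/
theorem hasGaussianGrowth_third (hV : IsAdmissiblePotential V) (i j k : Fin d) :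
    HasGaussianGrowth (partialDeriv i (partialDeriv j (partialDeriv k (halfGradSq V)))) := by
  obtain ⟨C₁, hC₁, C₂, hC₂, α, hα0, hα2, hb⟩ := hV.growth
  have hf : ContDiff ℝ 3 (halfGradSq V) := (contDiff_halfGradSq hV.contDiff).of_le (by norm_num)
  refine ⟨C₁ * Real.exp C₂, by positivity, C₂, hC₂.le, fun x => ?_⟩
  have h1 := hb x i j k
  have hd : ∀ ε : ℝ, iteratedFDeriv ℝ 3 (pathPotential V ε) x
      = iteratedFDeriv ℝ 3 (halfGradSq V) x - ε • iteratedFDeriv ℝ 3 (Δ V) x := fun ε => by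
    have e1 : ContDiff ℝ (3 : ℕ) (Δ V) := by exact_mod_cast contDiff_laplacian hV.contDiff
    have e2 : ContDiff ℝ (3 : ℕ) (halfGradSq V) := by exact_mod_cast hf
    have e3 : ContDiffAt ℝ (3 : ℕ) (ε • Δ V) x := e1.contDiffAt.const_smul ε
    rw [pathPotential_eq, iteratedFDeriv_sub_apply e2.contDiffAt e3,
      iteratedFDeriv_const_smul_apply e1.contDiffAt]
  have h2 : Tendsto (fun ε : ℝ => max
        |iteratedFDeriv ℝ 3 (pathPotential V ε) x
          ![EuclideanSpace.single i 1, EuclideanSpace.single j 1, EuclideanSpace.single k 1]|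
        |pathPotential V ε x|) (𝓝[>] 0)
      (𝓝 (max |partialDeriv i (partialDeriv j (partialDeriv k (halfGradSq V))) x|
        |halfGradSq V x|)) := by
    simp only [hd]
    simp only [pathPotential_eq, sub_apply, smul_apply, iteratedFDeriv_three_single hf, Pi.sub_apply,
      Pi.smul_apply, smul_eq_mul]
    refine Tendsto.mono_left (Continuous.tendsto' ?_ _ _ ?_) nhdsWithin_le_nhds
    · fun_prop
    · simp
  rw [h2.limsup_eq] at h1
  refine (le_max_left _ _).trans (h1.trans ?_)
  rw [mul_assoc, ← Real.exp_add]
  gcongr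
  -- A Gaussian bound is enough, since the exponential weight available later has a coefficient of
  -- order `1/ε`.
  have h3 : ‖x‖ ^ α ≤ 1 + ‖x‖ ^ 2 := by
    rcases le_total ‖x‖ 1 with h | h
    · have := Real.rpow_le_one (norm_nonneg x) h hα0
      nlinarith [sq_nonneg ‖x‖]
    · have := Real.rpow_le_rpow_of_exponent_le h hα2.le
      rw [Real.rpow_two] at this
      linarith
  nlinarith

theorem hasGaussianGrowth_second (hV : IsAdmissiblePotential V) (j k : Fin d) :
    HasGaussianGrowth (partialDeriv j (partialDeriv k (halfGradSq V))) :=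
  .of_partialDeriv ((contDiff_partialDeriv (m := 2) (contDiff_partialDeriv (m := 3)
    (contDiff_halfGradSq hV.contDiff) (by norm_num) k) (by norm_num) j).differentiable
      (by norm_num)) fun i => hV.hasGaussianGrowth_third i j k

theorem hasGaussianGrowth_halfGradSq (hV : IsAdmissiblePotential V) :
    HasGaussianGrowth (halfGradSq V) :=
  .of_partialDeriv ((contDiff_halfGradSq hV.contDiff).differentiable (by norm_num)) fun k =>
    .of_partialDeriv ((contDiff_partialDeriv (m := 3)
      (contDiff_halfGradSq hV.contDiff) (by norm_num) k).differentiable (by norm_num))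
      fun j => hV.hasGaussianGrowth_second j k

/-- The Bernstein estimate bounds `ΔV` at `x` by functions of known growth at a point within
distance one of the ball of radius `‖x‖`. -/
theorem hasGaussianGrowth_laplacian (hV : IsAdmissiblePotential V) :
    HasGaussianGrowth (Δ V) := by
  have h1 : HasGaussianGrowth fun x =>
      1 + (2 * d * |∑ i, partialDeriv i (partialDeriv i (halfGradSq V)) x|
        + 8 * d ^ 2 * halfGradSq V x) :=
    (HasGaussianGrowth.const 1).add (((HasGaussianGrowth.const (2 * (d : ℝ))).mul
      (HasGaussianGrowth.sum Finset.univ fun i _ => hV.hasGaussianGrowth_second i i).abs).add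
      ((HasGaussianGrowth.const (8 * (d : ℝ) ^ 2)).mul hV.hasGaussianGrowth_halfGradSq))
  refine h1.of_forall_exists fun x => ?_
  obtain ⟨p, hp, hle⟩ := exists_laplacian_sq_le hV.contDiff x
  refine ⟨p, hp, le_trans ?_ (le_abs_self _)⟩
  rw [← sq_abs] at hle
  nlinarith [sq_nonneg (|(Δ V) x| - 1), abs_nonneg ((Δ V) x)]

end IsAdmissiblePotential

/-! ## Expectations under the bridge law -/

namespace IsBridgeLaw

variable {d : ℕ} {ε a β : ℝ} {A X Y : ℝ → Matrix (Fin d) (Fin d) ℝ} {ν : Measure (PathSpace d)}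
  (hν : IsBridgeLaw ε A ν) (h : IsFundamentalPair ε A X Y) (hε : 0 < ε) (ha : 0 < a)
  (hA : MemH1Mat a A) (hβ : 0 < β) (hβ' : 4 * (β * d) * (ε / a) ≤ 1)

include hν h hε ha hA hβ hβ'

theorem integrable_of_abs_le_exp {t : ℝ} (ht : t ∈ Icc (0 : ℝ) 1) {R : PathSpace d → ℝ}
    (hR : AEStronglyMeasurable R ν) {κ : ℝ}
    (hb : ∀ z, |R z| ≤ κ * Real.exp (β * ‖pathEval z t‖ ^ 2)) :
    Integrable R ν ∧ ∫ z, |R z| ∂ν ≤ κ * (1 + d * 2) := by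
  obtain ⟨h1, h2⟩ := hν.integrable_exp_norm_sq h hε ha hA ht hβ.le hβ'
  have h3 : Integrable R ν := (h1.const_mul κ).mono' hR (.of_forall fun z => hb z)
  have hκ : 0 ≤ κ := by
    have := (abs_nonneg _).trans (hb 0)
    exact nonneg_of_mul_nonneg_left this (Real.exp_pos _)
  refine ⟨h3, (integral_mono h3.abs (h1.const_mul κ) hb).trans ?_⟩
  rw [integral_const_mul]
  exact mul_le_mul_of_nonneg_left h2 hκ

/-- Tonelli: the exponential moment is bounded uniformly in time, so the prefactor `κ(t)` need only
be integrable. This allows for `A'`, which has no pointwise bound. -/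
theorem integrable_prod_of_abs_le_exp {Φ : PathSpace d × ℝ → ℝ}
    (hΦ : AEStronglyMeasurable Φ (ν.prod (volume.restrict (Ioc (0 : ℝ) 1)))) {κ : ℝ → ℝ}
    (hκ : IntervalIntegrable κ volume 0 1)
    (hb : ∀ t ∈ Icc (0 : ℝ) 1, ∀ z, |Φ (z, t)| ≤ κ t * Real.exp (β * ‖pathEval z t‖ ^ 2)) :
    Integrable Φ (ν.prod (volume.restrict (Ioc (0 : ℝ) 1))) := by
  have := hν.gaussian
  rw [intervalIntegrable_iff_integrableOn_Ioc_of_le zero_le_one] at hκ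
  have hs := hΦ.prod_swap
  have h1 : ∀ᵐ t ∂(volume.restrict (Ioc (0 : ℝ) 1)), Integrable (fun z => Φ (z, t)) ν ∧
      ∫ z, |Φ (z, t)| ∂ν ≤ κ t * (1 + d * 2) := by
    filter_upwards [hs.prodMk_left, ae_restrict_mem measurableSet_Ioc] with t ht ht2
    exact hν.integrable_of_abs_le_exp h hε ha hA hβ hβ' (Ioc_subset_Icc_self ht2) ht
      (hb t (Ioc_subset_Icc_self ht2))
  refine (integrable_prod_iff' hΦ).2 ⟨h1.mono fun t ht => ht.1, ?_⟩
  refine Integrable.mono' (hκ.mul_const (1 + d * 2 : ℝ)) hs.norm.integral_prod_right' ?_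
  filter_upwards [h1] with t ht
  rw [Real.norm_eq_abs, abs_of_nonneg (integral_nonneg fun _ => norm_nonneg _)]
  exact ht.2

theorem integrable_coord {t : ℝ} (ht : t ∈ Icc (0 : ℝ) 1) (i : Fin d) :
    Integrable (fun z => (pathEval z t).ofLp i) ν := by
  refine (hν.integrable_of_abs_le_exp h hε ha hA hβ hβ' ht (κ := (√β)⁻¹)
    (pathCoord d t i).continuous.aestronglyMeasurable fun z => ?_).1
  have := (mul_exp_sq_le (c := 0) (y := ‖pathEval z t‖) hβ (by linarith)).1
  rw [zero_mul, Real.exp_zero, mul_one] at this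
  exact (PiLp.norm_apply_le _ i).trans this

omit hν h hε ha hA hβ' in
theorem abs_coord_mul_coord_le (x : EuclideanSpace ℝ (Fin d)) (i j : Fin d) :
    |x.ofLp i * x.ofLp j| ≤ β⁻¹ * Real.exp (β * ‖x‖ ^ 2) := by
  rw [abs_mul]
  have h1 : |x.ofLp i| * |x.ofLp j| ≤ ‖x‖ * ‖x‖ :=
    mul_le_mul (PiLp.norm_apply_le x i) (PiLp.norm_apply_le x j) (abs_nonneg _) (norm_nonneg _)
  refine h1.trans ?_
  rw [le_inv_mul_iff₀ hβ]
  have := Real.add_one_le_exp (β * ‖x‖ ^ 2)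
  nlinarith

theorem integrable_coord_mul_coord {t : ℝ} (ht : t ∈ Icc (0 : ℝ) 1) (i j : Fin d) :
    Integrable (fun z => (pathEval z t).ofLp i * (pathEval z t).ofLp j) ν :=
  (hν.integrable_of_abs_le_exp h hε ha hA hβ hβ' ht (κ := β⁻¹)
    ((pathCoord d t i).continuous.mul (pathCoord d t j).continuous).aestronglyMeasurable
    fun z => abs_coord_mul_coord_le hβ (pathEval z t) i j).1

theorem integral_quadratic {t : ℝ} (ht : t ∈ Icc (0 : ℝ) 1) (S : Matrix (Fin d) (Fin d) ℝ) :
    Integrable (fun z => ∑ i, (pathEval z t).ofLp i * ∑ j, (pathEval z t).ofLp j * S j i) ν ∧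
    ∫ z, ∑ i, (pathEval z t).ofLp i * ∑ j, (pathEval z t).ofLp j * S j i ∂ν
      = (S * (freeCov X Y t - bridgeCorr X Y t)).trace := by
  have h1 : ∀ i j, Integrable (fun z =>
      S j i * ((pathEval z t).ofLp i * (pathEval z t).ofLp j)) ν := fun i j =>
    (hν.integrable_coord_mul_coord h hε ha hA hβ hβ' ht i j).const_mul _
  have h2 : (fun z => ∑ i, (pathEval z t).ofLp i * ∑ j, (pathEval z t).ofLp j * S j i)
      = fun z => ∑ i, ∑ j, S j i * ((pathEval z t).ofLp i * (pathEval z t).ofLp j) := by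
    funext z
    simp only [Finset.mul_sum]
    exact Finset.sum_congr rfl fun i _ => Finset.sum_congr rfl fun j _ => by ring
  rw [h2]
  refine ⟨integrable_finsetSum _ fun i _ => integrable_finsetSum _ fun j _ => h1 i j, ?_⟩
  rw [integral_finsetSum _ fun i _ => integrable_finsetSum _ fun j _ => h1 i j,
    trace_mul_eq_sum, Finset.sum_comm]
  refine Finset.sum_congr rfl fun i _ => ?_
  rw [integral_finsetSum _ fun j _ => h1 i j]
  refine Finset.sum_congr rfl fun j _ => ?_
  rw [integral_const_mul, hν.integral_coord_mul_coord h hε ha hA ht]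

/-- The expectation of a function of `z(t)`, expanded to second order. -/
theorem abs_integral_sub_taylor_le {F : EuclideanSpace ℝ (Fin d) → ℝ} (hF : Continuous F)
    {x : EuclideanSpace ℝ (Fin d)} {p : Fin d → ℝ} {S : Matrix (Fin d) (Fin d) ℝ} {K c : ℝ}
    (hK : 0 ≤ K) (hcβ : 2 * c ≤ β)
    (hb : ∀ z, |F (x + z) - F x - ∑ i, z.ofLp i * p i
      - 1 / 2 * ∑ i, z.ofLp i * ∑ j, z.ofLp j * S j i| ≤ K * (‖z‖ ^ 3 * Real.exp (c * ‖z‖ ^ 2)))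
    {t : ℝ} (ht : t ∈ Icc (0 : ℝ) 1) :
    |(∫ z, F (pathEval z t + x) ∂ν) - F x
      - 1 / 2 * (S * (freeCov X Y t - bridgeCorr X Y t)).trace|
      ≤ K * (9 * (√β)⁻¹ ^ 3) * (1 + d * 2) := by
  have := hν.gaussian
  obtain ⟨q1, q2⟩ := hν.integral_quadratic h hε ha hA hβ hβ' ht S
  have l1 : Integrable (fun z => ∑ i, (pathEval z t).ofLp i * p i) ν :=
    integrable_finsetSum _ fun i _ =>
      (hν.integrable_coord h hε ha hA hβ hβ' ht i).mul_const _
  have l2 : ∫ z, ∑ i, (pathEval z t).ofLp i * p i ∂ν = 0 := by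
    rw [integral_finsetSum _ fun i _ =>
      (hν.integrable_coord h hε ha hA hβ hβ' ht i).mul_const _]
    simp [integral_mul_const, hν.integral_coord]
  set R : PathSpace d → ℝ := fun z => F (x + pathEval z t) - F x
    - ∑ i, (pathEval z t).ofLp i * p i
      - 1 / 2 * ∑ i, (pathEval z t).ofLp i * ∑ j, (pathEval z t).ofLp j * S j i with hR
  have hc : Continuous fun z : PathSpace d => F (x + pathEval z t) :=
    hF.comp (continuous_const.add (pathEvalCLM d t).continuous)
  have hRm : AEStronglyMeasurable R ν :=
    (((hc.aestronglyMeasurable.sub aestronglyMeasurable_const).sub l1.aestronglyMeasurable).sub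
      (q1.aestronglyMeasurable.const_mul _))
  -- Only the cubic remainder survives: the linear term is centred and the quadratic one is
  -- evaluated exactly. With `β` of order `1/ε` the bound `β^{-3/2}` is `O(ε^{3/2})`.
  obtain ⟨r1, r2⟩ := hν.integrable_of_abs_le_exp h hε ha hA hβ hβ' ht hRm
    (κ := K * (9 * (√β)⁻¹ ^ 3)) fun z => by
      refine (hb (pathEval z t)).trans ?_
      rw [mul_assoc]
      exact mul_le_mul_of_nonneg_left (mul_exp_sq_le hβ hcβ).2 hK
  have e1 : ∫ z, F (pathEval z t + x) ∂ν = ∫ z, (R z + (F x + (∑ i, (pathEval z t).ofLp i * p i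
      + 1 / 2 * ∑ i, (pathEval z t).ofLp i * ∑ j, (pathEval z t).ofLp j * S j i))) ∂ν := by
    refine integral_congr_ae (.of_forall fun z => ?_)
    simp only [hR]
    rw [add_comm]
    ring
  have i1 : Integrable (fun z => ∑ i, (pathEval z t).ofLp i * p i
      + 1 / 2 * ∑ i, (pathEval z t).ofLp i * ∑ j, (pathEval z t).ofLp j * S j i) ν :=
    l1.add (q1.const_mul _)
  have i2 : Integrable (fun z => F x + (∑ i, (pathEval z t).ofLp i * p i
      + 1 / 2 * ∑ i, (pathEval z t).ofLp i * ∑ j, (pathEval z t).ofLp j * S j i)) ν :=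
    (integrable_const _).add i1
  rw [e1, integral_add r1 i2, integral_add (integrable_const _) i1,
    integral_add l1 (q1.const_mul _), l2, integral_const_mul, q2]
  simp only [integral_const, probReal_univ, one_smul]
  rw [show ∀ u v w : ℝ, u + (v + (0 + w)) - v - w = u by intros; ring]
  exact (abs_integral_le_integral_abs).trans r2

/-- The expectation of a function of `z(t)`, expanded to zeroth order. -/
theorem abs_integral_sub_le {F : EuclideanSpace ℝ (Fin d) → ℝ} (hF : Continuous F)
    {x : EuclideanSpace ℝ (Fin d)} {K c : ℝ} (hK : 0 ≤ K) (hcβ : 2 * c ≤ β)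
    (hb : ∀ z, |F (x + z) - F x| ≤ K * (‖z‖ * Real.exp (c * ‖z‖ ^ 2)))
    {t : ℝ} (ht : t ∈ Icc (0 : ℝ) 1) :
    |(∫ z, F (pathEval z t + x) ∂ν) - F x| ≤ K * (√β)⁻¹ * (1 + d * 2) := by
  have := hν.gaussian
  have hc : Continuous fun z : PathSpace d => F (x + pathEval z t) - F x :=
    (hF.comp (continuous_const.add (pathEvalCLM d t).continuous)).sub continuous_const
  obtain ⟨r1, r2⟩ := hν.integrable_of_abs_le_exp h hε ha hA hβ hβ' ht hc.aestronglyMeasurable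
    (κ := K * (√β)⁻¹) fun z => by
      refine (hb (pathEval z t)).trans ?_
      rw [mul_assoc]
      exact mul_le_mul_of_nonneg_left (mul_exp_sq_le hβ hcβ).1 hK
  have e1 : ∫ z, F (pathEval z t + x) ∂ν
      = ∫ z, ((F (x + pathEval z t) - F x) + F x) ∂ν := by
    refine integral_congr_ae (.of_forall fun z => ?_)
    simp only [sub_add_cancel]
    rw [add_comm]
  rw [e1, integral_add r1 (integrable_const _)]
  simp only [integral_const, probReal_univ, one_smul, add_sub_cancel_right]
  exact (abs_integral_le_integral_abs).trans r2

theorem integrable_prod_comp {F : EuclideanSpace ℝ (Fin d) → ℝ} (hF : Continuous F)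
    {m : ℝ → EuclideanSpace ℝ (Fin d)} (hm : ContinuousOn m (Icc 0 1)) {K c : ℝ} (hK : 0 ≤ K)
    (hcβ : c ≤ β)
    (hb : ∀ t ∈ Icc (0 : ℝ) 1, ∀ z, |F (z + m t)| ≤ K * Real.exp (c * ‖z‖ ^ 2)) :
    Integrable (fun p : PathSpace d × ℝ => F (pathEval p.1 p.2 + m p.2))
      (ν.prod (volume.restrict (Ioc (0 : ℝ) 1))) := by
  have := hν.gaussian
  refine hν.integrable_prod_of_abs_le_exp h hε ha hA hβ hβ' ?_ (κ := fun _ => K)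
    intervalIntegrable_const fun t ht z => (hb t ht _).trans ?_
  · refine hF.comp_aestronglyMeasurable (continuous_pathEval_uncurry.aestronglyMeasurable.add ?_)
    exact AEStronglyMeasurable.comp_snd
      ((hm.mono Ioc_subset_Icc_self).aestronglyMeasurable measurableSet_Ioc)
  · gcongr

theorem integrable_prod_quadratic :
    Integrable (fun p : PathSpace d × ℝ => (pathEval p.1 p.2).ofLp ⬝ᵥ
      (schrodingerPotential ε A p.2 *ᵥ (pathEval p.1 p.2).ofLp))
      (ν.prod (volume.restrict (Ioc (0 : ℝ) 1))) := by
  have := hν.gaussian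
  have hB : ∀ i j, IntervalIntegrable (fun t => schrodingerPotential ε A t i j) volume 0 1 := by
    intro i j
    have hc : ContinuousOn (fun t => (A t * A t) i j) (Icc 0 1) := by
      simp only [Matrix.mul_apply]
      exact continuousOn_finsetSum _ fun k _ =>
        (hA.continuousOn_apply i k).mul (hA.continuousOn_apply k j)
    exact ((intervalIntegrable_of_continuousOn_unit hc).const_mul _).sub
      ((hA.intervalIntegrable_matDeriv i j).const_mul _)
  have he : (fun p : PathSpace d × ℝ => (pathEval p.1 p.2).ofLp ⬝ᵥ
      (schrodingerPotential ε A p.2 *ᵥ (pathEval p.1 p.2).ofLp)) = fun p => ∑ i, ∑ j,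
        schrodingerPotential ε A p.2 i j * ((pathEval p.1 p.2).ofLp i * (pathEval p.1 p.2).ofLp j) := by
    funext p
    simp only [dotProduct, Matrix.mulVec, Finset.mul_sum]
    exact Finset.sum_congr rfl fun i _ => Finset.sum_congr rfl fun j _ => by ring
  rw [he]
  refine integrable_finsetSum _ fun i _ => integrable_finsetSum _ fun j _ => ?_
  refine hν.integrable_prod_of_abs_le_exp h hε ha hA hβ hβ' ?_
    (κ := fun t => |schrodingerPotential ε A t i j| * β⁻¹) ((hB i j).abs.mul_const _)
    fun t ht z => ?_
  · have h1 := (hB i j).aestronglyMeasurable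
    refine AEStronglyMeasurable.mul (AEStronglyMeasurable.comp_snd h1) ?_
    have h2 : ∀ i, Continuous fun p : PathSpace d × ℝ => (pathEval p.1 p.2).ofLp i := fun i =>
      (EuclideanSpace.proj (𝕜 := ℝ) i).continuous.comp continuous_pathEval_uncurry
    exact ((h2 i).mul (h2 j)).aestronglyMeasurable
  · rw [abs_mul, mul_assoc]
    exact mul_le_mul_of_nonneg_left (abs_coord_mul_coord_le hβ _ i j) (abs_nonneg _)

theorem integral_pathQuadraticIntegral :
    Integrable (pathQuadraticIntegral ε A) ν ∧ ∫ z, pathQuadraticIntegral ε A z ∂ν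
      = ∫ t in (0 : ℝ)..1,
        (schrodingerPotential ε A t * (freeCov X Y t - bridgeCorr X Y t)).trace := by
  have := hν.gaussian
  have h1 := hν.integrable_prod_quadratic h hε ha hA hβ hβ'
  have e1 : pathQuadraticIntegral ε A = fun z => ∫ t in Ioc (0 : ℝ) 1, (pathEval z t).ofLp ⬝ᵥ
      (schrodingerPotential ε A t *ᵥ (pathEval z t).ofLp) := by
    funext z
    rw [pathQuadraticIntegral, intervalIntegral.integral_of_le zero_le_one]
  rw [e1]
  refine ⟨h1.integral_prod_left, ?_⟩
  rw [integral_integral_swap h1, intervalIntegral.integral_of_le zero_le_one]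
  refine setIntegral_congr_fun measurableSet_Ioc fun t ht => ?_
  simp only
  have h2 := (hν.integral_quadratic h hε ha hA hβ hβ' (Ioc_subset_Icc_self ht)
    (schrodingerPotential ε A t)).2
  rw [← h2]
  refine integral_congr_ae (.of_forall fun z => ?_)
  simp only [dotProduct, Matrix.mulVec, Finset.mul_sum]
  rw [Finset.sum_comm]
  exact Finset.sum_congr rfl fun i _ => Finset.sum_congr rfl fun j _ => by ring

omit h hε ha hA hβ hβ' in
theorem integral_pathPotentialIntegral {V : EuclideanSpace ℝ (Fin d) → ℝ}
    {m : ℝ → EuclideanSpace ℝ (Fin d)}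
    (hf : Integrable (fun p : PathSpace d × ℝ => halfGradSq V (pathEval p.1 p.2 + m p.2))
      (ν.prod (volume.restrict (Ioc (0 : ℝ) 1))))
    (hg : Integrable (fun p : PathSpace d × ℝ => (Δ V) (pathEval p.1 p.2 + m p.2))
      (ν.prod (volume.restrict (Ioc (0 : ℝ) 1)))) :
    Integrable (pathPotentialIntegral V ε m) ν ∧ ∫ z, pathPotentialIntegral V ε m z ∂ν
      = (∫ t in (0 : ℝ)..1, ∫ z, halfGradSq V (pathEval z t + m t) ∂ν)
        - ε * ∫ t in (0 : ℝ)..1, ∫ z, (Δ V) (pathEval z t + m t) ∂ν := by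
  have := hν.gaussian
  have h1 := hf.sub (hg.const_mul ε)
  have e1 : pathPotentialIntegral V ε m = fun z => ∫ t in Ioc (0 : ℝ) 1,
      (halfGradSq V (pathEval z t + m t) - ε * (Δ V) (pathEval z t + m t)) := by
    funext z
    rw [pathPotentialIntegral, intervalIntegral.integral_of_le zero_le_one]
    rfl
  rw [e1]
  refine ⟨h1.integral_prod_left, ?_⟩
  have s1 : ∫ z, (∫ t in Ioc (0 : ℝ) 1, halfGradSq V (pathEval z t + m t)) ∂ν
      = ∫ t in Ioc (0 : ℝ) 1, ∫ z, halfGradSq V (pathEval z t + m t) ∂ν :=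
    integral_integral_swap hf
  have s2 : ∫ z, (∫ t in Ioc (0 : ℝ) 1, (Δ V) (pathEval z t + m t)) ∂ν
      = ∫ t in Ioc (0 : ℝ) 1, ∫ z, (Δ V) (pathEval z t + m t) ∂ν :=
    integral_integral_swap hg
  rw [intervalIntegral.integral_of_le zero_le_one, intervalIntegral.integral_of_le zero_le_one,
    ← s1, ← s2, ← integral_const_mul,
    ← integral_sub hf.integral_prod_left (hg.integral_prod_left.const_mul ε)]
  refine integral_congr_ae ?_
  filter_upwards [hf.prod_right_ae, hg.prod_right_ae] with z hz1 hz2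
  rw [integral_sub hz1 (hz2.const_mul ε), integral_const_mul]

end IsBridgeLaw

/-! ## The expansion at fixed `ε` -/

section PotentialBounds

variable {d : ℕ} {V : EuclideanSpace ℝ (Fin d) → ℝ}

theorem continuous_hessianMatrix (hV : ContDiff ℝ 5 V) : Continuous (hessianMatrix V) := by
  refine continuous_matrix fun i j => ?_
  simp only [hessianMatrix_apply hV]
  exact (contDiff_partialDeriv (m := 0) (contDiff_partialDeriv (m := 1) hV
    (by norm_num) j) (by norm_num) i).continuous

theorem continuous_thirdDerivGradMatrix (hV : ContDiff ℝ 5 V) :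
    Continuous (thirdDerivGradMatrix V) := by
  refine continuous_matrix fun i j => ?_
  simp only [thirdDerivGradMatrix_apply hV]
  have h1 : ∀ k, ContDiff ℝ 4 (partialDeriv k V) := fun k =>
    contDiff_partialDeriv hV (by norm_num) k
  exact continuous_finsetSum _ fun k _ =>
    (contDiff_partialDeriv (m := 0) (contDiff_partialDeriv (m := 1) (h1 k) (by norm_num) j)
      (by norm_num) i).continuous.mul (h1 k).continuous

/-- Uniform bounds for a potential `V` around the points of a ball: Taylor expansions of
`½ |∇V|²` and `ΔV`, and their growth. -/
structure HasPotentialBounds (V : EuclideanSpace ℝ (Fin d) → ℝ) (M K c : ℝ) : Prop where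
  nonneg : 0 ≤ K
  taylor : ∀ x, ‖x‖ ≤ M → ∀ z, |halfGradSq V (x + z) - halfGradSq V x
    - ∑ i, z.ofLp i * partialDeriv i (halfGradSq V) x
    - 1 / 2 * ∑ i, z.ofLp i * ∑ j, z.ofLp j *
      (hessianMatrix V x ^ 2 + thirdDerivGradMatrix V x) j i|
      ≤ K * (‖z‖ ^ 3 * Real.exp (c * ‖z‖ ^ 2))
  laplacian_sub : ∀ x, ‖x‖ ≤ M → ∀ z,
    |(Δ V) (x + z) - (Δ V) x| ≤ K * (‖z‖ * Real.exp (c * ‖z‖ ^ 2))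
  halfGradSq_le : ∀ x, ‖x‖ ≤ M → ∀ z, |halfGradSq V (z + x)| ≤ K * Real.exp (c * ‖z‖ ^ 2)
  laplacian_le : ∀ x, ‖x‖ ≤ M → ∀ z, |(Δ V) (z + x)| ≤ K * Real.exp (c * ‖z‖ ^ 2)
  apply_le : ∀ x, ‖x‖ ≤ M → ∀ i j,
    |(hessianMatrix V x ^ 2 + thirdDerivGradMatrix V x) i j| ≤ K

theorem IsAdmissiblePotential.exists_hasPotentialBounds (hV : IsAdmissiblePotential V) (M : ℝ) :
    ∃ K c, HasPotentialBounds V M K c := by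
  have hf := contDiff_halfGradSq hV.contDiff
  have hg := contDiff_laplacian hV.contDiff
  obtain ⟨K₁, hK₁, c₁, hc₁, h₁⟩ := exists_abs_taylor_le (hf.of_le (by norm_num))
    hV.hasGaussianGrowth_third M
  obtain ⟨K₂, hK₂, c₂, hc₂, h₂⟩ := exists_abs_sub_le (hg.of_le (by norm_num))
    hV.hasGaussianGrowth_laplacian M
  obtain ⟨K₃, hK₃, c₃, hc₃, h₃⟩ := hV.hasGaussianGrowth_halfGradSq.exists_shift_le M
  obtain ⟨K₄, hK₄, c₄, hc₄, h₄⟩ := hV.hasGaussianGrowth_laplacian.exists_shift_le M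
  have hSc : Continuous fun x => hessianMatrix V x ^ 2 + thirdDerivGradMatrix V x :=
    ((continuous_hessianMatrix hV.contDiff).pow 2).add
      (continuous_thirdDerivGradMatrix hV.contDiff)
  have hS : ∀ i j, ∃ L, ∀ x ∈ Metric.closedBall (0 : EuclideanSpace ℝ (Fin d)) M,
      |(hessianMatrix V x ^ 2 + thirdDerivGradMatrix V x) i j| ≤ L := fun i j =>
    (isCompact_closedBall _ _).exists_bound_of_continuousOn
      ((continuous_id.matrix_elem i j).comp hSc).continuousOn
  choose L hL using hS
  have key : ∀ {u k k' e e' : ℝ} (y : ℝ), 0 ≤ k → k ≤ k' → e ≤ e' → 0 ≤ u →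
      k * (u * Real.exp (e * y ^ 2)) ≤ k' * (u * Real.exp (e' * y ^ 2)) :=
    fun y _ _ _ _ => by gcongr; linarith
  have hsum : 0 ≤ ∑ i, ∑ j, |L i j| := by positivity
  refine ⟨K₁ + K₂ + K₃ + K₄ + ∑ i, ∑ j, |L i j|, c₁ + c₂ + c₃ + c₄, by positivity,
    fun x hx z => ?_, fun x hx z => ?_, fun x hx z => ?_, fun x hx z => ?_, fun x hx i j => ?_⟩
  · refine le_trans ?_ ((h₁ x hx z).trans
      (key ‖z‖ hK₁ (by linarith) (by linarith) (by positivity)))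
    simp only [partialDeriv_partialDeriv_halfGradSq hV.contDiff]
    exact le_rfl
  · exact (h₂ x hx z).trans (key ‖z‖ hK₂ (by linarith) (by linarith) (by positivity))
  · have := h₃ x hx z 1 (by simp)
    rw [one_smul, add_comm] at this
    refine this.trans ?_
    have := key ‖z‖ hK₃ (k' := K₁ + K₂ + K₃ + K₄ + (∑ i, ∑ j, |L i j|))
      (e := c₃) (e' := c₁ + c₂ + c₃ + c₄) (by linarith) (by linarith) zero_le_one
    simpa using this
  · have := h₄ x hx z 1 (by simp)
    rw [one_smul, add_comm] at this
    refine this.trans ?_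
    have := key ‖z‖ hK₄ (k' := K₁ + K₂ + K₃ + K₄ + (∑ i, ∑ j, |L i j|))
      (e := c₄) (e' := c₁ + c₂ + c₃ + c₄) (by linarith) (by linarith) zero_le_one
    simpa using this
  · have h5 := hL i j x (mem_closedBall_zero_iff.2 hx)
    have h6 : |L i j| ≤ ∑ i, ∑ j, |L i j| :=
      (Finset.single_le_sum (f := fun j => |L i j|) (fun _ _ => abs_nonneg _)
        (Finset.mem_univ j)).trans (Finset.single_le_sum (f := fun i => ∑ j, |L i j|)
          (fun _ _ => Finset.sum_nonneg fun _ _ => abs_nonneg _) (Finset.mem_univ i))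
    linarith [le_abs_self (L i j)]

end PotentialBounds

/-- Expand the square; cyclicity of the trace makes the two cross terms equal to `Tr H`. -/
theorem frobInner_sub_sq_inv {d : ℕ} {H A : Matrix (Fin d) (Fin d) ℝ} (hs : (A⁻¹).IsSymm)
    (h1 : A * A⁻¹ = 1) (h2 : A⁻¹ * A = 1) :
    frobInner ((H - A) ^ 2) A⁻¹ = (H ^ 2 * A⁻¹).trace - 2 * H.trace + A.trace := by
  have e : (H - A) ^ 2 * A⁻¹ = H ^ 2 * A⁻¹ - H * (A * A⁻¹) - A * (H * A⁻¹) + A * (A * A⁻¹) := by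
    noncomm_ring
  have e2 : (A * (H * A⁻¹)).trace = H.trace := by
    rw [Matrix.trace_mul_comm, Matrix.mul_assoc, h2, mul_one]
  rw [frobInner, hs.eq, e, h1, mul_one, mul_one, Matrix.trace_add, Matrix.trace_sub,
    Matrix.trace_sub, e2]
  ring

namespace IsBridgeLaw

variable {d : ℕ} {ε a β : ℝ} {A X Y : ℝ → Matrix (Fin d) (Fin d) ℝ} {ν : Measure (PathSpace d)}

/-- The five errors are: the Taylor remainder, replacing the covariance by `εA⁻¹`, freezing `ΔV` at
`m`, the quadratic term, and the log-determinant. -/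
theorem abs_functionalF_sub_le (hν : IsBridgeLaw ε A ν) (h : IsFundamentalPair ε A X Y)
    (hM : ∀ t ∈ Icc (0 : ℝ) 1, fundamentalMatrix ε A 1 t = X 1 * Y t)
    (hε : 0 < ε) (hε1 : ε ≤ 1) (ha : 0 < a) (hA : MemH1Mat a A) (hβ : 0 < β)
    (hβ' : 4 * (β * d) * (ε / a) ≤ 1) {V : EuclideanSpace ℝ (Fin d) → ℝ} (hV : ContDiff ℝ 5 V)
    {m : ℝ → EuclideanSpace ℝ (Fin d)} (hm : ContinuousOn m (Icc 0 1)) {M K c b γ : ℝ}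
    (hmM : ∀ t ∈ Icc (0 : ℝ) 1, ‖m t‖ ≤ M) (hK : HasPotentialBounds V M K c) (hcβ : 2 * c ≤ β)
    (hb : ε * h1NormSq A ≤ b) :
    Integrable (pathPotentialIntegral V ε m) ν ∧ Integrable (pathQuadraticIntegral ε A) ν ∧
    |functionalF V γ ε m A ν - (functionalE V ε m
        + 1 / 4 * (∫ t in (0 : ℝ)..1, frobInner ((hessianMatrix V (m t) - A t) ^ 2) (A t)⁻¹)
        + 1 / 4 * (∫ t in (0 : ℝ)..1, frobInner (thirdDerivGradMatrix V (m t)) (A t)⁻¹)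
        + ε ^ γ * h1NormSq A)|
      ≤ (2 * ε)⁻¹ * (K * (9 * (√β)⁻¹ ^ 3) * (1 + d * 2))
        + 1 / 4 * (√ε * (d ^ 2 * (K * (1 + (2 * a)⁻¹ * (d ^ 2 * a⁻¹ ^ 2)
          + (2 * a)⁻¹ ^ 2 * a⁻¹ ^ 4 * b + d * a⁻¹ ^ 2))))
        + 1 / 2 * (K * (√β)⁻¹ * (1 + d * 2))
        + 1 / 4 * (ε * ((3 * d ^ 3 * a⁻¹ + d ^ 4 * a⁻¹ ^ 2) * (1 + h1NormSq A)))
        + ε / 2 * (d * (Real.log (1 + 2 * (d * (1 + h1NormSq A)) / ε)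
          + |Real.log (ε / (2 * a))|)) := by
  have := hν.gaussian
  have hfc := (contDiff_halfGradSq hV).continuous
  have hgc := (contDiff_laplacian hV).continuous
  set S : EuclideanSpace ℝ (Fin d) → Matrix (Fin d) (Fin d) ℝ :=
    fun x => hessianMatrix V x ^ 2 + thirdDerivGradMatrix V x with hS
  have hHc : ContinuousOn (fun t => hessianMatrix V (m t)) (Icc 0 1) :=
    (continuous_hessianMatrix hV).comp_continuousOn hm
  have hTc : ContinuousOn (fun t => thirdDerivGradMatrix V (m t)) (Icc 0 1) :=
    (continuous_thirdDerivGradMatrix hV).comp_continuousOn hm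
  have hSc : ContinuousOn (fun t => S (m t)) (Icc 0 1) := (hHc.pow 2).add hTc
  have hIc : ContinuousOn (fun t => (A t)⁻¹) (Icc 0 1) := continuousOn_pi.2 fun i =>
    continuousOn_pi.2 fun j => (hA.ac_inv ha i j).continuousOn_unit
  have hCc : ContinuousOn (fun t => freeCov X Y t - bridgeCorr X Y t) (Icc 0 1) :=
    (h.continuousOn_freeCov hA).sub h.continuousOn_bridgeCorr
  have cI : ∀ {u : ℝ → ℝ}, ContinuousOn u (Icc 0 1) → IntervalIntegrable u volume 0 1 :=
    fun hu => intervalIntegrable_of_continuousOn_unit hu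
  -- integrability on the product space
  have hcβ1 : c ≤ β := by linarith
  have pf := hν.integrable_prod_comp h hε ha hA hβ hβ' hfc hm hK.nonneg hcβ1
    fun t ht => hK.halfGradSq_le _ (hmM t ht)
  have pg := hν.integrable_prod_comp h hε ha hA hβ hβ' hgc hm hK.nonneg hcβ1
    fun t ht => hK.laplacian_le _ (hmM t ht)
  obtain ⟨i1, eΨ⟩ := hν.integral_pathPotentialIntegral pf pg
  obtain ⟨i2, eB⟩ := hν.integral_pathQuadraticIntegral h hε ha hA hβ hβ'
  refine ⟨i1, i2, ?_⟩
  have iEf : IntervalIntegrable (fun t => ∫ z, halfGradSq V (pathEval z t + m t) ∂ν) volume 0 1 :=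
    (intervalIntegrable_iff_integrableOn_Ioc_of_le zero_le_one).2 pf.integral_prod_right
  have iEg : IntervalIntegrable (fun t => ∫ z, (Δ V) (pathEval z t + m t) ∂ν) volume 0 1 :=
    (intervalIntegrable_iff_integrableOn_Ioc_of_le zero_le_one).2 pg.integral_prod_right
  have if' : IntervalIntegrable (fun t => halfGradSq V (m t)) volume 0 1 :=
    cI (hfc.comp_continuousOn hm)
  have ig : IntervalIntegrable (fun t => (Δ V) (m t)) volume 0 1 := cI (hgc.comp_continuousOn hm)
  have iSC : IntervalIntegrable
      (fun t => (S (m t) * (freeCov X Y t - bridgeCorr X Y t)).trace) volume 0 1 :=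
    cI (continuousOn_matrix_trace (hSc.mul hCc))
  have iSA : IntervalIntegrable (fun t => (S (m t) * (A t)⁻¹).trace) volume 0 1 :=
    cI (continuousOn_matrix_trace (hSc.mul hIc))
  have iA := cI (continuousOn_matrix_trace hA.continuousOn)
  -- the five error terms
  have unitBound : ∀ {u : ℝ → ℝ} {κ : ℝ}, (∀ t ∈ Icc (0 : ℝ) 1, |u t| ≤ κ) →
      |∫ t in (0 : ℝ)..1, u t| ≤ κ := fun {u κ} hu => by
    have := intervalIntegral.norm_integral_le_of_norm_le_const (a := (0 : ℝ)) (b := 1)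
      (f := u) (C := κ) fun t ht => by
        rw [uIoc_of_le zero_le_one] at ht
        exact hu t (Ioc_subset_Icc_self ht)
    simpa using this
  have r1 : |∫ t in (0 : ℝ)..1, ((∫ z, halfGradSq V (pathEval z t + m t) ∂ν) - halfGradSq V (m t)
      - 1 / 2 * (S (m t) * (freeCov X Y t - bridgeCorr X Y t)).trace)|
      ≤ K * (9 * (√β)⁻¹ ^ 3) * (1 + d * 2) := unitBound fun t ht => hν.abs_integral_sub_taylor_le h hε ha hA hβ hβ' hfc hK.nonneg
    hcβ (hK.taylor (m t) (hmM t ht)) ht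
  have r2 : |∫ t in (0 : ℝ)..1, ((∫ z, (Δ V) (pathEval z t + m t) ∂ν) - (Δ V) (m t))|
      ≤ K * (√β)⁻¹ * (1 + d * 2) := unitBound fun t ht => hν.abs_integral_sub_le h hε ha hA hβ hβ' hgc hK.nonneg
    hcβ (hK.laplacian_sub (m t) (hmM t ht)) ht
  have r3 := h.abs_integral_trace_mul_cov_sub_le hε ha hA hSc hK.nonneg
    (fun t ht => hK.apply_le _ (hmM t ht)) hε1 hb
  have r4 := h.abs_integral_trace_schrodingerPotential_sub_le hε ha hA
    fun t ht i => hν.bridgeCorr_le_freeCov h hε ha hA ht i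
  have r5 := h.abs_log_det_le hε ha hA hM
  rw [intervalIntegral.integral_sub (iEf.sub if') (iSC.const_mul _),
    intervalIntegral.integral_sub iEf if', intervalIntegral.integral_const_mul] at r1
  rw [intervalIntegral.integral_sub iEg ig] at r2
  -- the deterministic integrals
  have eJ : (∫ t in (0 : ℝ)..1, frobInner ((hessianMatrix V (m t) - A t) ^ 2) (A t)⁻¹)
      + (∫ t in (0 : ℝ)..1, frobInner (thirdDerivGradMatrix V (m t)) (A t)⁻¹)
      = (∫ t in (0 : ℝ)..1, (S (m t) * (A t)⁻¹).trace) - 2 * (∫ t in (0 : ℝ)..1, (Δ V) (m t))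
        + ∫ t in (0 : ℝ)..1, (A t).trace := by
    have hTr : ContinuousOn (fun t => ((A t)⁻¹)ᵀ) (Icc 0 1) :=
      continuous_id.matrix_transpose.comp_continuousOn hIc
    have j1 : IntervalIntegrable
        (fun t => frobInner ((hessianMatrix V (m t) - A t) ^ 2) (A t)⁻¹) volume 0 1 :=
      cI (continuousOn_matrix_trace (((hHc.sub hA.continuousOn).pow 2).mul hTr))
    have j2 : IntervalIntegrable
        (fun t => frobInner (thirdDerivGradMatrix V (m t)) (A t)⁻¹) volume 0 1 :=
      cI (continuousOn_matrix_trace (hTc.mul hTr))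
    rw [← intervalIntegral.integral_add j1 j2, ← intervalIntegral.integral_const_mul,
      ← intervalIntegral.integral_sub iSA (ig.const_mul 2),
      ← intervalIntegral.integral_add (iSA.sub (ig.const_mul 2)) iA]
    refine intervalIntegral.integral_congr fun t ht => ?_
    rw [uIcc_of_le zero_le_one] at ht
    rw [frobInner_sub_sq_inv (hA.isSymm_inv ht) (hA.mul_inv ha ht) (hA.inv_mul ha ht),
      laplacian_eq_trace hV, frobInner, (hA.isSymm_inv ht).eq, hS, Matrix.add_mul,
      Matrix.trace_add]
    ring
  have eE : ∫ t in (0 : ℝ)..1, ‖∇ V (m t)‖ ^ 2 = 2 * ∫ t in (0 : ℝ)..1, halfGradSq V (m t) := by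
    rw [← intervalIntegral.integral_const_mul]
    refine intervalIntegral.integral_congr fun t _ => ?_
    simp only [halfGradSq]
    ring
  rw [functionalF, modifiedKL, functionalE, eΨ, eB, eE]
  set IE := ∫ t in (0 : ℝ)..1, ∫ z, halfGradSq V (pathEval z t + m t) ∂ν
  set IEg := ∫ t in (0 : ℝ)..1, ∫ z, (Δ V) (pathEval z t + m t) ∂ν
  set If := ∫ t in (0 : ℝ)..1, halfGradSq V (m t)
  set Ig := ∫ t in (0 : ℝ)..1, (Δ V) (m t)
  set IS := ∫ t in (0 : ℝ)..1, (S (m t) * (freeCov X Y t - bridgeCorr X Y t)).trace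
  set ISA := ∫ t in (0 : ℝ)..1, (S (m t) * (A t)⁻¹).trace
  set IA := ∫ t in (0 : ℝ)..1, (A t).trace
  set IB := ∫ t in (0 : ℝ)..1,
    (schrodingerPotential ε A t * (freeCov X Y t - bridgeCorr X Y t)).trace
  set J₁ := ∫ t in (0 : ℝ)..1, frobInner ((hessianMatrix V (m t) - A t) ^ 2) (A t)⁻¹
  set J₂ := ∫ t in (0 : ℝ)..1, frobInner (thirdDerivGradMatrix V (m t)) (A t)⁻¹
  set D := ∫ t in (0 : ℝ)..1, ‖deriv m t‖ ^ 2
  set ℓ := Real.log (fundamentalGram ε A).det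
  have hJ : J₁ = ISA - 2 * Ig + IA - J₂ := by linarith
  -- Exact decomposition into these errors; the kinetic terms and the `H¹` penalties cancel.
  have key : ε * (1 / (2 * ε ^ 2) * (IE - ε * IEg) + 1 / 4 * D - 1 / 4 * IB + 1 / (2 * ε) * IA
      + 1 / 2 * ℓ) + ε ^ γ * h1NormSq A
      - (ε / 4 * D + 1 / (4 * ε) * (2 * If) + 1 / 4 * J₁ + 1 / 4 * J₂ + ε ^ γ * h1NormSq A)
      = (2 * ε)⁻¹ * (IE - If - 1 / 2 * IS) + 1 / 4 * (ε⁻¹ * IS - ISA) + -(1 / 2 * (IEg - Ig))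
        + -(1 / 4 * (ε * IB - IA)) + ε / 2 * ℓ := by
    rw [hJ]
    field_simp
    ring
  rw [key]
  have mulBound : ∀ {k u w : ℝ}, 0 ≤ k → |u| ≤ w → |k * u| ≤ k * w := fun {k u w} hk hu => by
    rw [abs_mul, abs_of_nonneg hk]
    exact mul_le_mul_of_nonneg_left hu hk
  refine (abs_add_le _ _).trans (add_le_add ((abs_add_le _ _).trans (add_le_add
    ((abs_add_le _ _).trans (add_le_add ((abs_add_le _ _).trans (add_le_add ?_ ?_)) ?_)) ?_)) ?_)
  · exact mulBound (by positivity) r1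
  · exact mulBound (by norm_num) r3
  · rw [abs_neg]; exact mulBound (by norm_num) r2
  · rw [abs_neg]; exact mulBound (by norm_num) r4
  · exact mulBound (by positivity) r5

end IsBridgeLaw

/-! ## Asymptotics -/

theorem ContinuousOn.norm_le_of_eLpNorm_top_le {E : Type*} [NormedAddCommGroup E] {u : ℝ → E}
    (hu : ContinuousOn u (Icc 0 1)) {M : ℝ≥0}
    (h : eLpNorm u ⊤ (volume.restrict (Ioo 0 1)) ≤ M) : ∀ t ∈ Icc (0 : ℝ) 1, ‖u t‖ ≤ M := by
  -- The a.e. inequality is phrased as an equality of continuous functions, which then holds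
  -- everywhere on the closed interval.
  have h1 : ∀ᵐ t ∂(volume.restrict (Icc (0 : ℝ) 1)), max ‖u t‖ M = M := by
    rw [← restrict_Ioo_eq_restrict_Icc]
    rw [eLpNorm_exponent_top] at h
    filter_upwards [ae_le_eLpNormEssSup (f := u) (μ := volume.restrict (Ioo 0 1))] with t ht
    refine max_eq_right ?_
    have := ht.trans h
    rw [enorm_eq_nnnorm, ENNReal.coe_le_coe] at this
    exact_mod_cast this
  intro t ht
  have h2 := Measure.eqOn_Icc_of_ae_eq volume zero_ne_one (f := fun t => max ‖u t‖ M)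
    (g := fun _ => (M : ℝ)) h1 (hu.norm.sup continuousOn_const) continuousOn_const ht
  exact max_eq_right_iff.1 h2

theorem eventually_le_of_limsup_lt_top {α : Type*} {l : Filter α} {u : α → ℝ≥0∞}
    (h : limsup u l < ⊤) : ∃ M : ℝ≥0, ∀ᶠ x in l, u x ≤ M := by
  obtain ⟨M, hM, -⟩ := ENNReal.lt_iff_exists_nnreal_btwn.1 h
  exact ⟨M, (eventually_lt_of_limsup_lt hM).mono fun _ hx => hx.le⟩

theorem mul_neg_log_le_sqrt {ε : ℝ} (hε : 0 < ε) : ε * -Real.log ε ≤ 2 * √ε := by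
  have h1 := Real.log_le_rpow_div (x := ε⁻¹) (ε := 1 / 2) (by positivity) (by norm_num)
  rw [Real.log_inv, ← Real.sqrt_eq_rpow, Real.sqrt_inv] at h1
  calc ε * -Real.log ε ≤ ε * ((√ε)⁻¹ / (1 / 2)) := by gcongr
    _ = 2 * √ε := by
      have : 0 < √ε := Real.sqrt_pos.2 hε
      nth_rewrite 1 [← Real.mul_self_sqrt hε.le]
      field_simp

/-- The logarithmic error terms are of order `√ε`. -/
theorem mul_log_error_le {ε D N C a : ℝ} (hε : 0 < ε) (hε1 : ε ≤ 1) (hD : 0 ≤ D) (hN : 0 ≤ N)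
    (hC : ε * N ≤ C) (ha : 0 < a) :
    ε * (Real.log (1 + 2 * (D * (1 + N)) / ε) + |Real.log (ε / (2 * a))|)
      ≤ √ε * (6 + Real.log (1 + 2 * (D * (1 + C))) + |Real.log (2 * a)|) := by
  have hs : 0 < √ε := Real.sqrt_pos.2 hε
  have hC0 : 0 ≤ C := (by positivity : 0 ≤ ε * N).trans hC
  have hle : ε ≤ √ε := Real.le_sqrt_of_sq_le (by nlinarith)
  have hlog : Real.log ε ≤ 0 := Real.log_nonpos hε.le hε1
  -- One power of `ε` is explicit; the second is spent on `N`, which may be as large as `C/ε`.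
  have h1 : 1 + 2 * (D * (1 + N)) / ε ≤ (1 + 2 * (D * (1 + C))) / ε ^ 2 := by
    rw [le_div_iff₀ (by positivity), add_mul]
    have e1 : 2 * (D * (1 + N)) / ε * ε ^ 2 = 2 * (D * (ε + ε * N)) := by field_simp
    rw [e1]
    have e2 : D * (ε + ε * N) ≤ D * (1 + C) := by gcongr
    nlinarith
  have h2 : Real.log (1 + 2 * (D * (1 + N)) / ε)
      ≤ Real.log (1 + 2 * (D * (1 + C))) + 2 * -Real.log ε := by
    refine (Real.log_le_log (by positivity) h1).trans_eq ?_
    rw [Real.log_div (by positivity) (by positivity), Real.log_pow]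
    push_cast
    ring
  have h3 : |Real.log (ε / (2 * a))| ≤ -Real.log ε + |Real.log (2 * a)| := by
    rw [Real.log_div hε.ne' (by positivity)]
    refine (abs_sub _ _).trans ?_
    rw [abs_of_nonpos hlog]
  have h4 := mul_neg_log_le_sqrt hε
  have h5 : 0 ≤ Real.log (1 + 2 * (D * (1 + C))) :=
    Real.log_nonneg (by nlinarith [mul_nonneg hD (by linarith : 0 ≤ 1 + C)])
  calc ε * (Real.log (1 + 2 * (D * (1 + N)) / ε) + |Real.log (ε / (2 * a))|)
      ≤ ε * ((Real.log (1 + 2 * (D * (1 + C))) + 2 * -Real.log ε)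
        + (-Real.log ε + |Real.log (2 * a)|)) := by gcongr
    _ = 3 * (ε * -Real.log ε)
        + ε * (Real.log (1 + 2 * (D * (1 + C))) + |Real.log (2 * a)|) := by ring
    _ ≤ 3 * (2 * √ε) + √ε * (Real.log (1 + 2 * (D * (1 + C))) + |Real.log (2 * a)|) := by gcongr
    _ = _ := by ring

theorem proposition4p4 {d : ℕ} (V : EuclideanSpace ℝ (Fin d) → ℝ)
    (hV : IsAdmissiblePotential V) (xm xp : EuclideanSpace ℝ (Fin d))
    (a : ℝ) (ha : 0 < a) (γ : ℝ) (hγ : γ ∈ Ioo (0 : ℝ) (1 / 2))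
    (m : ℝ → ℝ → EuclideanSpace ℝ (Fin d)) (A : ℝ → ℝ → Matrix (Fin d) (Fin d) ℝ)
    (hm : ∀ ε > 0, MemH1Bdry xm xp (m ε)) (hA : ∀ ε > 0, MemH1Mat a (A ε))
    (hAbdd : limsup (fun ε : ℝ => ENNReal.ofReal (ε ^ γ * h1NormSq (A ε))) (𝓝[>] 0) < ⊤)
    (hmbdd : limsup (fun ε : ℝ => eLpNorm (m ε) ⊤ (volume.restrict (Ioo 0 1))) (𝓝[>] 0) < ⊤)
    (ν : ℝ → Measure (PathSpace d)) (hν : ∀ ε > 0, IsBridgeLaw ε (A ε) (ν ε)) :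
    (∀ᶠ ε : ℝ in 𝓝[>] 0, Integrable (pathPotentialIntegral V ε (m ε)) (ν ε) ∧
      Integrable (pathQuadraticIntegral ε (A ε)) (ν ε)) ∧
    (fun ε : ℝ => functionalF V γ ε (m ε) (A ε) (ν ε)
      - (functionalE V ε (m ε)
        + 1 / 4 * (∫ t in (0 : ℝ)..1,
            frobInner ((hessianMatrix V (m ε t) - A ε t) ^ 2) (A ε t)⁻¹)
        + 1 / 4 * (∫ t in (0 : ℝ)..1,
            frobInner (thirdDerivGradMatrix V (m ε t)) (A ε t)⁻¹)
        + ε ^ γ * h1NormSq (A ε)))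
      =O[𝓝[>] 0] fun ε : ℝ => ε ^ (1 / 2 : ℝ) := by
  obtain ⟨C, hC⟩ := eventually_le_of_limsup_lt_top hAbdd
  obtain ⟨M, hM⟩ := eventually_le_of_limsup_lt_top hmbdd
  obtain ⟨K, c, hK⟩ := hV.exists_hasPotentialBounds M
  have hK0 := hK.nonneg
  -- With `β = b₀/ε` the moment condition becomes `d/(d + 1) ≤ 1`; using `d + 1` also covers `d =
  -- 0`.
  set b₀ : ℝ := a / (4 * (d + 1)) with hb₀
  have hb₀p : 0 < b₀ := by positivity
  set q : ℝ := (√b₀)⁻¹ with hq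
  have hq0 : 0 ≤ q := by positivity
  set L : ℝ := 1 / 2 * (K * (9 * q ^ 3) * (1 + d * 2))
        + 1 / 4 * (d ^ 2 * (K * (1 + (2 * a)⁻¹ * (d ^ 2 * a⁻¹ ^ 2)
          + (2 * a)⁻¹ ^ 2 * a⁻¹ ^ 4 * C + d * a⁻¹ ^ 2)))
        + 1 / 2 * (K * q * (1 + d * 2))
        + 1 / 4 * ((3 * d ^ 3 * a⁻¹ + d ^ 4 * a⁻¹ ^ 2) * (1 + C))
        + 1 / 2 * (d * (6 + Real.log (1 + 2 * (d * (1 + C))) + |Real.log (2 * a)|)) with hL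
  -- The second condition is `2c ≤ β`: the Gaussian weight beats the growth of the potential.
  have hsmall : ∀ᶠ ε : ℝ in 𝓝[>] 0, ε ≤ 1 ∧ 2 * c * ε ≤ b₀ := by
    refine nhdsWithin_le_nhds ((eventually_le_nhds one_pos).and ?_)
    have : Tendsto (fun ε : ℝ => 2 * c * ε) (𝓝 0) (𝓝 0) :=
      Continuous.tendsto' (by fun_prop) _ _ (by simp)
    exact this.eventually_le_const hb₀p
  have key : ∀ᶠ ε : ℝ in 𝓝[>] 0, Integrable (pathPotentialIntegral V ε (m ε)) (ν ε) ∧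
      Integrable (pathQuadraticIntegral ε (A ε)) (ν ε) ∧
      |functionalF V γ ε (m ε) (A ε) (ν ε)
        - (functionalE V ε (m ε)
        + 1 / 4 * (∫ t in (0 : ℝ)..1,
            frobInner ((hessianMatrix V (m ε t) - A ε t) ^ 2) (A ε t)⁻¹)
        + 1 / 4 * (∫ t in (0 : ℝ)..1,
            frobInner (thirdDerivGradMatrix V (m ε t)) (A ε t)⁻¹)
        + ε ^ γ * h1NormSq (A ε))| ≤ L * √ε := by
    filter_upwards [hC, hM, hsmall, self_mem_nhdsWithin] with ε hCε hMε ⟨hε1, hcε⟩ hε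
    have hε : 0 < ε := hε
    have hmc := (hm ε hε).1.1.continuousOn_unit
    obtain ⟨X, Y, hXY, hfund⟩ := exists_isFundamentalPair ε (hA ε hε).continuousOn_apply
    have hN := MemH1Mat.h1NormSq_nonneg (A ε)
    set N := h1NormSq (A ε) with hNdef
    have hs : 0 < √ε := Real.sqrt_pos.2 hε
    have hss : √ε * √ε = ε := Real.mul_self_sqrt hε.le
    have hs1 : √ε ≤ 1 := Real.sqrt_le_one.2 hε1
    have hεs : ε ≤ √ε := by nlinarith
    have hCN : ε ^ γ * N ≤ C := by
      have := ENNReal.toReal_mono ENNReal.coe_ne_top hCε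
      rwa [ENNReal.toReal_ofReal (by positivity), ENNReal.coe_toReal] at this
    have hεN : ε * N ≤ √ε * C := by
      -- The point where `γ < ½` enters: `εN ≤ √ε·(ε^γ N)`.
      have h1 : √ε ≤ ε ^ γ := by
        rw [Real.sqrt_eq_rpow]
        exact Real.rpow_le_rpow_of_exponent_ge hε hε1 hγ.2.le
      calc ε * N = √ε * (√ε * N) := by rw [← mul_assoc, hss]
        _ ≤ √ε * (ε ^ γ * N) := by gcongr
        _ ≤ √ε * C := by gcongr
    have hεNC : ε * N ≤ C := hεN.trans (mul_le_of_le_one_left C.2 hs1)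
    have hβs : (√(b₀ / ε))⁻¹ = q * √ε := by
      rw [Real.sqrt_div hb₀p.le, inv_div, hq, div_eq_inv_mul]
    have hβ' : 4 * (b₀ / ε * d) * (ε / a) ≤ 1 := by
      have e : 4 * (b₀ / ε * d) * (ε / a) = d / (d + 1) := by
        rw [hb₀]
        field_simp
      rw [e]
      exact div_le_one_of_le₀ (by linarith) (by positivity)
    obtain ⟨h1, h2, h3⟩ := (hν ε hε).abs_functionalF_sub_le hXY hfund hε hε1 ha (hA ε hε)
      (β := b₀ / ε) (by positivity) hβ' hV.contDiff hmc (γ := γ)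
      (hmc.norm_le_of_eLpNorm_top_le hMε) hK
      (by rwa [le_div_iff₀ hε]) hεNC
    refine ⟨h1, h2, h3.trans ?_⟩
    rw [hβs]
    -- The cubic moment `ε^{3/2}` divided by `ε` fixes the rate `√ε`.
    have t1 : (2 * ε)⁻¹ * (K * (9 * (q * √ε) ^ 3) * (1 + d * 2))
        = (1 / 2 * (K * (9 * q ^ 3) * (1 + d * 2))) * √ε := by
      have : (√ε) ^ 3 = ε * √ε := by rw [pow_succ, sq, hss]
      rw [mul_pow, this]
      field_simp
    have t4 : ε * ((3 * d ^ 3 * a⁻¹ + d ^ 4 * a⁻¹ ^ 2) * (1 + N))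
        ≤ √ε * ((3 * d ^ 3 * a⁻¹ + d ^ 4 * a⁻¹ ^ 2) * (1 + C)) := by
      have h4 : ε * (1 + N) ≤ √ε * (1 + C) := by linarith
      calc _ = (3 * d ^ 3 * a⁻¹ + d ^ 4 * a⁻¹ ^ 2) * (ε * (1 + N)) := by ring
        _ ≤ (3 * d ^ 3 * a⁻¹ + d ^ 4 * a⁻¹ ^ 2) * (√ε * (1 + C)) := by gcongr
        _ = _ := by ring
    have t5 := mul_log_error_le hε hε1 (Nat.cast_nonneg (α := ℝ) d) hN hεNC ha
    have t5' := mul_le_mul_of_nonneg_left t5 (by positivity : (0 : ℝ) ≤ 1 / 2 * d)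
    rw [t1, hL]
    rw [show ∀ u v w x y s : ℝ, (u + v + w + x + y) * s = u * s + v * s + w * s + x * s + y * s by
      intros; ring]
    refine add_le_add (add_le_add (add_le_add (add_le_add le_rfl ?_) ?_) ?_) ?_
    · exact le_of_eq (by ring)
    · exact le_of_eq (by ring)
    · exact (mul_le_mul_of_nonneg_left t4 (by norm_num)).trans_eq (by ring)
    · refine le_trans (le_of_eq ?_) (t5'.trans_eq ?_) <;> ring
  refine ⟨key.mono fun ε h => ⟨h.1, h.2.1⟩, Asymptotics.IsBigO.of_bound L ?_⟩
  filter_upwards [key] with ε h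
  rw [← Real.sqrt_eq_rpow, Real.norm_eq_abs, Real.norm_of_nonneg (Real.sqrt_nonneg ε)]
  exact h.2.2
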